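/- Let $v\ge 0$, $n\ge 0$, $w\ge 1$, $m=4w+1$, let $T\ge 1$, and let $\phi_{i,j}\in\{0,\pi/4,\dots,7\pi/4\}$ ($1\le i\le n$, $1\le j\le m$) be target angles. Notation: $R_Z(\phi)=\mathrm{diag}(1,e^{i\phi})$, $R_X(\phi)=HR_Z(\phi)H$, $|\pm\rangle_\phi=R_Z(\phi)|\pm\rangle$; angles are modulo $2\pi$. *Brickwork graph.* Its vertices are the $(i,j)$. Every row is a path, and for every tape $y=1,\dots,w$ and every $i<n$ with $i+y$ even (a *brick* on rows $i,i+1$ of tape $y$) there are vertical edges $(i,j)\sim(i+1,j)$ for $j=4y-1$ and $j=4y+1$. *Target computation $\mathcal F_A$.* On the logical state $|+\rangle^{\otimes n}$ one applies, for $y=1,\dots,w$: $R_Z^\dagger(\phi_{i,4y-1})R_X^\dagger(\phi_{i,4y-2})R_Z^\dagger(\phi_{i,4y-3})$ on every row $i$; $cZ$ on the two rows of every brick of tape $y$; $R_X^\dagger(\phi_{i,4y})$ on every row $i$; the same $cZ$ gates again. Finally row $i$ is measured in the basis $|\pm\rangle_{\phi_{i,m}}$, and the $n$ outcomes are the output.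 $\mathcal F_A$ is the channel that reads $\phi$ from Alice's register and writes this random output there, marked as accepted. *Protocol 2 with $v$ traps, honest Bob, and at most $T$ attempts to prepare each qubit.* Alice's register initially holds $\phi$ and the following independent uniformly random choices: $v_t\in\{1,\dots,v+1\}$; for every $k\in\{1,\dots,v+1\}$ and vertex, $r^{(k)}_{i,j},r'^{(k)}_{i,j}\in\{0,1\}$ and $\theta^{(k)}_{i,j}\in\{0,\pi/4,\dots,7\pi/4\}$; for every $k$, the choice between an R-trap and a C-trap and all coins and angles used in the traps. All qubits are initially $|0\rangle$. For $k=1,\dots,v+1$: 1. *Angles.* $\phi^{(v_t)}=\phi$. For $k\ne v_t$, $\phi^{(k)}$ is an R-trap or a C-trap. All trap angles not mentioned are $0$. R-trap, row $i$: let $q$ be the parity of the number of Hadamard tapes of the row before the current tape. Tape $y<w$ is a Hadamard tape iff its fair coin shows $0$; tape $w$ is one iff $q=1$. A Hadamard tape has $\phi_{i,4y-3}=\phi_{i,4y-2}=\phi_{i,4y-1}=\pi/2$. A tape that is not a Hadamard tape has random $\phi_{i,4y-3},\phi_{i,4y-1}$ if $q=0$, and random $\phi_{i,4y-2}$ if $q=1$.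 The angle $\phi_{i,m}$ is minus the sum of all these random angles of row $i$. C-trap: for every row a coin decides whether $\phi_{i,1}=\pi$ and $z_i=\pi$, or $\phi_{i,1}=0$ and $z_i=0$. For every brick a coin decides which of its rows is the control $c$, the other being the target $t$; then $\phi_{c,4y-1}=\pi/2$, $\phi_{t,4y-2}=\pi/2$, $\phi_{t,4y}=-\pi/2$, and, tape by tape, $z_c$ is replaced by $z_c+z_t$. The angle $\phi_{i,m}$ is the final $z_i$. 2. *State preparation.* For every vertex $(i,j)$: Alice asks Bob for eight qubits, Bob creates $|+\rangle_\tau$ for $\tau=0,\pi/4,\dots,7\pi/4$ and sends them; Alice measures the qubit $\tau$ in the basis $|\pm\rangle_\tau$. If all outcomes are $0$, she sends back the qubit with $\tau=\theta^{(k)}_{i,j}+\pi\sum_{(i',j')\sim(i,j)}r'^{(k)}_{i',j'}$ and discards the others; otherwise she restarts, and after $T$ failed attempts she rejects. 3. *Computation.* Bob applies $cZ$ along all edges. For $j=1,\dots,m$ and $i=1,\dots,n$, Bob sends qubit $(i,j)$ and Alice measures it in the basis $|\pm\rangle_\delta$, $\delta=(-1)^{r'^{(k)}_{i,j}}\big((-1)^{s_X}\phi^{(k)}_{i,j}+s_Z\pi\big)+\theta^{(k)}_{i,j}+r^{(k)}_{i,j}\pi$,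 and records $s^{(k)}_{i,j}=(\text{outcome})\oplus r^{(k)}_{i,j}$. Here $s_X=s^{(k)}_{i,j-1}$ ($0$ if $j=1$), and $s_Z$ is the parity of the $s^{(k)}_{a,b}$ over all $(a,b)\ne(i,j)$ with $b<m$ and $(a,b+1)\sim(i,j)$. 4. *Verification.* If $k\neq v_t$ and $(s^{(k)}_{1,m},\dots,s^{(k)}_{n,m})\ne(0,\dots,0)$, Alice rejects. At the end Alice keeps only the output: $(s^{(v_t)}_{i,m})_{i=1}^n$, marked as accepted, or "reject". **Theorem.** Protocol 2 is correct: with Alice's register $A$, Bob's register $B$, the common register $C$, the above input state $\rho_{\mathrm{in}}$ and the output state $\rho_{\mathrm{out}}$ of the honest run, $$D\big(\mathrm{Tr}_{BC}[\mathcal F_A(\rho_{\mathrm{in}})],\mathrm{Tr}_{BC}[\rho_{\mathrm{out}}]\big)=0,\qquad D(\rho,\sigma)=\tfrac12\mathrm{Tr}|\rho-\sigma|.$$ In particular the honest run is never rejected. -/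

import Mathlib

noncomputable section

namespace BrickworkVerification

open Matrix
open scoped Kronecker

/-! ### Channels, trace distance, two-party protocols -/

/-- A completely positive trace preserving map on the operators of the Hilbert space with
orthonormal basis `ι`, given by finitely many Kraus operators. -/
structure KrausMap (ι : Type) [Fintype ι] [DecidableEq ι] where
  /-- labels of the Kraus operators -/
  κ : Type
  [fin : Fintype κ]
  /-- the Kraus operators -/
  op : κ → Matrix ι ι ℂ
  tp : ∑ u, (op u)ᴴ * op u = 1

attribute [instance] KrausMap.fin

open scoped MatrixOrder Matrix.Norms.L2Operator in
/-- The trace distance `D(ρ, σ) = (1/2) Tr |ρ - σ|`. -/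
def traceDistance {ι : Type} [Fintype ι] [DecidableEq ι] (ρ σ : Matrix ι ι ℂ) : ℝ :=
  (1 / 2) * (CFC.abs (ρ - σ)).trace.re

section Registers

variable {A B C : Type} [Fintype A] [DecidableEq A] [Fintype B] [DecidableEq B]
  [Fintype C] [DecidableEq C]

/-- The identity channel. -/
def KrausMap.idle (ι : Type) [Fintype ι] [DecidableEq ι] : KrausMap ι where
  κ := Unit
  op := fun _ => 1
  tp := by simp

/-- The operator `K` on `A ⊗ C`, extended by the identity on `B`. -/
def liftAC (K : Matrix (A × C) (A × C) ℂ) : Matrix (A × B × C) (A × B × C) ℂ :=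
  Matrix.of fun x y => if x.2.1 = y.2.1 then K (x.1, x.2.2) (y.1, y.2.2) else 0

/-- The operator `K` on `B ⊗ C`, extended by the identity on `A`. -/
def liftBC (K : Matrix (B × C) (B × C) ℂ) : Matrix (A × B × C) (A × B × C) ℂ :=
  Matrix.of fun x y => if x.1 = y.1 then K x.2 y.2 else 0

/-- The operator `K` on `A`, extended by the identity on `B ⊗ C`. -/
def liftA (K : Matrix A A ℂ) : Matrix (A × B × C) (A × B × C) ℂ :=
  Matrix.of fun x y => if x.2 = y.2 then K x.1 y.1 else 0

/-- A channel on `A ⊗ C` acting on a state of `A ⊗ B ⊗ C`. -/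
def KrausMap.applyAC (E : KrausMap (A × C)) (ρ : Matrix (A × B × C) (A × B × C) ℂ) :
    Matrix (A × B × C) (A × B × C) ℂ :=
  ∑ u, liftAC (E.op u) * ρ * (liftAC (E.op u))ᴴ

/-- A channel on `B ⊗ C` acting on a state of `A ⊗ B ⊗ C`. -/
def KrausMap.applyBC (E : KrausMap (B × C)) (ρ : Matrix (A × B × C) (A × B × C) ℂ) :
    Matrix (A × B × C) (A × B × C) ℂ :=
  ∑ u, liftBC (E.op u) * ρ * (liftBC (E.op u))ᴴ

/-- A channel on `A` acting on a state of `A ⊗ B ⊗ C`. -/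
def KrausMap.applyA (E : KrausMap A) (ρ : Matrix (A × B × C) (A × B × C) ℂ) :
    Matrix (A × B × C) (A × B × C) ℂ :=
  ∑ u, liftA (E.op u) * ρ * (liftA (E.op u))ᴴ

/-- The partial trace over Bob's register `B` and the common register `C`. -/
def traceBC (ρ : Matrix (A × B × C) (A × B × C) ℂ) : Matrix A A ℂ :=
  Matrix.of fun a a' => ∑ x : B × C, ρ (a, x) (a', x)

/-- One step of a protocol: a channel of Alice (on her register `A` and the common register `C`),
followed by a channel of Bob (on his register `B` and the common register `C`). -/
abbrev Step (A B C : Type) [Fintype A] [DecidableEq A] [Fintype B] [DecidableEq B]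
    [Fintype C] [DecidableEq C] : Type 1 :=
  KrausMap (A × C) × KrausMap (B × C)

/-- A step in which only Alice acts. -/
def aliceStep (E : KrausMap (A × C)) : Step A B C := (E, KrausMap.idle _)

/-- A step in which only Bob acts. -/
def bobStep (E : KrausMap (B × C)) : Step A B C := (KrausMap.idle _, E)

/-- A protocol is a finite sequence of steps. -/
abbrev Protocol (A B C : Type) [Fintype A] [DecidableEq A] [Fintype B] [DecidableEq B]
    [Fintype C] [DecidableEq C] : Type 1 :=
  List (Step A B C)

/-- The output state of a protocol on an input state. -/
def Protocol.run (P : Protocol A B C) (ρ : Matrix (A × B × C) (A × B × C) ℂ) :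
    Matrix (A × B × C) (A × B × C) ℂ :=
  P.foldl (fun σ st => st.2.applyBC (st.1.applyAC σ)) ρ

/-- A protocol is correct, on the input `ρ` and for the channel `F` that Alice wants to apply, if
its output and the output of `F` agree on Alice's register, up to trace distance zero. -/
def Protocol.IsCorrect (P : Protocol A B C) (F : KrausMap A)
    (ρ : Matrix (A × B × C) (A × B × C) ℂ) : Prop :=
  traceDistance (traceBC (F.applyA ρ)) (traceBC (P.run ρ)) = 0

/-- Alice's register is a classical memory. Depending on its content `a` she applies the
instrument with Kraus operators `K a o` to the common register, and on obtaining the outcome `o`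
she changes her memory to `f a o`. -/
def instrument {O : Type} [Fintype O] (f : A → O → A) (K : A → O → Matrix C C ℂ)
    (hK : ∀ a, ∑ o, (K a o)ᴴ * K a o = 1) : KrausMap (A × C) where
  κ := A × O
  op := fun u => Matrix.single (f u.1 u.2) u.1 1 ⊗ₖ K u.1 u.2
  tp := by
    simp only [conjTranspose_kronecker, ← mul_kronecker_mul, conjTranspose_single, star_one,
      single_mul_single_same, mul_one]
    rw [Fintype.sum_prod_type]
    have h : ∀ a : A, ∑ o : O, Matrix.single a a (1 : ℂ) ⊗ₖ ((K a o)ᴴ * K a o)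
        = Matrix.single a a (1 : ℂ) ⊗ₖ (1 : Matrix C C ℂ) := by
      intro a
      rw [← hK a]
      ext x y
      simp [kroneckerMap_apply, Matrix.sum_apply, Finset.mul_sum]
    simp only [h]
    ext x y
    have := congrFun (congrFun (Matrix.sum_single_one (m := A) (α := ℂ)) x.1) y.1
    rw [Matrix.sum_apply] at this
    simp only [Matrix.sum_apply, kroneckerMap_apply, ← Finset.sum_mul, this]
    rw [← kroneckerMap_apply (· * ·), one_kronecker_one]

/-- The instrument that changes nothing and reports the outcome `0`. -/
def idleOp {O : Type} [DecidableEq O] [Zero O] (o : O) : Matrix C C ℂ := if o = 0 then 1 else 0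

lemma idleOp_tp {O : Type} [Fintype O] [DecidableEq O] [Zero O] :
    ∑ o : O, (idleOp o : Matrix C C ℂ)ᴴ * idleOp o = 1 := by
  have : ∀ o : O, (idleOp o : Matrix C C ℂ)ᴴ * idleOp o = if o = 0 then 1 else 0 := by
    intro o
    unfold idleOp
    split_ifs <;> simp
  simp [this]

/-- A unitary as a channel. -/
def KrausMap.ofUnitary {ι : Type} [Fintype ι] [DecidableEq ι] (U : Matrix ι ι ℂ)
    (hU : U ∈ unitaryGroup ι ℂ) : KrausMap ι where
  κ := Unit
  op := fun _ => U
  tp := by simpa [star_eq_conjTranspose] using mem_unitaryGroup_iff'.1 hU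

end Registers

/-! ### Qubits

The computational basis of a qubit is indexed by `Fin 2`, and that of a family `J` of qubits by
`J → Fin 2`. The angle `l π / 4` is represented by `l : ZMod 8`; so `π` is `4` and `π / 2` is
`2`. Bits are elements of `Fin 2`, whose addition is the exclusive or. -/

/-- The Hadamard gate. -/
def hadamard : Matrix (Fin 2) (Fin 2) ℂ :=
  ((Real.sqrt 2 : ℝ) : ℂ)⁻¹ • !![1, 1; 1, -1]

/-- `R_Z(φ) = diag(1, exp(i φ))` for `φ = l π / 4`; here
`ZMod.stdAddChar l = exp(2 π i l / 8) = exp(i φ)`. -/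
def rotZ (l : ZMod 8) : Matrix (Fin 2) (Fin 2) ℂ :=
  !![1, 0; 0, ZMod.stdAddChar l]

/-- `R_X(φ) = H R_Z(φ) H`. -/
def rotX (l : ZMod 8) : Matrix (Fin 2) (Fin 2) ℂ := hadamard * rotZ l * hadamard

/-- `R_Z(φ)|+⟩` for `s = 0` and `R_Z(φ)|-⟩` for `s = 1`. -/
def ketXY (l : ZMod 8) (s : Fin 2) : Fin 2 → ℂ := fun b => (rotZ l * hadamard) b s

/-- The projection onto `ketXY l s`. -/
def projXY (l : ZMod 8) (s : Fin 2) : Matrix (Fin 2) (Fin 2) ℂ :=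
  vecMulVec (ketXY l s) (star (ketXY l s))

/-- The tensor product of single-qubit operators. -/
def tensorOp {J : Type} [Fintype J] (U : J → Matrix (Fin 2) (Fin 2) ℂ) :
    Matrix (J → Fin 2) (J → Fin 2) ℂ :=
  Matrix.of fun x y => ∏ i, U i (x i) (y i)

/-- The tensor product of single-qubit vectors. -/
def tensorKet {J : Type} [Fintype J] (k : J → Fin 2 → ℂ) : (J → Fin 2) → ℂ :=
  fun x => ∏ i, k i (x i)

lemma hadamard_mem : hadamard ∈ unitaryGroup (Fin 2) ℂ := by
  rw [mem_unitaryGroup_iff', star_eq_conjTranspose]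
  have h2 : (((Real.sqrt 2 : ℝ) : ℂ)⁻¹) * ((Real.sqrt 2 : ℝ) : ℂ)⁻¹ = 1 / 2 := by
    rw [← mul_inv, ← Complex.ofReal_mul, Real.mul_self_sqrt (by norm_num)]
    norm_num
  ext i j
  fin_cases i <;> fin_cases j <;>
    simp [hadamard, Matrix.mul_apply, Fin.sum_univ_two, Complex.conj_ofReal,
      h2] <;> norm_num

lemma rotZ_mem (l : ZMod 8) : rotZ l ∈ unitaryGroup (Fin 2) ℂ := by
  rw [mem_unitaryGroup_iff', star_eq_conjTranspose]
  have h : (starRingEnd ℂ) (ZMod.stdAddChar l) * ZMod.stdAddChar l = 1 := by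
    rw [← Complex.normSq_eq_conj_mul_self, ZMod.stdAddChar_apply, Circle.normSq_coe]
    simp
  ext i j
  fin_cases i <;> fin_cases j <;> simp [rotZ, Matrix.mul_apply, Fin.sum_univ_two, h]

lemma rotX_mem (l : ZMod 8) : rotX l ∈ unitaryGroup (Fin 2) ℂ :=
  mul_mem (mul_mem hadamard_mem (rotZ_mem l)) hadamard_mem

lemma conjTranspose_mem {ι : Type} [Fintype ι] [DecidableEq ι] {U : Matrix ι ι ℂ}
    (hU : U ∈ unitaryGroup ι ℂ) : Uᴴ ∈ unitaryGroup ι ℂ := by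
  simpa [star_eq_conjTranspose] using Unitary.star_mem hU

section Tensor

variable {J : Type} [Fintype J]

lemma tensorOp_mul [DecidableEq J] (U V : J → Matrix (Fin 2) (Fin 2) ℂ) :
    tensorOp U * tensorOp V = tensorOp (fun i => U i * V i) := by
  ext x y
  simp only [tensorOp, Matrix.mul_apply, Matrix.of_apply, Finset.prod_univ_sum,
    Fintype.piFinset_univ, Finset.prod_mul_distrib]

lemma tensorOp_conjTranspose (U : J → Matrix (Fin 2) (Fin 2) ℂ) :
    (tensorOp U)ᴴ = tensorOp (fun i => (U i)ᴴ) := by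
  ext x y
  simp [tensorOp, conjTranspose_apply]

lemma tensorOp_one : tensorOp (fun _ : J => (1 : Matrix (Fin 2) (Fin 2) ℂ)) = 1 := by
  ext x y
  simp only [tensorOp, Matrix.of_apply, Matrix.one_apply]
  by_cases h : x = y
  · simp [h]
  · rw [if_neg h]
    obtain ⟨i, hi⟩ := Function.ne_iff.1 h
    exact Finset.prod_eq_zero (Finset.mem_univ i) (by simp [hi])

lemma tensorOp_mem [DecidableEq J] {U : J → Matrix (Fin 2) (Fin 2) ℂ} (hU : ∀ i, U i ∈ unitaryGroup (Fin 2) ℂ) :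
    tensorOp U ∈ unitaryGroup (J → Fin 2) ℂ := by
  rw [mem_unitaryGroup_iff', star_eq_conjTranspose, tensorOp_conjTranspose, tensorOp_mul,
    ← tensorOp_one]
  congr 1
  funext i
  simpa [star_eq_conjTranspose] using mem_unitaryGroup_iff'.1 (hU i)

lemma sum_tensorOp [DecidableEq J] (P : J → Fin 2 → Matrix (Fin 2) (Fin 2) ℂ) :
    ∑ o : J → Fin 2, tensorOp (fun i => P i (o i)) = tensorOp (fun i => ∑ s, P i s) := by
  ext x y
  simp only [tensorOp, Matrix.sum_apply, Matrix.of_apply, Finset.prod_univ_sum,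
    Fintype.piFinset_univ]

lemma sum_tensorOp_update [DecidableEq J] {O : Type} [Fintype O] (j : J) (P : O → Matrix (Fin 2) (Fin 2) ℂ) :
    ∑ o, tensorOp (Function.update (fun _ : J => 1) j (P o))
      = tensorOp (Function.update (fun _ : J => 1) j (∑ o, P o)) := by
  ext x y
  simp only [tensorOp, Matrix.sum_apply, Matrix.of_apply]
  have h : ∀ M : Matrix (Fin 2) (Fin 2) ℂ,
      ∏ i, (Function.update (fun _ : J => (1 : Matrix (Fin 2) (Fin 2) ℂ)) j M) i (x i) (y i)
        = M (x j) (y j) * ∏ i ∈ Finset.univ.erase j,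
          (1 : Matrix (Fin 2) (Fin 2) ℂ) (x i) (y i) := by
    intro M
    rw [← Finset.mul_prod_erase _ _ (Finset.mem_univ j)]
    congr 1
    · simp
    · refine Finset.prod_congr rfl fun i hi => ?_
      rw [Function.update_of_ne (Finset.ne_of_mem_erase hi)]
  simp only [h, ← Finset.sum_mul, Matrix.sum_apply]

lemma diagonal_sign_mem {ι : Type} [Fintype ι] [DecidableEq ι] {d : ι → ℂ}
    (hd : ∀ x, d x = 1 ∨ d x = -1) : Matrix.diagonal d ∈ unitaryGroup ι ℂ := by
  rw [mem_unitaryGroup_iff', star_eq_conjTranspose, diagonal_conjTranspose, diagonal_mul_diagonal,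
    ← diagonal_one]
  congr 1
  funext x
  rcases hd x with h | h <;> simp [h]

end Tensor

lemma prod_sign {J : Type} (s : Finset J) {f : J → ℂ} (h : ∀ i, f i = 1 ∨ f i = -1) :
    ∏ i ∈ s, f i = 1 ∨ ∏ i ∈ s, f i = -1 := by
  classical
  induction s using Finset.induction_on with
  | empty => simp
  | insert a s ha ih =>
    rw [Finset.prod_insert ha]
    rcases h a with h | h <;> rcases ih with ih | ih <;> simp [h, ih]

lemma ketXY_mem (l : ZMod 8) : rotZ l * hadamard ∈ unitaryGroup (Fin 2) ℂ :=
  mul_mem (rotZ_mem l) hadamard_mem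

lemma projXY_tp (l : ZMod 8) (s : Fin 2) : (projXY l s)ᴴ * projXY l s = projXY l s := by
  have h := congrFun (congrFun (mem_unitaryGroup_iff'.1 (ketXY_mem l)) s) s
  have h1 : star (ketXY l s) ⬝ᵥ ketXY l s = 1 := by
    rw [star_eq_conjTranspose, Matrix.mul_apply] at h
    simpa only [dotProduct, ketXY, conjTranspose_apply, Pi.star_apply, one_apply_eq] using h
  have h2 : (projXY l s)ᴴ = projXY l s := by
    simp [projXY, conjTranspose_vecMulVec]
  rw [h2]
  unfold projXY
  rw [vecMulVec_mul_vecMulVec, h1, one_smul]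

lemma sum_projXY (l : ZMod 8) : ∑ s, projXY l s = 1 := by
  have h := mem_unitaryGroup_iff.1 (ketXY_mem l)
  rw [← h]
  ext i j
  rw [star_eq_conjTranspose, Matrix.mul_apply, Matrix.sum_apply]
  simp only [projXY, ketXY, vecMulVec_apply, conjTranspose_apply, Pi.star_apply]

/-! ### The brickwork state

Rows are numbered `0, …, n - 1` and columns `0, …, 4 w`, so that there are `m = 4 w + 1` columns.
The tapes are numbered `0, …, w - 1`, and tape `t` consists of the columns
`4 t, 4 t + 1, 4 t + 2, 4 t + 3`. -/

/-- The physical qubits of a brickwork state: row and column. -/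
abbrev Vertex (n w : ℕ) : Type := Fin n × Fin (4 * w + 1)

/-- The position `p` of tape `t`. -/
def col {w : ℕ} (t : Fin w) (p : Fin 4) : Fin (4 * w + 1) := ⟨4 * t + p, by omega⟩

/-- In tape `t` there is a brick with upper row `i` and lower row `j`. -/
abbrev bricked (t i j : ℕ) : Prop := i + 1 = j ∧ Even (i + t)

/-- The edges of the brickwork graph, each in one direction: every row is a path, and each brick
of tape `t` adds the two vertical edges in the columns `4 t + 2` and `4 t + 4`. -/
abbrev linked {n w : ℕ} (u u' : Vertex n w) : Prop :=
  (u.1 = u'.1 ∧ (u.2 : ℕ) + 1 = u'.2) ∨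
    (u.2 = u'.2 ∧ ∃ t : Fin w, bricked t u.1 u'.1 ∧
      ((u.2 : ℕ) = 4 * t + 2 ∨ (u.2 : ℕ) = 4 * t + 4))

/-- The brickwork graph. -/
def brickworkGraph (n w : ℕ) : SimpleGraph (Vertex n w) := SimpleGraph.fromRel linked

instance (n w : ℕ) : DecidableRel (brickworkGraph n w).Adj := fun u u' =>
  inferInstanceAs (Decidable (u ≠ u' ∧ (linked u u' ∨ linked u' u)))

/-- A product of controlled-Z gates on the pairs `(u, u')` with `R u u'`. -/
def cZ {J : Type} [Fintype J] [DecidableEq J] (R : J → J → Prop) [DecidableRel R] :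
    Matrix (J → Fin 2) (J → Fin 2) ℂ :=
  Matrix.diagonal fun x => ∏ u, ∏ u', if R u u' ∧ x u = 1 ∧ x u' = 1 then -1 else 1

lemma cZ_mem {J : Type} [Fintype J] [DecidableEq J] (R : J → J → Prop) [DecidableRel R] :
    cZ R ∈ unitaryGroup (J → Fin 2) ℂ :=
  diagonal_sign_mem fun _ => prod_sign _ fun _ => prod_sign _ fun _ => by
    split_ifs <;> simp

/-! ### The target computation -/

/-- The layer of controlled-Z gates of the bricks of tape `t`, on the logical qubits. -/
def brickLayer (n t : ℕ) : Matrix (Fin n → Fin 2) (Fin n → Fin 2) ℂ :=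
  cZ fun i j : Fin n => bricked t i j

/-- The logical unitary of tape `t`. -/
def tapeUnitary {n w : ℕ} (φ : Vertex n w → ZMod 8) (t : Fin w) :
    Matrix (Fin n → Fin 2) (Fin n → Fin 2) ℂ :=
  brickLayer n t *
    tensorOp (fun i => (rotX (φ (i, col t 3)))ᴴ) *
    brickLayer n t *
    tensorOp (fun i =>
      (rotZ (φ (i, col t 2)))ᴴ * (rotX (φ (i, col t 1)))ᴴ * (rotZ (φ (i, col t 0)))ᴴ)

/-- The logical circuit: tape `0` first, tape `w - 1` last. -/
def logicalCircuit {n w : ℕ} (φ : Vertex n w → ZMod 8) :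
    Matrix (Fin n → Fin 2) (Fin n → Fin 2) ℂ :=
  ((List.finRange w).map (tapeUnitary φ)).reverse.prod

/-- The amplitude of the outcome `o` when the logical circuit is applied to `|+⟩ ⊗ … ⊗ |+⟩` and
every logical qubit is then measured in the `XY`-plane by the angle of the last column. -/
def targetAmplitude {n w : ℕ} (φ : Vertex n w → ZMod 8) (o : Fin n → Fin 2) : ℂ :=
  star (tensorKet fun i => ketXY (φ (i, Fin.last _)) (o i)) ⬝ᵥ
    (logicalCircuit φ *ᵥ tensorKet fun _ => ketXY 0 0)

lemma logicalCircuit_mem {n w : ℕ} (φ : Vertex n w → ZMod 8) :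
    logicalCircuit φ ∈ unitaryGroup (Fin n → Fin 2) ℂ := by
  refine Submonoid.list_prod_mem _ fun U hU => ?_
  rw [List.mem_reverse, List.mem_map] at hU
  obtain ⟨t, -, rfl⟩ := hU
  have hb : brickLayer n t ∈ unitaryGroup (Fin n → Fin 2) ℂ := cZ_mem _
  exact mul_mem (mul_mem (mul_mem hb (tensorOp_mem fun i => conjTranspose_mem (rotX_mem _))) hb)
    (tensorOp_mem fun i => mul_mem (mul_mem (conjTranspose_mem (rotZ_mem _))
      (conjTranspose_mem (rotX_mem _))) (conjTranspose_mem (rotZ_mem _)))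

lemma sum_targetAmplitude {n w : ℕ} (φ : Vertex n w → ZMod 8) :
    ∑ o, star (targetAmplitude φ o) * targetAmplitude φ o = 1 := by
  set T : Matrix (Fin n → Fin 2) (Fin n → Fin 2) ℂ :=
    tensorOp fun i => rotZ (φ (i, Fin.last _)) * hadamard
  set T₀ : Matrix (Fin n → Fin 2) (Fin n → Fin 2) ℂ := tensorOp fun _ => rotZ 0 * hadamard
  have hM : Tᴴ * (logicalCircuit φ * T₀) ∈ unitaryGroup (Fin n → Fin 2) ℂ :=
    mul_mem (conjTranspose_mem (tensorOp_mem fun i => ketXY_mem _))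
      (mul_mem (logicalCircuit_mem φ) (tensorOp_mem fun i => ketXY_mem _))
  have hA : ∀ o, targetAmplitude φ o = (Tᴴ * (logicalCircuit φ * T₀)) o 0 := fun o => rfl
  have h := congrFun (congrFun (mem_unitaryGroup_iff'.1 hM) 0) 0
  rw [star_eq_conjTranspose, Matrix.mul_apply] at h
  simpa [hA] using h

/-! ### The traps -/

/-- The number of Hadamards on row `i` before tape `t`, for coin outcomes `c`. -/
def hadamardsBefore {n w : ℕ} (c : Fin n → Fin w → Fin 2) (i : Fin n) (t : Fin w) : ℕ :=
  (Finset.univ.filter fun t' : Fin w => t' < t ∧ c i t' = 0).card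

/-- In an R-trap, row `i` undergoes a Hadamard in tape `t`: before the last tape this is decided
by the coin, and in the last tape by the parity of the number of Hadamards so far. -/
abbrev isHadamard {n w : ℕ} (c : Fin n → Fin w → Fin 2) (i : Fin n) (t : Fin w) : Prop :=
  if (t : ℕ) + 1 < w then c i t = 0 else Odd (hadamardsBefore c i t)

/-- The angle at position `p` of tape `t` in row `i` of an R-trap, for coin outcomes `c` and random
angles `a`: angles for a Hadamard, a rotation about `Z`, or a rotation about `X`. -/
def rTrapAngle {n w : ℕ} (c : Fin n → Fin w → Fin 2) (a : Vertex n w → ZMod 8)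
    (i : Fin n) (t : Fin w) (p : Fin 4) : ZMod 8 :=
  if isHadamard c i t then (if p = 3 then 0 else 2)
  else if Even (hadamardsBefore c i t) then (if p = 0 ∨ p = 2 then a (i, col t p) else 0)
  else (if p = 1 then a (i, col t p) else 0)

/-- The measurement angles of an R-trap. The angle of a last-column qubit undoes the sum of the
rotations of its row. -/
def rTrap {n w : ℕ} (c : Fin n → Fin w → Fin 2) (a : Vertex n w → ZMod 8) :
    Vertex n w → ZMod 8 := fun u =>
  if h : (u.2 : ℕ) < 4 * w then
    rTrapAngle c a u.1 ⟨u.2 / 4, by omega⟩ ⟨u.2 % 4, by omega⟩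
  else -∑ t : Fin w, if isHadamard c u.1 t then 0 else ∑ p, rTrapAngle c a u.1 t p

/-- In tape `t` of a C-trap there is a CNOT with control `i` and target `j`. The coin of a brick,
indexed by its upper row, decides which of its rows is the control. -/
abbrev isCNOT {n w : ℕ} (c : Fin n → Fin w → Fin 2) (t : Fin w) (i j : Fin n) : Prop :=
  (bricked t i j ∧ c i t = 0) ∨ (bricked t j i ∧ c j t = 1)

/-- The angle at position `p` of tape `t` in row `i` of a C-trap: the rows with initial coin `0`
undergo a Pauli-Z, and each brick a CNOT. -/
def cTrapAngle {n w : ℕ} (c₀ : Fin n → Fin 2) (c : Fin n → Fin w → Fin 2)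
    (i : Fin n) (t : Fin w) (p : Fin 4) : ZMod 8 :=
  if p = 0 then (if (t : ℕ) = 0 ∧ c₀ i = 0 then 4 else 0)
  else if p = 2 then (if ∃ j, isCNOT c t i j then 2 else 0)
  else if ∃ j, isCNOT c t j i then (if p = 1 then 2 else -2) else 0

/-- The `Z`-phase of each row of a C-trap after its first `t` tapes: a CNOT adds the phase of
its target to that of its control. -/
def cTrapPhase {n w : ℕ} (c₀ : Fin n → Fin 2) (c : Fin n → Fin w → Fin 2) :
    ℕ → Fin n → ZMod 8
  | 0 => fun i => if c₀ i = 0 then 4 else 0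
  | t + 1 => fun i => cTrapPhase c₀ c t i +
      if h : t < w then ∑ j, if isCNOT c ⟨t, h⟩ i j then cTrapPhase c₀ c t j else 0 else 0

/-- The measurement angles of a C-trap. -/
def cTrap {n w : ℕ} (c₀ : Fin n → Fin 2) (c : Fin n → Fin w → Fin 2) :
    Vertex n w → ZMod 8 := fun u =>
  if h : (u.2 : ℕ) < 4 * w then
    cTrapAngle c₀ c u.1 ⟨u.2 / 4, by omega⟩ ⟨u.2 % 4, by omega⟩
  else cTrapPhase c₀ c w u.1

/-! ### Alice's memory -/

/-- The random choices of Alice. The `v + 1` computations are indexed by `Fin (v + 1)`. -/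
structure Tape (v n w : ℕ) where
  /-- the index of the target computation -/
  vt : Fin (v + 1)
  /-- for each other computation, whether it is a C-trap or an R-trap -/
  isC : Fin (v + 1) → Bool
  /-- the coins of the R-traps -/
  rCoin : Fin (v + 1) → Fin n → Fin w → Fin 2
  /-- the random angles of the R-traps -/
  rAngle : Fin (v + 1) → Vertex n w → ZMod 8
  /-- the initial coins of the C-traps -/
  cInit : Fin (v + 1) → Fin n → Fin 2
  /-- the coins of the bricks of the C-traps -/
  cCoin : Fin (v + 1) → Fin n → Fin w → Fin 2
  /-- the bits `r` -/
  r : Fin (v + 1) → Vertex n w → Fin 2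
  /-- the bits `r'` -/
  r' : Fin (v + 1) → Vertex n w → Fin 2
  /-- the angles `θ` -/
  θ : Fin (v + 1) → Vertex n w → ZMod 8
  deriving DecidableEq

set_option synthInstance.maxSize 1000 in
instance (v n w : ℕ) : Fintype (Tape v n w) :=
  Fintype.ofInjective
    (fun τ => (τ.vt, τ.isC, τ.rCoin, τ.rAngle, τ.cInit, τ.cCoin, τ.r, τ.r', τ.θ))
    (fun τ τ' h => by
      cases τ
      cases τ'
      simpa using h)

/-- How far the preparation of the current qubit is: Alice waits for eight qubits that pass her
measurements, or they have just passed, or she has sent one of them to Bob. -/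
inductive Status
  | waiting
  | passed
  | sent
  deriving DecidableEq

instance : Fintype Status := ⟨{.waiting, .passed, .sent}, fun x => by cases x <;> simp⟩

/-- The content of Alice's memory. -/
structure Memory (v n w : ℕ) where
  /-- the measurement angles of the target computation -/
  φ : Vertex n w → ZMod 8
  /-- the random choices -/
  tape : Tape v n w
  /-- the status of the current preparation -/
  status : Status
  /-- the recomputed outcomes of the measurements so far -/
  s : Fin (v + 1) → Vertex n w → Fin 2
  /-- whether the run is rejected -/
  rejected : Bool
  /-- the output; `none` stands for rejection, and is also the initial value -/
  out : Option (Fin n → Fin 2)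
  deriving DecidableEq

set_option synthInstance.maxSize 1000 in
instance (v n w : ℕ) : Fintype (Memory v n w) :=
  Fintype.ofInjective
    (fun a => (a.φ, a.tape, a.status, a.s, a.rejected, a.out))
    (fun a a' h => by
      cases a
      cases a'
      simpa using h)

variable {v n w : ℕ}

/-- The memory at the beginning. -/
def Memory.init (φ : Vertex n w → ZMod 8) (τ : Tape v n w) : Memory v n w :=
  ⟨φ, τ, .waiting, 0, false, none⟩

/-- The memory at the end: everything but the output is erased. -/
def Memory.final (v : ℕ) {n : ℕ} (w : ℕ) (o : Option (Fin n → Fin 2)) : Memory v n w :=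
  ⟨0, ⟨0, fun _ => false, 0, 0, 0, 0, 0, 0, 0⟩, .waiting, 0, false, o⟩

/-- The measurement angles of computation `k`: those of the target or those of a trap. -/
def Memory.angle (a : Memory v n w) (k : Fin (v + 1)) : Vertex n w → ZMod 8 :=
  if k = a.tape.vt then a.φ
  else if a.tape.isC k then cTrap (a.tape.cInit k) (a.tape.cCoin k)
  else rTrap (a.tape.rCoin k) (a.tape.rAngle k)

/-- The angle `θ + π ∑ r'` of the state in which the qubit `u` is sent to Bob; the sum is over the
neighbours of `u`. -/
def Memory.prepAngle (a : Memory v n w) (k : Fin (v + 1)) (u : Vertex n w) : ZMod 8 :=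
  a.tape.θ k u +
    ∑ u', if (brickworkGraph n w).Adj u' u ∧ a.tape.r' k u' = 1 then 4 else 0

/-- `s_X` for the qubit `u`: the outcome of its left neighbour in the same row. -/
def Memory.sX (a : Memory v n w) (k : Fin (v + 1)) (u : Vertex n w) : Fin 2 :=
  ∑ u' : Vertex n w, if u'.1 = u.1 ∧ (u'.2 : ℕ) + 1 = u.2 then a.s k u' else 0

/-- `s_Z` for the qubit `u`: the parity of the outcomes of all qubits `u' ≠ u` whose right
neighbour in the same row is a neighbour of `u` in the brickwork graph. -/
def Memory.sZ (a : Memory v n w) (k : Fin (v + 1)) (u : Vertex n w) : Fin 2 :=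
  ∑ u' : Vertex n w, if u' ≠ u ∧ ∃ u'' : Vertex n w, u''.1 = u'.1 ∧ (u'.2 : ℕ) + 1 = u''.2 ∧
    (brickworkGraph n w).Adj u'' u then a.s k u' else 0

/-- `(-1)^b l` for a bit `b` and an angle `l`. -/
def signed (b : Fin 2) (l : ZMod 8) : ZMod 8 := if b = 1 then -l else l

/-- `b π` for a bit `b`. -/
def piBit (b : Fin 2) : ZMod 8 := if b = 1 then 4 else 0

/-- The angle `(-1)^{s_X} φ + s_Z π`, adapted to the previous outcomes. -/
def Memory.adapted (a : Memory v n w) (k : Fin (v + 1)) (u : Vertex n w) : ZMod 8 :=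
  signed (a.sX k u) (a.angle k u) + piBit (a.sZ k u)

/-- The angle `δ = (-1)^{r'} φ + θ + r π` of the measurement of `u`, with adapted `φ`. -/
def Memory.δ (a : Memory v n w) (k : Fin (v + 1)) (u : Vertex n w) : ZMod 8 :=
  signed (a.tape.r' k u) (a.adapted k u) + a.tape.θ k u + piBit (a.tape.r k u)

/-! ### The registers of Bob and the common register -/

/-- Bob's register: the qubits of one brickwork state. -/
abbrev BobReg (n w : ℕ) : Type := Vertex n w → Fin 2

/-- The common register: one bit by which Alice asks for eight qubits, and eight qubits labelled
by the angles in `ZMod 8`. A single qubit is sent at position `0`. -/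
abbrev ComReg : Type := Fin 2 × (ZMod 8 → Fin 2)

/-- If the request bit is `1`, Bob replaces the eight qubits by fresh ones, the qubit at `τ` in
the state `|+⟩_τ`; if it is `0`, he does nothing. -/
def prepareOp (e : ZMod 8 → Fin 2) : Matrix ComReg ComReg ℂ :=
  Matrix.single 1 1 1 ⊗ₖ vecMulVec (tensorKet fun τ => ketXY τ 0) (Pi.single e 1) +
    Matrix.single 0 0 1 ⊗ₖ idleOp e

/-- Only the qubit at `l` is kept and moved to position `0`; the other qubits are discarded and
replaced by `|0⟩`. The values of the discarded qubits are the label `e`. -/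
def keepOp (l : ZMod 8) (e : {τ : ZMod 8 // τ ≠ 0} → Fin 2) :
    Matrix (ZMod 8 → Fin 2) (ZMod 8 → Fin 2) ℂ :=
  Matrix.of fun x y =>
    if x = Pi.single 0 (y l) ∧ (fun τ : {τ : ZMod 8 // τ ≠ 0} => y (Equiv.swap 0 l τ)) = e
    then 1 else 0

/-- The exchange of Bob's qubit `u` and of the common qubit at position `0`. -/
def exchange (u : Vertex n w) : Equiv.Perm (BobReg n w × ComReg) :=
  Function.Involutive.toPerm
    (fun x => (Function.update x.1 u (x.2.2 0), x.2.1, Function.update x.2.2 0 (x.1 u)))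
    (fun x => by ext <;> simp)

lemma one_kronecker_tp {O : Type} [Fintype O] {J L : Type} [Fintype J] [DecidableEq J]
    [Fintype L] [DecidableEq L] {K : O → Matrix L L ℂ} (hK : ∑ o, (K o)ᴴ * K o = 1) :
    ∑ o, ((1 : Matrix J J ℂ) ⊗ₖ K o)ᴴ * ((1 : Matrix J J ℂ) ⊗ₖ K o) = 1 := by
  simp only [conjTranspose_kronecker, ← mul_kronecker_mul, conjTranspose_one, mul_one]
  rw [← one_kronecker_one, ← hK]
  ext x y
  simp [kroneckerMap_apply, Matrix.sum_apply, Finset.mul_sum]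

lemma prepareOp_tp : ∑ e, (prepareOp e)ᴴ * prepareOp e = 1 := by
  set k : (ZMod 8 → Fin 2) → ℂ := tensorKet fun τ => ketXY τ 0 with hk
  have hk1 : star k ⬝ᵥ k = 1 := by
    have h := congrFun (congrFun (mem_unitaryGroup_iff'.1
      (tensorOp_mem fun τ : ZMod 8 => ketXY_mem τ)) 0) 0
    rw [star_eq_conjTranspose, Matrix.mul_apply] at h
    exact h
  have h1 : ∀ e : ZMod 8 → Fin 2,
      (vecMulVec k (Pi.single e 1))ᴴ * vecMulVec k (Pi.single e 1) = Matrix.single e e 1 := by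
    intro e
    rw [conjTranspose_vecMulVec, vecMulVec_mul_vecMulVec, hk1, one_smul]
    ext x y
    by_cases hx : e = x <;> by_cases hy : e = y <;>
      simp [vecMulVec_apply, Matrix.single_apply, Pi.single_apply, hx, hy, eq_comm]
  have h2 : ∀ e, (prepareOp e)ᴴ * prepareOp e =
      Matrix.single 1 1 1 ⊗ₖ Matrix.single e e 1 +
        Matrix.single 0 0 1 ⊗ₖ ((idleOp e)ᴴ * idleOp e) := by
    intro e
    rw [← h1 e]
    simp only [prepareOp, conjTranspose_add, conjTranspose_kronecker, conjTranspose_single,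
      star_one, add_mul, mul_add, ← mul_kronecker_mul, single_mul_single_same, mul_one]
    rw [single_mul_single_of_ne _ _ _ _ (by decide), single_mul_single_of_ne _ _ _ _ (by decide)]
    simp [hk]
  have h3 : ∀ (i : Fin 2) (M : (ZMod 8 → Fin 2) → Matrix (ZMod 8 → Fin 2) (ZMod 8 → Fin 2) ℂ),
      ∑ e, Matrix.single i i (1 : ℂ) ⊗ₖ M e = Matrix.single i i 1 ⊗ₖ ∑ e, M e := by
    intro i M
    ext x y
    simp [kroneckerMap_apply, Matrix.sum_apply, Finset.mul_sum]
  simp only [h2, Finset.sum_add_distrib, h3, idleOp_tp, Matrix.sum_single_one]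
  rw [← add_kronecker]
  have h4 : (Matrix.single 1 1 1 + Matrix.single 0 0 1 : Matrix (Fin 2) (Fin 2) ℂ) = 1 := by
    ext i j
    fin_cases i <;> fin_cases j <;> simp
  rw [h4, one_kronecker_one]

lemma keepOp_tp (l : ZMod 8) : ∑ e, (keepOp l e)ᴴ * keepOp l e = 1 := by
  have hinj : ∀ x y : ZMod 8 → Fin 2, (Pi.single 0 (x l) : ZMod 8 → Fin 2) = Pi.single 0 (y l) →
      (fun τ : {τ : ZMod 8 // τ ≠ 0} => x (Equiv.swap 0 l τ)) =
        (fun τ : {τ : ZMod 8 // τ ≠ 0} => y (Equiv.swap 0 l τ)) → x = y := by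
    intro x y h h'
    funext σ
    by_cases hσ : σ = l
    · subst hσ
      simpa using congrFun h 0
    · have hne : Equiv.swap 0 l σ ≠ 0 := by
        intro h0
        apply hσ
        rw [← Equiv.swap_apply_left (0 : ZMod 8) l]
        exact (Equiv.swap_apply_eq_iff.1 h0)
      simpa using congrFun h' ⟨Equiv.swap 0 l σ, hne⟩
  ext x y
  simp only [Matrix.sum_apply, Matrix.mul_apply, conjTranspose_apply, keepOp, Matrix.of_apply,
    apply_ite star, star_one, star_zero, ite_mul, one_mul, zero_mul]
  rw [Finset.sum_eq_single (fun τ : {τ : ZMod 8 // τ ≠ 0} => x (Equiv.swap 0 l τ))]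
  · rw [Finset.sum_eq_single (Pi.single 0 (x l))]
    · simp only [and_self, if_true, Matrix.one_apply]
      by_cases hxy : x = y
      · simp [hxy]
      · rw [if_neg hxy, if_neg]
        rintro ⟨h, h'⟩
        exact hxy (hinj x y h h'.symm)
    · intro z _ hz
      rw [if_neg fun h => hz h.1]
    · simp
  · intro e _ he
    exact Finset.sum_eq_zero fun z _ => if_neg fun h => he h.2.symm
  · simp

/-! ### The steps of the protocol -/

/-- Alice sets the request bit if and only if she waits for eight qubits. -/
def requestStep : KrausMap (Memory v n w × ComReg) :=
  instrument (O := Fin 2) (fun a _ => a)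
    (fun a o => Matrix.single (if a.status = .waiting then 1 else 0) o 1 ⊗ₖ 1)
    (fun a => by
      simp only [conjTranspose_kronecker, ← mul_kronecker_mul, conjTranspose_single, star_one,
        single_mul_single_same, mul_one, conjTranspose_one]
      rw [← one_kronecker_one, ← Matrix.sum_single_one (m := Fin 2)]
      ext x y
      simp [kroneckerMap_apply, Matrix.sum_apply, add_mul])

/-- Bob prepares eight qubits if he is asked to. -/
def prepareStep : KrausMap (BobReg n w × ComReg) where
  κ := ZMod 8 → Fin 2
  op := fun e => 1 ⊗ₖ prepareOp e
  tp := one_kronecker_tp prepareOp_tp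

/-- If Alice waits for eight qubits, she measures the qubit at `τ` in the basis `|±⟩_τ`, for every
`τ`. The qubits pass if all outcomes are `0`. -/
def testStep : KrausMap (Memory v n w × ComReg) :=
  instrument (O := ZMod 8 → Fin 2)
    (fun a o => if a.status = .waiting ∧ o = 0 then { a with status := .passed } else a)
    (fun a o => if a.status = .waiting then 1 ⊗ₖ tensorOp (fun τ => projXY τ (o τ)) else idleOp o)
    (fun a => by
      by_cases h : a.status = .waiting
      · simp only [h, if_true]
        refine one_kronecker_tp ?_
        simp only [tensorOp_conjTranspose, tensorOp_mul, projXY_tp]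
        rw [sum_tensorOp]
        simp only [sum_projXY, tensorOp_one]
      · simp only [h, if_false]
        exact idleOp_tp)

/-- If the eight qubits have just passed, Alice keeps the one in the state
`R_Z(θ + π ∑ r')|+⟩` in order to send it to Bob, and discards the others. -/
def selectStep (k : Fin (v + 1)) (u : Vertex n w) : KrausMap (Memory v n w × ComReg) :=
  instrument (O := {τ : ZMod 8 // τ ≠ 0} → Fin 2)
    (fun a _ => if a.status = .passed then { a with status := .sent } else a)
    (fun a e => if a.status = .passed then 1 ⊗ₖ keepOp (a.prepAngle k u) e else idleOp e)
    (fun a => by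
      by_cases h : a.status = .passed
      · simp only [h, if_true]
        exact one_kronecker_tp (keepOp_tp _)
      · simp only [h, if_false]
        exact idleOp_tp)

/-- Bob exchanges his qubit `u` and the common qubit at position `0`. -/
def exchangeStep (u : Vertex n w) : KrausMap (BobReg n w × ComReg) :=
  KrausMap.ofUnitary ((exchange u).permMatrix ℂ) (by
    rw [mem_unitaryGroup_iff', star_eq_conjTranspose, conjTranspose_permMatrix,
      ← permMatrix_mul, mul_inv_cancel, permMatrix_one])

/-- After the attempts to prepare a qubit, Alice gets ready for the next one; if no attempt was
successful, she gives up and rejects. -/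
def nextStep : KrausMap (Memory v n w × ComReg) :=
  instrument (O := Unit)
    (fun a _ => { a with status := .waiting, rejected := a.rejected || decide (a.status ≠ .sent) })
    (fun _ _ => 1) (fun _ => by simp)

/-- Bob creates the brickwork state. -/
def entangleStep : KrausMap (BobReg n w × ComReg) :=
  KrausMap.ofUnitary (cZ (linked (n := n) (w := w)) ⊗ₖ 1)
    (kronecker_mem_unitary (cZ_mem _) (one_mem _))

/-- Alice measures the common qubit at position `0` by the angle `δ` and records the outcome,
recomputed as `s ⊕ r`. -/
def measureStep (k : Fin (v + 1)) (u : Vertex n w) : KrausMap (Memory v n w × ComReg) :=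
  instrument (O := Fin 2)
    (fun a o => { a with
      s := Function.update a.s k (Function.update (a.s k) u (o + a.tape.r k u)) })
    (fun a o => 1 ⊗ₖ tensorOp (Function.update (fun _ => 1) 0 (projXY (a.δ k u) o)))
    (fun a => one_kronecker_tp (by
      have h : ∀ P : Matrix (Fin 2) (Fin 2) ℂ,
          (tensorOp (Function.update (fun _ : ZMod 8 => 1) 0 P))ᴴ *
            tensorOp (Function.update (fun _ : ZMod 8 => 1) 0 P) =
          tensorOp (Function.update (fun _ : ZMod 8 => 1) 0 (Pᴴ * P)) := by
        intro P
        rw [tensorOp_conjTranspose, tensorOp_mul]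
        congr 1
        funext i
        by_cases hi : i = 0
        · subst hi
          simp
        · simp [Function.update_of_ne hi]
      simp only [h, projXY_tp]
      rw [sum_tensorOp_update, sum_projXY]
      simpa using tensorOp_one (J := ZMod 8)))

/-- Computation `k` is a trap, and some outcome of its last column is not `0`. -/
abbrev Memory.fails (a : Memory v n w) (k : Fin (v + 1)) : Prop :=
  k ≠ a.tape.vt ∧ ∃ i, a.s k (i, Fin.last _) ≠ 0

/-- If computation `k` is a failed trap, Alice rejects. -/
def verifyStep (k : Fin (v + 1)) : KrausMap (Memory v n w × ComReg) :=
  instrument (O := Unit)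
    (fun a _ => { a with rejected := a.rejected || decide (a.fails k) })
    (fun _ _ => 1) (fun _ => by simp)

/-- Alice outputs the last-column outcomes of the target, or the rejection. -/
def outputStep : KrausMap (Memory v n w × ComReg) :=
  instrument (O := Unit)
    (fun a _ => Memory.final v w
      (if a.rejected then none else some fun i => a.s a.tape.vt (i, Fin.last _)))
    (fun _ _ => 1) (fun _ => by simp)

/-! ### The protocol -/

/-- One attempt to prepare the qubit `u` of computation `k`. It has no effect if a previous attempt
was successful. -/
def attempt (k : Fin (v + 1)) (u : Vertex n w) : Protocol (Memory v n w) (BobReg n w) ComReg :=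
  [(requestStep, prepareStep), aliceStep testStep, aliceStep (selectStep k u)]

/-- The preparation of the qubit `u` of computation `k`, restarted after each failure, with at
most `T` attempts. -/
def preparation (T : ℕ) (k : Fin (v + 1)) (u : Vertex n w) :
    Protocol (Memory v n w) (BobReg n w) ComReg :=
  (List.replicate T (attempt k u)).flatten ++ [bobStep (exchangeStep u), aliceStep nextStep]

/-- Computation `k`: preparation of all qubits, entangling, measurement of all qubits column by
column, verification. -/
def computation (T : ℕ) (k : Fin (v + 1)) : Protocol (Memory v n w) (BobReg n w) ComReg :=
  ((List.finRange n).flatMap fun i =>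
    (List.finRange (4 * w + 1)).flatMap fun j => preparation T k (i, j)) ++
  [bobStep entangleStep] ++
  ((List.finRange (4 * w + 1)).flatMap fun j =>
    (List.finRange n).flatMap fun i =>
      [bobStep (exchangeStep (i, j)), aliceStep (measureStep k (i, j))]) ++
  [aliceStep (verifyStep k)]

/-- The verification protocol with trusted measurements, with `v` traps, on brickwork states with
`n` rows and `4 w + 1` columns, for honest Bob, with at most `T` attempts to prepare each qubit. -/
def measurementProtocol (v n w T : ℕ) : Protocol (Memory v n w) (BobReg n w) ComReg :=
  ((List.finRange (v + 1)).flatMap fun k => computation T k) ++ [aliceStep outputStep]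

/-- The input state: Alice holds the target angles `φ` and uniformly random choices; all qubits
are in the state `|0⟩`. -/
def inputState (v : ℕ) {n w : ℕ} (φ : Vertex n w → ZMod 8) :
    Matrix (Memory v n w × BobReg n w × ComReg) (Memory v n w × BobReg n w × ComReg) ℂ :=
  ∑ τ : Tape v n w, (Fintype.card (Tape v n w) : ℂ)⁻¹ •
    Matrix.single (Memory.init φ τ, 0, 0) (Memory.init φ τ, 0, 0) 1

/-- The channel that Alice wants to apply: it reads the target angles and writes the accepted
outcome `o` of the target computation with its Born probability `|targetAmplitude φ o| ^ 2`. -/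
def targetChannel (v n w : ℕ) : KrausMap (Memory v n w) where
  κ := Memory v n w × (Fin n → Fin 2)
  op := fun u => Matrix.single (Memory.final v w (some u.2)) u.1 (targetAmplitude u.1.φ u.2)
  tp := by
    simp only [conjTranspose_single, single_mul_single_same]
    rw [Fintype.sum_prod_type, ← Matrix.sum_single_one (m := Memory v n w)]
    refine Finset.sum_congr rfl fun a _ => ?_
    rw [← sum_targetAmplitude a.φ]
    ext x y
    simp only [Matrix.sum_apply, Matrix.single_apply]
    split_ifs <;> simp

end BrickworkVerification

end

noncomputable section

namespace BrickworkVerification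

open Matrix
open scoped Kronecker

/-! ### Pure branches of a state -/

section Branches

variable {A B C : Type} [Fintype A] [DecidableEq A] [Fintype B] [DecidableEq B]
  [Fintype C] [DecidableEq C]

/-! The two reduced states already agree for every fixed value of Alice's random choices. By
linearity a run may start from one pure branch `|a⟩ ⊗ ψ` with a definite memory `a`, and each step
turns a branch into a weighted sum of branches. The honest preparation keeps a single branch: Bob's
eight qubits are precisely the states that Alice tests, so the first attempt passes with certainty
(`run_preparations`).

The measurements of one computation give one branch for each record `s` of all outcomes. Angles
depend only on earlier columns, so they can be evaluated on the complete record, and the weight of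
`s` is the squared overlap of the brickwork state with a product of equatorial states
(`run_measurements`, `run_computation`). Up to normalisation this overlap is `graphSum`, a sum over
bit strings of an edge sign times phases. Translating the bit strings by `t` is the stabiliser
symmetry: it preserves the modulus, negates the angles where `t = 1` and adds `π` at the neighbours
of those vertices (`norm_graphSum_stabilizer`). The choice `t = r'` removes Alice's padding, and `t
= s_X` removes the adaptive corrections together with all outcomes outside the last column
(`norm_overlap_measured`). Read column by column, the remaining sum is the matrix product of the
logical circuit (`graphSum_plainAngle`). Hence the outcomes before the last column are uniform, and
the last column has the Born distribution (`norm_overlap_measured_sq`).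

The circuit of a trap ends, up to a scalar, in exactly the product state for which all final
outcomes are `0`. In an R-trap the two brick layers of each tape cancel, and every row merely
collects rotations and an even number of Hadamards (`logicalCircuit_rTrap`); in a C-trap each brick
acts as a CNOT by phase kickback (`cnot_layer`, `logicalCircuit_cTrap`). So branches with a failed
trap have weight zero (`targetAmplitude_trap`). An induction over the computations concludes: a trap
contributes total weight one, the target its Born distribution (`traceBC_run_computations`). -/

/-- The vector `|a⟩ ⊗ ψ`. -/
def branchKet (a : A) (ψ : B × C → ℂ) : A × B × C → ℂ := fun x => if x.1 = a then ψ x.2 else 0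

/-- The (not normalised) pure state `|a⟩ ⊗ ψ`. -/
def branch (a : A) (ψ : B × C → ℂ) : Matrix (A × B × C) (A × B × C) ℂ :=
  vecMulVec (branchKet a ψ) (star (branchKet a ψ))

/-- The tensor product of two vectors. -/
def tens {X Y : Type} (β : X → ℂ) (χ : Y → ℂ) : X × Y → ℂ := fun x => β x.1 * χ x.2

omit [DecidableEq A] in
lemma mul_vecMulVec_mul_conjTranspose (M : Matrix A A ℂ) (k : A → ℂ) :
    M * vecMulVec k (star k) * Mᴴ = vecMulVec (M *ᵥ k) (star (M *ᵥ k)) := by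
  rw [mul_vecMulVec, vecMulVec_mul, star_mulVec]

omit [DecidableEq B] [DecidableEq C] in
lemma kronecker_mulVec_tens (K : Matrix B B ℂ) (L : Matrix C C ℂ) (β : B → ℂ) (χ : C → ℂ) :
    (K ⊗ₖ L) *ᵥ tens β χ = tens (K *ᵥ β) (L *ᵥ χ) := by
  ext x
  simp only [mulVec, dotProduct, tens, kroneckerMap_apply, Fintype.sum_prod_type,
    Finset.sum_mul_sum]
  exact Finset.sum_congr rfl fun _ _ => Finset.sum_congr rfl fun _ _ => by ring

omit [Fintype A] [Fintype B] [DecidableEq B] [Fintype C] [DecidableEq C] in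
lemma branch_smul (a : A) (c : ℂ) (ψ : B × C → ℂ) :
    branch a (c • ψ) = ((‖c‖ ^ 2 : ℝ) : ℂ) • branch a ψ := by
  ext x y
  simp only [branch, vecMulVec_apply, branchKet, Pi.star_apply, Pi.smul_apply, smul_eq_mul,
    Matrix.smul_apply]
  have h : ((‖c‖ ^ 2 : ℝ) : ℂ) = c * star c := by
    rw [Complex.star_def, Complex.mul_conj, Complex.normSq_eq_norm_sq]
  rw [h]
  split_ifs <;> simp; ring

omit [DecidableEq B] [DecidableEq C] in
lemma liftBC_mulVec_branchKet (M : Matrix (B × C) (B × C) ℂ) (a : A) (ψ : B × C → ℂ) :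
    liftBC M *ᵥ branchKet a ψ = branchKet a (M *ᵥ ψ) := by
  ext ⟨a', x⟩
  simp only [mulVec, dotProduct, liftBC, branchKet, Matrix.of_apply, Fintype.sum_prod_type (α₁ := A)]
  rw [Finset.sum_eq_single a]
  · by_cases h : a' = a <;> simp [h]
  · intro b _ hb
    simp [hb]
  · simp

lemma applyBC_branch (E : KrausMap (B × C)) (a : A) (ψ : B × C → ℂ) :
    E.applyBC (branch a ψ) = ∑ u, branch a (E.op u *ᵥ ψ) := by
  simp only [KrausMap.applyBC, branch, mul_vecMulVec_mul_conjTranspose, liftBC_mulVec_branchKet]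

omit [DecidableEq C] in
lemma liftAC_mulVec_branchKet (K : Matrix C C ℂ) (a a₁ a₂ : A) (ψ : B × C → ℂ) :
    liftAC (Matrix.single a₂ a₁ 1 ⊗ₖ K) *ᵥ branchKet a ψ =
      if a₁ = a then branchKet a₂ (((1 : Matrix B B ℂ) ⊗ₖ K) *ᵥ ψ) else 0 := by
  ext ⟨a', b, c⟩
  have hL : (if a₁ = a then branchKet a₂ (((1 : Matrix B B ℂ) ⊗ₖ K) *ᵥ ψ) else 0) (a', b, c) =
      if a₁ = a ∧ a' = a₂ then (((1 : Matrix B B ℂ) ⊗ₖ K) *ᵥ ψ) (b, c) else 0 := by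
    by_cases h : a₁ = a <;> simp [h, branchKet]
  rw [hL]
  simp only [mulVec, dotProduct, liftAC, branchKet, Matrix.of_apply, Fintype.sum_prod_type (α₁ := A),
    kroneckerMap_apply]
  rw [Finset.sum_eq_single a]
  · simp only [↓reduceIte]
    split_ifs with h
    · obtain ⟨rfl, rfl⟩ := h
      refine Finset.sum_congr rfl fun y _ => ?_
      by_cases hb : b = y.1 <;> simp [hb, Matrix.one_apply]
    · refine Finset.sum_eq_zero fun y _ => ?_
      have h' : ¬ (a₂ = a' ∧ a₁ = a) := fun h' => h ⟨h'.2, h'.1.symm⟩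
      simp [h']
  · intro b _ hb
    simp [hb]
  · simp

/-- Only the Kraus operators labelled by the actual memory content act nontrivially on a branch, so
the memory stays classical and the result is a mixture indexed by the outcomes. -/
lemma applyAC_instrument_branch {O : Type} [Fintype O] (f : A → O → A) (K : A → O → Matrix C C ℂ)
    (hK : ∀ a, ∑ o, (K a o)ᴴ * K a o = 1) (a : A) (ψ : B × C → ℂ) :
    (instrument f K hK).applyAC (branch a ψ) =
      ∑ o, branch (f a o) (((1 : Matrix B B ℂ) ⊗ₖ K a o) *ᵥ ψ) := by
  change ∑ u : A × O, liftAC (Matrix.single (f u.1 u.2) u.1 1 ⊗ₖ K u.1 u.2) * branch a ψ *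
    (liftAC (Matrix.single (f u.1 u.2) u.1 1 ⊗ₖ K u.1 u.2))ᴴ = _
  simp only [branch, mul_vecMulVec_mul_conjTranspose, liftAC_mulVec_branchKet,
    Fintype.sum_prod_type]
  rw [Finset.sum_eq_single a]
  · simp
  · intro b _ hb
    refine Finset.sum_eq_zero fun o _ => ?_
    ext x y
    simp [hb, vecMulVec_apply]
  · simp

lemma idle_applyAC (ρ : Matrix (A × B × C) (A × B × C) ℂ) :
    (KrausMap.idle (A × C)).applyAC ρ = ρ := by
  have h : liftAC (B := B) (1 : Matrix (A × C) (A × C) ℂ) = 1 := by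
    ext ⟨a, b, c⟩ ⟨a', b', c'⟩
    simp only [liftAC, Matrix.of_apply, Matrix.one_apply, Prod.mk.injEq]
    by_cases hb : b = b' <;> simp [hb]
  change ∑ _u : Unit, liftAC 1 * ρ * (liftAC 1)ᴴ = ρ
  simp [h]

lemma idle_applyBC (ρ : Matrix (A × B × C) (A × B × C) ℂ) :
    (KrausMap.idle (B × C)).applyBC ρ = ρ := by
  have h : liftBC (A := A) (1 : Matrix (B × C) (B × C) ℂ) = 1 := by
    ext ⟨a, x⟩ ⟨a', x'⟩
    simp only [liftBC, Matrix.of_apply, Matrix.one_apply, Prod.mk.injEq]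
    by_cases ha : a = a' <;> simp [ha]
  change ∑ _u : Unit, liftBC 1 * ρ * (liftBC 1)ᴴ = ρ
  simp [h]

lemma applyAC_sum (E : KrausMap (A × C)) {I : Type*} (s : Finset I)
    (ρ : I → Matrix (A × B × C) (A × B × C) ℂ) :
    E.applyAC (∑ i ∈ s, ρ i) = ∑ i ∈ s, E.applyAC (ρ i) := by
  simp only [KrausMap.applyAC, Finset.mul_sum, Finset.sum_mul]
  exact Finset.sum_comm

lemma applyBC_sum (E : KrausMap (B × C)) {I : Type*} (s : Finset I)
    (ρ : I → Matrix (A × B × C) (A × B × C) ℂ) :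
    E.applyBC (∑ i ∈ s, ρ i) = ∑ i ∈ s, E.applyBC (ρ i) := by
  simp only [KrausMap.applyBC, Finset.mul_sum, Finset.sum_mul]
  exact Finset.sum_comm

lemma applyAC_smul (E : KrausMap (A × C)) (c : ℂ) (ρ : Matrix (A × B × C) (A × B × C) ℂ) :
    E.applyAC (c • ρ) = c • E.applyAC ρ := by
  simp [KrausMap.applyAC, Finset.smul_sum]

lemma applyBC_smul (E : KrausMap (B × C)) (c : ℂ) (ρ : Matrix (A × B × C) (A × B × C) ℂ) :
    E.applyBC (c • ρ) = c • E.applyBC ρ := by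
  simp [KrausMap.applyBC, Finset.smul_sum]

lemma run_append (P Q : Protocol A B C) (ρ : Matrix (A × B × C) (A × B × C) ℂ) :
    Protocol.run (P ++ Q) ρ = Protocol.run Q (Protocol.run P ρ) := by
  simp [Protocol.run, List.foldl_append]

lemma run_cons (st : Step A B C) (P : Protocol A B C) (ρ : Matrix (A × B × C) (A × B × C) ℂ) :
    Protocol.run (st :: P) ρ = Protocol.run P (st.2.applyBC (st.1.applyAC ρ)) := rfl

lemma run_nil (ρ : Matrix (A × B × C) (A × B × C) ℂ) :
    Protocol.run ([] : Protocol A B C) ρ = ρ := rfl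

lemma run_sum (P : Protocol A B C) {I : Type*} (s : Finset I)
    (ρ : I → Matrix (A × B × C) (A × B × C) ℂ) :
    P.run (∑ i ∈ s, ρ i) = ∑ i ∈ s, P.run (ρ i) := by
  induction P generalizing ρ with
  | nil => rfl
  | cons st P ih =>
    simp only [run_cons, applyAC_sum, applyBC_sum, ih]

lemma run_smul (P : Protocol A B C) (c : ℂ) (ρ : Matrix (A × B × C) (A × B × C) ℂ) :
    P.run (c • ρ) = c • P.run ρ := by
  induction P generalizing ρ with
  | nil => rfl
  | cons st P ih => simp only [run_cons, applyAC_smul, applyBC_smul, ih]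

lemma run_aliceStep_cons (E : KrausMap (A × C)) (P : Protocol A B C)
    (ρ : Matrix (A × B × C) (A × B × C) ℂ) :
    Protocol.run (aliceStep E :: P) ρ = Protocol.run P (E.applyAC ρ) := by
  rw [run_cons, aliceStep, idle_applyBC]

lemma run_bobStep_cons (E : KrausMap (B × C)) (P : Protocol A B C)
    (ρ : Matrix (A × B × C) (A × B × C) ℂ) :
    Protocol.run (bobStep E :: P) ρ = Protocol.run P (E.applyBC ρ) := by
  rw [run_cons, bobStep, idle_applyAC]

omit [Fintype A] [DecidableEq A] [DecidableEq B] [DecidableEq C] in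
lemma traceBC_sum {I : Type*} (s : Finset I) (ρ : I → Matrix (A × B × C) (A × B × C) ℂ) :
    traceBC (∑ i ∈ s, ρ i) = ∑ i ∈ s, traceBC (ρ i) := by
  ext a a'
  simp only [traceBC, Matrix.of_apply, Matrix.sum_apply]
  exact Finset.sum_comm

omit [Fintype A] [DecidableEq A] [DecidableEq B] [DecidableEq C] in
lemma traceBC_smul (c : ℂ) (ρ : Matrix (A × B × C) (A × B × C) ℂ) :
    traceBC (c • ρ) = c • traceBC ρ := by
  ext a a'
  simp [traceBC, Finset.mul_sum]

/-- A vector of norm one. -/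
def IsUnitKet {X : Type} [Fintype X] (k : X → ℂ) : Prop := star k ⬝ᵥ k = 1

omit [Fintype A] [DecidableEq B] [DecidableEq C] in
lemma traceBC_branch (a : A) {ψ : B × C → ℂ} (hψ : IsUnitKet ψ) :
    traceBC (branch a ψ) = Matrix.single a a 1 := by
  ext x y
  simp only [traceBC, branch, Matrix.of_apply, vecMulVec_apply, branchKet, Pi.star_apply,
    Matrix.single_apply]
  by_cases hx : a = x
  · by_cases hy : a = y
    · simp only [hx, hy ▸ hx, if_true, and_self]
      rw [← hψ]
      subst hx
      simp [dotProduct, mul_comm]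
    · simp [hy, Ne.symm hy]
  · simp [hx, Ne.symm hx]

omit [DecidableEq B] [DecidableEq C] in
lemma IsUnitKet.tens {β : B → ℂ} {χ : C → ℂ} (hβ : IsUnitKet β) (hχ : IsUnitKet χ) :
    IsUnitKet (tens β χ) := by
  unfold IsUnitKet at *
  rw [← mul_one 1]
  nth_rw 1 [← hβ]
  rw [← hχ]
  simp only [dotProduct, BrickworkVerification.tens, Pi.star_apply, Fintype.sum_prod_type,
    Finset.sum_mul_sum, star_mul']
  exact Finset.sum_congr rfl fun _ _ => Finset.sum_congr rfl fun _ _ => by ring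

/-- If all outcomes of an instrument on a unit vector give multiples of one unit vector, then
their weights add up to one. -/
lemma sum_norm_sq_of_mulVec {O : Type} [Fintype O] {K : O → Matrix C C ℂ}
    (hK : ∑ o, (K o)ᴴ * K o = 1) {χ χ' : C → ℂ} (hχ : IsUnitKet χ) (hχ' : IsUnitKet χ')
    (c : O → ℂ) (h : ∀ o, K o *ᵥ χ = c o • χ') : ∑ o, ((‖c o‖ ^ 2 : ℝ) : ℂ) = 1 := by
  unfold IsUnitKet at *
  rw [← hχ]
  nth_rw 2 [← one_mulVec χ]
  rw [← hK, sum_mulVec, dotProduct_sum]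
  refine Finset.sum_congr rfl fun o _ => ?_
  rw [← mulVec_mulVec, dotProduct_mulVec, ← star_mulVec, h, star_smul, smul_dotProduct,
    dotProduct_smul, hχ', smul_eq_mul, smul_eq_mul, mul_one, Complex.star_def,
    ← Complex.normSq_eq_conj_mul_self, Complex.normSq_eq_norm_sq]

/-- The tool for steps whose outcome carries no information: all outcomes lead to multiples of one
vector, and the squared coefficients sum to one by trace preservation. Outcomes of amplitude zero
may change the memory in any way. -/
lemma applyAC_instrument_tens {O : Type} [Fintype O] {f : A → O → A} {K : A → O → Matrix C C ℂ}
    (hK : ∀ a, ∑ o, (K a o)ᴴ * K a o = 1) (a a' : A) (β : B → ℂ) {χ χ' : C → ℂ}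
    (hχ : IsUnitKet χ) (hχ' : IsUnitKet χ') (c : O → ℂ) (h : ∀ o, K a o *ᵥ χ = c o • χ')
    (ha : ∀ o, c o ≠ 0 → f a o = a') :
    (instrument f K hK).applyAC (branch a (tens β χ)) = branch a' (tens β χ') := by
  rw [applyAC_instrument_branch]
  have : ∀ o, branch (f a o) (((1 : Matrix B B ℂ) ⊗ₖ K a o) *ᵥ tens β χ) =
      ((‖c o‖ ^ 2 : ℝ) : ℂ) • branch a' (tens β χ') := by
    intro o
    have h1 : ((1 : Matrix B B ℂ) ⊗ₖ K a o) *ᵥ tens β χ = c o • tens β χ' := by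
      rw [kronecker_mulVec_tens, h, one_mulVec]
      ext x
      simp only [tens, Pi.smul_apply, smul_eq_mul]
      ring
    rw [h1, branch_smul]
    by_cases h0 : c o = 0
    · simp [h0]
    · rw [ha o h0]
  simp only [this, ← Finset.sum_smul]
  rw [sum_norm_sq_of_mulVec (hK a) hχ hχ' c h, one_smul]

lemma applyBC_tens {O : Type} [Fintype O] {K : O → Matrix C C ℂ}
    (hK : ∑ o, (K o)ᴴ * K o = 1) (a : A) (β : B → ℂ) {χ χ' : C → ℂ}
    (hχ : IsUnitKet χ) (hχ' : IsUnitKet χ') (c : O → ℂ) (h : ∀ o, K o *ᵥ χ = c o • χ') :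
    KrausMap.applyBC ⟨O, fun o => (1 : Matrix B B ℂ) ⊗ₖ K o, one_kronecker_tp hK⟩
      (branch a (tens β χ)) = branch a (tens β χ') := by
  rw [applyBC_branch]
  have : ∀ o, branch a (((1 : Matrix B B ℂ) ⊗ₖ K o) *ᵥ tens β χ) =
      ((‖c o‖ ^ 2 : ℝ) : ℂ) • branch a (tens β χ') := by
    intro o
    have h1 : ((1 : Matrix B B ℂ) ⊗ₖ K o) *ᵥ tens β χ = c o • tens β χ' := by
      rw [kronecker_mulVec_tens, h, one_mulVec]
      ext x
      simp only [tens, Pi.smul_apply, smul_eq_mul]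
      ring
    rw [h1, branch_smul]
  change ∑ o, branch a (((1 : Matrix B B ℂ) ⊗ₖ K o) *ᵥ tens β χ) = _
  simp only [this, ← Finset.sum_smul]
  rw [sum_norm_sq_of_mulVec hK hχ hχ' c h, one_smul]

end Branches

/-! ### Honest preparation of the qubits -/

section Preparation

/-! ### Product vectors of qubits -/

section Qubits

variable {J : Type} [Fintype J] [DecidableEq J]

lemma star_tensorKet_dotProduct (k k' : J → Fin 2 → ℂ) :
    star (tensorKet k) ⬝ᵥ tensorKet k' = ∏ i, star (k i) ⬝ᵥ k' i := by
  have : ∀ x : J → Fin 2, star (tensorKet k) x * tensorKet k' x =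
      ∏ i, star (k i) (x i) * k' i (x i) := by
    intro x
    simp [tensorKet, Finset.prod_mul_distrib]
  simp only [dotProduct, this, Finset.prod_univ_sum, Fintype.piFinset_univ]

lemma IsUnitKet.tensorKet {k : J → Fin 2 → ℂ} (hk : ∀ i, IsUnitKet (k i)) :
    IsUnitKet (tensorKet k) := by
  rw [IsUnitKet, star_tensorKet_dotProduct]
  exact Finset.prod_eq_one fun i _ => hk i

lemma isUnitKet_single {X : Type} [Fintype X] [DecidableEq X] (x : X) :
    IsUnitKet (Pi.single x 1 : X → ℂ) := by
  simp [IsUnitKet]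

lemma star_ketXY_dotProduct (l : ZMod 8) (s t : Fin 2) :
    star (ketXY l s) ⬝ᵥ ketXY l t = if s = t then 1 else 0 := by
  have h := congrFun (congrFun (mem_unitaryGroup_iff'.1 (ketXY_mem l)) s) t
  rw [star_eq_conjTranspose, Matrix.mul_apply, Matrix.one_apply] at h
  rw [← h]
  simp only [dotProduct, ketXY, conjTranspose_apply, Pi.star_apply]

lemma isUnitKet_ketXY (l : ZMod 8) (s : Fin 2) : IsUnitKet (ketXY l s) := by
  rw [IsUnitKet, star_ketXY_dotProduct, if_pos rfl]

omit [DecidableEq J] in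
lemma vecMulVec_star_mulVec (u v w : J → ℂ) :
    vecMulVec u (star v) *ᵥ w = (star v ⬝ᵥ w) • u := by
  rw [vecMulVec_mulVec]
  ext i
  simp [mul_comm]

lemma projXY_mulVec (l : ZMod 8) (s t : Fin 2) :
    projXY l s *ᵥ ketXY l t = if s = t then ketXY l t else 0 := by
  rw [projXY, vecMulVec_star_mulVec, star_ketXY_dotProduct]
  by_cases h : s = t <;> simp [h]

lemma tensorOp_mulVec_tensorKet (U : J → Matrix (Fin 2) (Fin 2) ℂ) (k : J → Fin 2 → ℂ) :
    tensorOp U *ᵥ tensorKet k = tensorKet fun i => U i *ᵥ k i := by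
  ext x
  simp only [mulVec, dotProduct, tensorOp, tensorKet, Matrix.of_apply, Finset.prod_univ_sum,
    Fintype.piFinset_univ, Finset.prod_mul_distrib]

lemma tensorKet_update (k : J → Fin 2 → ℂ) (u : J) (m : Fin 2 → ℂ) (x : J → Fin 2) :
    tensorKet (Function.update k u m) x = m (x u) * ∏ i ∈ Finset.univ.erase u, k i (x i) := by
  rw [tensorKet, ← Finset.mul_prod_erase _ _ (Finset.mem_univ u)]
  congr 1
  · simp
  · exact Finset.prod_congr rfl fun i hi => by
      rw [Function.update_of_ne (Finset.ne_of_mem_erase hi)]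

lemma tensorKet_apply_update (k : J → Fin 2 → ℂ) (u : J) (z : Fin 2) (x : J → Fin 2) :
    tensorKet k (Function.update x u z) = k u z * ∏ i ∈ Finset.univ.erase u, k i (x i) := by
  rw [tensorKet, ← Finset.mul_prod_erase _ _ (Finset.mem_univ u)]
  congr 1
  · simp
  · exact Finset.prod_congr rfl fun i hi => by
      rw [Function.update_of_ne (Finset.ne_of_mem_erase hi)]

omit [DecidableEq J] in
lemma tensorKet_smul (c : J → ℂ) (k : J → Fin 2 → ℂ) :
    (tensorKet fun i => c i • k i) = (∏ i, c i) • tensorKet k := by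
  ext x
  simp [tensorKet, Finset.prod_mul_distrib]

end Qubits

section Tens

variable {X Y : Type}

@[simp]
lemma tens_zero_left (χ : Y → ℂ) : tens (0 : X → ℂ) χ = 0 := by
  ext
  simp [tens]

@[simp]
lemma tens_zero_right (β : X → ℂ) : tens β (0 : Y → ℂ) = 0 := by
  ext
  simp [tens]

lemma tens_smul_left (c : ℂ) (β : X → ℂ) (χ : Y → ℂ) : tens (c • β) χ = c • tens β χ := by
  ext
  simp [tens, mul_assoc]

lemma tens_smul_right (c : ℂ) (β : X → ℂ) (χ : Y → ℂ) : tens β (c • χ) = c • tens β χ := by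
  ext
  simp [tens, mul_left_comm]

end Tens

lemma single_mulVec_single {X : Type} [Fintype X] [DecidableEq X] (x y z : X) :
    Matrix.single x y (1 : ℂ) *ᵥ Pi.single z 1 = if y = z then Pi.single x 1 else 0 := by
  ext i
  by_cases h : y = z <;> simp [h, Matrix.single_apply, Pi.single_apply, eq_comm]

/-! ### The preparation of a qubit -/

variable {v n w : ℕ}

/-- The state of the common register with request bit `q`. -/
def comKet (q : Fin 2) (γ : (ZMod 8 → Fin 2) → ℂ) : ComReg → ℂ := tens (Pi.single q 1) γ

lemma isUnitKet_comKet (q : Fin 2) {γ : (ZMod 8 → Fin 2) → ℂ} (hγ : IsUnitKet γ) :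
    IsUnitKet (comKet q γ) := (isUnitKet_single q).tens hγ

lemma requestStep_branch (a : Memory v n w) (β : BobReg n w → ℂ) (q : Fin 2)
    {γ : (ZMod 8 → Fin 2) → ℂ} (hγ : IsUnitKet γ) :
    requestStep.applyAC (branch a (tens β (comKet q γ))) =
      branch a (tens β (comKet (if a.status = .waiting then 1 else 0) γ)) := by
  refine applyAC_instrument_tens _ a a β (isUnitKet_comKet _ hγ) (isUnitKet_comKet _ hγ)
    (fun o => if o = q then 1 else 0) (fun o => ?_) fun _ _ => rfl
  rw [comKet, kronecker_mulVec_tens, one_mulVec, single_mulVec_single]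
  by_cases h : o = q
  · subst h
    simp [comKet]
  · simp [h]

/-- The state of the eight qubits created by Bob. -/
def eightKet : (ZMod 8 → Fin 2) → ℂ := tensorKet fun τ => ketXY τ 0

lemma isUnitKet_eightKet : IsUnitKet eightKet := .tensorKet fun τ => isUnitKet_ketXY τ 0

lemma prepareStep_branch_one (a : Memory v n w) (β : BobReg n w → ℂ)
    {γ : (ZMod 8 → Fin 2) → ℂ} (hγ : IsUnitKet γ) :
    prepareStep.applyBC (branch a (tens β (comKet 1 γ))) =
      branch a (tens β (comKet 1 eightKet)) := by
  -- The label `e` is the basis value of the qubits that Bob replaces, so its amplitude is `γ e`.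
  refine applyBC_tens prepareOp_tp a β (isUnitKet_comKet _ hγ)
    (isUnitKet_comKet _ isUnitKet_eightKet) γ fun e => ?_
  have h : vecMulVec eightKet (Pi.single e 1) *ᵥ γ = γ e • eightKet := by
    rw [vecMulVec_mulVec]
    ext
    simp [mul_comm]
  rw [prepareOp, add_mulVec, comKet, kronecker_mulVec_tens, kronecker_mulVec_tens]
  change tens _ (vecMulVec eightKet (Pi.single e 1) *ᵥ γ) + _ = _
  rw [h, tens_smul_right, single_mulVec_single, single_mulVec_single]
  simp [comKet]

lemma idleOp_mulVec {O C : Type} [DecidableEq O] [Zero O] [Fintype C] [DecidableEq C] (o : O)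
    (χ : C → ℂ) : idleOp o *ᵥ χ = (if o = 0 then (1 : ℂ) else 0) • χ := by
  unfold idleOp
  split_ifs <;> simp

lemma prepareStep_branch_zero (a : Memory v n w) (β : BobReg n w → ℂ)
    {γ : (ZMod 8 → Fin 2) → ℂ} (hγ : IsUnitKet γ) :
    prepareStep.applyBC (branch a (tens β (comKet 0 γ))) = branch a (tens β (comKet 0 γ)) := by
  refine applyBC_tens prepareOp_tp a β (isUnitKet_comKet _ hγ) (isUnitKet_comKet _ hγ)
    (fun e => if e = 0 then 1 else 0) fun e => ?_
  rw [prepareOp, add_mulVec, comKet, kronecker_mulVec_tens, kronecker_mulVec_tens, idleOp_mulVec,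
    tens_smul_right, single_mulVec_single, single_mulVec_single]
  simp

/-- Honest qubits are eigenvectors of the tests: a nonzero entry of the outcome projects some factor
onto an orthogonal state, so only the outcome `0` has nonzero amplitude. -/
lemma testStep_branch_waiting {a : Memory v n w} (ha : a.status = .waiting)
    (β : BobReg n w → ℂ) (q : Fin 2) :
    testStep.applyAC (branch a (tens β (comKet q eightKet))) =
      branch { a with status := .passed } (tens β (comKet q eightKet)) := by
  refine applyAC_instrument_tens _ a _ β (isUnitKet_comKet _ isUnitKet_eightKet)
    (isUnitKet_comKet _ isUnitKet_eightKet) (fun o => if o = 0 then 1 else 0) (fun o => ?_)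
    fun o ho => ?_
  · rw [if_pos ha, comKet, kronecker_mulVec_tens, one_mulVec, eightKet, tensorOp_mulVec_tensorKet]
    simp only [projXY_mulVec]
    by_cases h : o = 0
    · subst h
      simp
    · obtain ⟨τ, hτ⟩ := Function.ne_iff.1 h
      have : (tensorKet fun i : ZMod 8 => if o i = 0 then ketXY i 0 else 0) = 0 := by
        ext x
        exact Finset.prod_eq_zero (Finset.mem_univ τ) (by simp [show o τ ≠ 0 from hτ])
      rw [this]
      simp [h]
  · have : o = 0 := by
      by_contra h
      simp [h] at ho
    simp [ha, this]

lemma testStep_branch_of_ne {a : Memory v n w} (ha : a.status ≠ .waiting)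
    (β : BobReg n w → ℂ) {χ : ComReg → ℂ} (hχ : IsUnitKet χ) :
    testStep.applyAC (branch a (tens β χ)) = branch a (tens β χ) := by
  refine applyAC_instrument_tens _ a _ β hχ hχ (fun o => if o = 0 then 1 else 0) (fun o => ?_)
    fun o ho => ?_
  · rw [if_neg ha, idleOp_mulVec]
  · simp [ha]

lemma selectStep_branch_of_ne {a : Memory v n w} (k : Fin (v + 1)) (u : Vertex n w)
    (ha : a.status ≠ .passed) (β : BobReg n w → ℂ) {χ : ComReg → ℂ} (hχ : IsUnitKet χ) :
    (selectStep k u).applyAC (branch a (tens β χ)) = branch a (tens β χ) := by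
  refine applyAC_instrument_tens _ a _ β hχ hχ (fun o => if o = 0 then 1 else 0) (fun o => ?_)
    fun o ho => ?_
  · rw [if_neg ha, idleOp_mulVec]
  · simp [ha]

/-- The state of the eight common qubits with `m` at position `0` and `|0⟩` elsewhere. -/
def sentKet (m : Fin 2 → ℂ) : ZMod 8 → Fin 2 → ℂ := Function.update (fun _ => Pi.single 0 1) 0 m

lemma isUnitKet_sentKet {m : Fin 2 → ℂ} (hm : IsUnitKet m) (τ : ZMod 8) :
    IsUnitKet (sentKet m τ) := by
  by_cases h : τ = 0
  · subst h
    simpa [sentKet] using hm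
  · simpa [sentKet, h] using isUnitKet_single 0

lemma tensorKet_sentKet (m : Fin 2 → ℂ) (x : ZMod 8 → Fin 2) :
    tensorKet (sentKet m) x = if x = Pi.single 0 (x 0) then m (x 0) else 0 := by
  rw [sentKet, tensorKet_update]
  split_ifs with h
  · rw [Finset.prod_eq_one, mul_one]
    intro i hi
    rw [h, Pi.single_eq_of_ne (Finset.ne_of_mem_erase hi), Pi.single_eq_same]
  · obtain ⟨i, hi⟩ := Function.ne_iff.1 h
    have hi0 : i ≠ 0 := by
      rintro rfl
      simp at hi
    rw [Pi.single_eq_of_ne hi0] at hi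
    rw [Finset.prod_eq_zero (Finset.mem_erase.2 ⟨hi0, Finset.mem_univ i⟩), mul_zero]
    rw [Pi.single_eq_of_ne hi]

/-- The label `e` fixes the basis values of all discarded qubits. In a product vector these
contribute only a scalar, and the qubit `l` arrives intact at position `0`. -/
lemma keepOp_mulVec_tensorKet (l : ZMod 8) (e : {τ : ZMod 8 // τ ≠ 0} → Fin 2)
    (κ : ZMod 8 → Fin 2 → ℂ) :
    keepOp l e *ᵥ tensorKet κ =
      (∏ τ : {τ : ZMod 8 // τ ≠ 0}, κ (Equiv.swap 0 l τ) (e τ)) • tensorKet (sentKet (κ l)) := by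
  ext x
  -- `y₀` is the only basis vector with label `e` and value `x 0` at `l`; the transposition of `0`
  -- and `l` matches the discarded positions with the nonzero labels.
  set y₀ : ZMod 8 → Fin 2 := fun σ =>
    if h : Equiv.swap 0 l σ ≠ 0 then e ⟨Equiv.swap 0 l σ, h⟩ else x 0 with hy₀
  have hl : y₀ l = x 0 := by simp [hy₀]
  have hne : ∀ τ : {τ : ZMod 8 // τ ≠ 0}, y₀ (Equiv.swap 0 l τ) = e τ := by
    intro τ
    simp [hy₀, τ.2]
  have huniq : ∀ y : ZMod 8 → Fin 2, y l = x 0 →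
      (fun τ : {τ : ZMod 8 // τ ≠ 0} => y (Equiv.swap 0 l τ)) = e → y = y₀ := by
    intro y h h'
    funext σ
    by_cases hσ : Equiv.swap 0 l σ ≠ 0
    · have := congrFun h' ⟨_, hσ⟩
      simp only [Equiv.swap_apply_self] at this
      simp [hy₀, hσ, this]
    · have hσ' : σ = l := by
        rw [not_not] at hσ
        rw [Equiv.swap_apply_eq_iff.1 hσ, Equiv.swap_apply_left]
      rw [hσ', h, hl]
  have hprod : tensorKet κ y₀ =
      (∏ τ : {τ : ZMod 8 // τ ≠ 0}, κ (Equiv.swap 0 l τ) (e τ)) * κ l (x 0) := by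
    rw [tensorKet, ← Equiv.prod_comp (Equiv.swap 0 l),
      ← Finset.mul_prod_erase _ _ (Finset.mem_univ (0 : ZMod 8)), Equiv.swap_apply_left, hl,
      mul_comm, Finset.prod_subtype (p := fun τ : ZMod 8 => τ ≠ 0) (F := inferInstance) _ (by simp)]
    simp only [hne]
  rw [Pi.smul_apply, tensorKet_sentKet, smul_eq_mul]
  simp only [mulVec, dotProduct, keepOp, Matrix.of_apply]
  split_ifs with h
  · rw [Finset.sum_eq_single y₀]
    · rw [if_pos ⟨by rw [hl]; exact h, funext hne⟩, one_mul, hprod]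
    · intro y _ hy
      rw [if_neg, zero_mul]
      rintro ⟨h1, h2⟩
      refine hy (huniq y ?_ h2)
      rw [h1]
      simp
    · simp
  · rw [mul_zero]
    refine Finset.sum_eq_zero fun y _ => ?_
    rw [if_neg, zero_mul]
    rintro ⟨h1, -⟩
    apply h
    rw [h1]
    simp

lemma selectStep_branch_passed {a : Memory v n w} (k : Fin (v + 1)) (u : Vertex n w)
    (ha : a.status = .passed) (β : BobReg n w → ℂ) (q : Fin 2) :
    (selectStep k u).applyAC (branch a (tens β (comKet q eightKet))) =
      branch { a with status := .sent }
        (tens β (comKet q (tensorKet (sentKet (ketXY (a.prepAngle k u) 0))))) := by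
  refine applyAC_instrument_tens _ a _ β (isUnitKet_comKet _ isUnitKet_eightKet)
    (isUnitKet_comKet _ (.tensorKet (isUnitKet_sentKet (isUnitKet_ketXY _ _))))
    (fun e => ∏ τ : {τ : ZMod 8 // τ ≠ 0}, ketXY (Equiv.swap 0 (a.prepAngle k u) τ) 0 (e τ))
    (fun o => ?_) fun o _ => if_pos ha
  rw [if_pos ha, comKet, kronecker_mulVec_tens, one_mulVec, eightKet, keepOp_mulVec_tensorKet,
    tens_smul_right]
  rfl

lemma exchangeStep_branch (u : Vertex n w) (a : Memory v n w) (ψ : BobReg n w × ComReg → ℂ) :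
    (exchangeStep u).applyBC (branch a ψ) = branch a (ψ ∘ exchange u) := by
  rw [applyBC_branch]
  change ∑ _u : Unit, branch a ((exchange u).permMatrix ℂ *ᵥ ψ) = _
  rw [permMatrix_mulVec]
  simp

lemma tens_comp_exchange (u : Vertex n w) (β : Vertex n w → Fin 2 → ℂ) (q : Fin 2)
    (κ : ZMod 8 → Fin 2 → ℂ) :
    tens (tensorKet β) (comKet q (tensorKet κ)) ∘ exchange u =
      tens (tensorKet (Function.update β u (κ 0)))
        (comKet q (tensorKet (Function.update κ 0 (β u)))) := by
  ext ⟨b, p, c⟩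
  change tensorKet β (Function.update b u (c 0)) *
    ((Pi.single q 1 : Fin 2 → ℂ) p * tensorKet κ (Function.update c 0 (b u))) =
    tensorKet (Function.update β u (κ 0)) b *
      ((Pi.single q 1 : Fin 2 → ℂ) p * tensorKet (Function.update κ 0 (β u)) c)
  simp only [tensorKet_apply_update, tensorKet_update]
  ring

lemma nextStep_branch {a : Memory v n w} (ha : a.status = .sent) (ψ : BobReg n w × ComReg → ℂ) :
    nextStep.applyAC (branch a ψ) = branch { a with status := .waiting } ψ := by
  rw [nextStep, applyAC_instrument_branch]
  simp [ha]

/-! ### The preparation of all qubits -/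

lemma run_attempt_waiting {a : Memory v n w} (ha : a.status = .waiting) (k : Fin (v + 1))
    (u : Vertex n w) (β : BobReg n w → ℂ) (q : Fin 2) {γ : (ZMod 8 → Fin 2) → ℂ}
    (hγ : IsUnitKet γ) :
    (attempt k u).run (branch a (tens β (comKet q γ))) =
      branch { a with status := .sent }
        (tens β (comKet 1 (tensorKet (sentKet (ketXY (a.prepAngle k u) 0))))) := by
  rw [attempt, run_cons, requestStep_branch a β q hγ, if_pos ha, prepareStep_branch_one a β hγ,
    run_aliceStep_cons, testStep_branch_waiting ha, run_aliceStep_cons,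
    selectStep_branch_passed k u rfl]
  rfl

/-- The selected qubit must survive the remaining attempts: request bit `0` keeps Bob idle, and the
status keeps both of Alice's operations idle. -/
lemma run_attempt_sent {a : Memory v n w} (ha : a.status = .sent) (k : Fin (v + 1))
    (u : Vertex n w) (β : BobReg n w → ℂ) (q : Fin 2) {γ : (ZMod 8 → Fin 2) → ℂ}
    (hγ : IsUnitKet γ) :
    (attempt k u).run (branch a (tens β (comKet q γ))) = branch a (tens β (comKet 0 γ)) := by
  have h1 : a.status ≠ .waiting := by simp [ha]
  have h2 : a.status ≠ .passed := by simp [ha]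
  rw [attempt, run_cons, requestStep_branch a β q hγ, if_neg h1, prepareStep_branch_zero a β hγ,
    run_aliceStep_cons, testStep_branch_of_ne h1 _ (isUnitKet_comKet _ hγ), run_aliceStep_cons,
    selectStep_branch_of_ne _ _ h2 _ (isUnitKet_comKet _ hγ)]
  rfl

lemma run_attempts_sent {a : Memory v n w} (ha : a.status = .sent) (k : Fin (v + 1))
    (u : Vertex n w) (β : BobReg n w → ℂ) {γ : (ZMod 8 → Fin 2) → ℂ} (hγ : IsUnitKet γ) (T : ℕ)
    (q : Fin 2) :
    ∃ q', Protocol.run (List.replicate T (attempt k u)).flatten (branch a (tens β (comKet q γ))) =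
      branch a (tens β (comKet q' γ)) := by
  induction T generalizing q with
  | zero => exact ⟨q, rfl⟩
  | succ T ih =>
    rw [List.replicate_succ, List.flatten_cons, run_append, run_attempt_sent ha k u β q hγ]
    exact ih 0

/-- Since `1 ≤ T`, a first attempt can be split off, and it succeeds. The memory returns to `a`, and
Bob's former qubit `u` is left behind at position `0` of the common register. -/
lemma run_preparation {T : ℕ} (hT : 1 ≤ T) {a : Memory v n w} (ha : a.status = .waiting)
    (k : Fin (v + 1)) (u : Vertex n w) (β : Vertex n w → Fin 2 → ℂ) (q : Fin 2)
    {γ : (ZMod 8 → Fin 2) → ℂ} (hγ : IsUnitKet γ) :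
    ∃ q', (preparation T k u).run (branch a (tens (tensorKet β) (comKet q γ))) =
      branch a (tens (tensorKet (Function.update β u (ketXY (a.prepAngle k u) 0)))
        (comKet q' (tensorKet (sentKet (β u))))) := by
  obtain ⟨T, rfl⟩ := Nat.exists_eq_add_of_le' hT
  obtain ⟨q', hq'⟩ := run_attempts_sent (a := { a with status := .sent }) rfl k u (tensorKet β)
    (.tensorKet (isUnitKet_sentKet (isUnitKet_ketXY (a.prepAngle k u) 0))) T 1
  refine ⟨q', ?_⟩
  rw [preparation, run_append, List.replicate_succ, List.flatten_cons, run_append,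
    run_attempt_waiting ha k u _ q hγ, hq', run_bobStep_cons, exchangeStep_branch,
    tens_comp_exchange, run_aliceStep_cons, nextStep_branch rfl, run_nil]
  have h1 : ({ a with status := .waiting } : Memory v n w) = a := by
    rw [← ha]
  simp only [h1]
  simp [sentKet]

/-- The leftover factors `κ'` are described only as unit vectors, because nothing but their norms
matters later. -/
lemma run_preparations {T : ℕ} (hT : 1 ≤ T) {a : Memory v n w} (ha : a.status = .waiting)
    (k : Fin (v + 1)) (L : List (Vertex n w)) (β : Vertex n w → Fin 2 → ℂ)
    (hβ : ∀ u, IsUnitKet (β u)) (q : Fin 2)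
    (κ : ZMod 8 → Fin 2 → ℂ) (hκ : ∀ τ, IsUnitKet (κ τ)) :
    ∃ q' κ', (∀ τ, IsUnitKet (κ' τ)) ∧
      Protocol.run (L.flatMap fun u => preparation T k u)
        (branch a (tens (tensorKet β) (comKet q (tensorKet κ)))) =
      branch a (tens (tensorKet fun u => if u ∈ L then ketXY (a.prepAngle k u) 0 else β u)
        (comKet q' (tensorKet κ'))) := by
  induction L generalizing β q κ with
  | nil => exact ⟨q, κ, hκ, by simp [run_nil]⟩
  | cons u L ih =>
    obtain ⟨q₁, h₁⟩ := run_preparation hT ha k u β q (.tensorKet hκ)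
    obtain ⟨q', κ', hκ', h⟩ := ih (Function.update β u (ketXY (a.prepAngle k u) 0))
      (fun u' => by
        by_cases h : u' = u
        · subst h
          simpa using isUnitKet_ketXY _ _
        · simpa [h] using hβ u') q₁ (sentKet (β u)) (isUnitKet_sentKet (hβ u))
    refine ⟨q', κ', hκ', ?_⟩
    rw [List.flatMap_cons, run_append, h₁, h]
    congr 3
    funext u'
    by_cases h1 : u' = u
    · subst h1
      simp
    · simp [h1]

end Preparation

/-! ### Adaptive measurements as a sum over outcome records -/

section Measurement

/-! ### The measurement of all qubits -/

section Site

variable {J : Type} [Fintype J] [DecidableEq J]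

lemma tensorOp_update_one_apply (u : J) (M : Matrix (Fin 2) (Fin 2) ℂ) (x y : J → Fin 2) :
    tensorOp (Function.update (fun _ => 1) u M) x y =
      if y = Function.update x u (y u) then M (x u) (y u) else 0 := by
  rw [tensorOp, Matrix.of_apply, ← Finset.mul_prod_erase _ _ (Finset.mem_univ u),
    Function.update_self]
  have h : ∀ i ∈ Finset.univ.erase u, (Function.update (fun _ => 1) u M :
      J → Matrix (Fin 2) (Fin 2) ℂ) i (x i) (y i) = (1 : Matrix (Fin 2) (Fin 2) ℂ) (x i) (y i) :=
    fun i hi => by rw [Function.update_of_ne (Finset.ne_of_mem_erase hi)]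
  rw [Finset.prod_congr rfl h]
  split_ifs with hy
  · rw [Finset.prod_eq_one, mul_one]
    intro i hi
    rw [hy, Function.update_of_ne (Finset.ne_of_mem_erase hi), one_apply_eq]
  · obtain ⟨i, hi⟩ := Function.ne_iff.1 hy
    have hiu : i ≠ u := by
      rintro rfl
      simp at hi
    rw [Function.update_of_ne hiu] at hi
    rw [Finset.prod_eq_zero (Finset.mem_erase.2 ⟨hiu, Finset.mem_univ i⟩), mul_zero]
    rw [one_apply_ne (Ne.symm hi)]

lemma tensorOp_update_one_mulVec (u : J) (M : Matrix (Fin 2) (Fin 2) ℂ) (Ψ : (J → Fin 2) → ℂ)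
    (x : J → Fin 2) :
    (tensorOp (Function.update (fun _ => 1) u M) *ᵥ Ψ) x =
      ∑ z, M (x u) z * Ψ (Function.update x u z) := by
  simp only [mulVec, dotProduct, tensorOp_update_one_apply]
  rw [← Finset.sum_subset (Finset.subset_univ
    (Finset.univ.image fun z => Function.update x u z)), Finset.sum_image]
  · refine Finset.sum_congr rfl fun z _ => ?_
    simp
  · intro z _ z' _ h
    simpa using congrFun h u
  · intro y _ hy
    rw [if_neg, zero_mul]
    intro h
    exact hy (Finset.mem_image.2 ⟨y u, Finset.mem_univ _, h.symm⟩)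

end Site

lemma one_kronecker_mulVec {B C : Type} [Fintype B] [DecidableEq B] [Fintype C]
    (K : Matrix C C ℂ) (ψ : B × C → ℂ) (b : B) (c : C) :
    (((1 : Matrix B B ℂ) ⊗ₖ K) *ᵥ ψ) (b, c) = (K *ᵥ fun c' => ψ (b, c')) c := by
  simp only [mulVec, dotProduct, Fintype.sum_prod_type, kroneckerMap_apply]
  rw [Finset.sum_eq_single b]
  · simp
  · intro b' _ hb
    simp [one_apply_ne (Ne.symm hb)]
  · simp

variable {v n w : ℕ}

/-- The memory after the outcomes of computation `k` have been set to `s`. -/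
def Memory.withOutcomes (a : Memory v n w) (k : Fin (v + 1)) (s : Vertex n w → Fin 2) :
    Memory v n w := { a with s := Function.update a.s k s }

@[simp]
lemma Memory.withOutcomes_s (a : Memory v n w) (k : Fin (v + 1)) (s : Vertex n w → Fin 2) :
    (a.withOutcomes k s).s k = s := Function.update_self _ _ _

lemma Memory.withOutcomes_withOutcomes (a : Memory v n w) (k : Fin (v + 1))
    (s s' : Vertex n w → Fin 2) : (a.withOutcomes k s).withOutcomes k s' = a.withOutcomes k s' := by
  simp [withOutcomes]

/-- The measured qubit is sent to Alice in exchange for the last measured qubit, and collapses. -/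
lemma measureStep_branch_exchange (k : Fin (v + 1)) (u : Vertex n w) (a : Memory v n w)
    (Ψ : BobReg n w → ℂ) (q : Fin 2) (κ : ZMod 8 → Fin 2 → ℂ) :
    (measureStep k u).applyAC (branch a (tens Ψ (comKet q (tensorKet κ)) ∘ exchange u)) =
      ∑ o, branch (a.withOutcomes k (Function.update (a.s k) u (o + a.tape.r k u)))
        (tens (tensorOp (Function.update (fun _ => 1) u
            (vecMulVec (κ 0) (star (ketXY (a.δ k u) o)))) *ᵥ Ψ)
          (comKet q (tensorKet (Function.update κ 0 (ketXY (a.δ k u) o))))) := by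
  rw [measureStep, applyAC_instrument_branch]
  refine Finset.sum_congr rfl fun o _ => ?_
  congr 1
  ext ⟨b, p, c⟩
  rw [one_kronecker_mulVec, one_kronecker_mulVec, tensorOp_update_one_mulVec]
  have h : ∀ z, (tens Ψ (comKet q (tensorKet κ)) ∘ exchange u)
      (b, p, Function.update c 0 z) = Ψ (Function.update b u z) *
        ((Pi.single q 1 : Fin 2 → ℂ) p * (κ 0 (b u) * ∏ i ∈ Finset.univ.erase 0, κ i (c i))) := by
    intro z
    change Ψ (Function.update b u (Function.update c 0 z 0)) * ((Pi.single q 1 : Fin 2 → ℂ) p *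
      tensorKet κ (Function.update (Function.update c 0 z) 0 (b u))) = _
    rw [Function.update_self, Function.update_idem, tensorKet_apply_update]
  simp only [h]
  simp only [tens, comKet, tensorOp_update_one_mulVec, tensorKet_update, projXY,
    vecMulVec_apply, Pi.star_apply, Finset.sum_mul]
  exact Finset.sum_congr rfl fun z _ => by ring

/-- The causal order of the corrections. A vertical edge or a row edge towards `u` puts `u''` no
further right than `u`; in the remaining case `u''` is the right neighbour of `u`, which forces the
excluded `u' = u`. -/
lemma col_lt_of_dependency {u u' u'' : Vertex n w} (hne : u' ≠ u) (h1 : u''.1 = u'.1)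
    (h2 : (u'.2 : ℕ) + 1 = u''.2) (h : (brickworkGraph n w).Adj u'' u) : u'.2 < u.2 := by
  rw [Fin.lt_def]
  rcases h with ⟨-, (⟨-, h⟩ | ⟨h, -⟩) | (⟨h', h⟩ | ⟨h, -⟩)⟩
  · omega
  · rw [← h]
    omega
  · exact absurd (Prod.ext (h1.symm.trans h'.symm) (Fin.ext (by omega))) hne
  · rw [h]
    omega

/-- `s_X` and `s_Z` read only earlier columns. Therefore the angle used during the run can be
computed from the complete record instead. -/
lemma Memory.δ_withOutcomes (a : Memory v n w) (k : Fin (v + 1)) (u : Vertex n w)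
    (s : Vertex n w → Fin 2) (h : ∀ u' : Vertex n w, u'.2 < u.2 → s u' = a.s k u') :
    (a.withOutcomes k s).δ k u = a.δ k u := by
  have hX : (a.withOutcomes k s).sX k u = a.sX k u := by
    refine Finset.sum_congr rfl fun u' _ => ?_
    split_ifs with hu
    · rw [withOutcomes_s]
      exact h u' (by rw [Fin.lt_def]; omega)
    · rfl
  have hZ : (a.withOutcomes k s).sZ k u = a.sZ k u := by
    refine Finset.sum_congr rfl fun u' _ => ?_
    split_ifs with hu
    · rw [withOutcomes_s]
      obtain ⟨hne, u'', h1, h2, h3⟩ := hu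
      exact h u' (col_lt_of_dependency hne h1 h2 h3)
    · rfl
  simp only [Memory.δ, Memory.adapted, hX, hZ]
  rfl

/-- The measurements of the qubits in `L`, one after the other. -/
def measurements (k : Fin (v + 1)) (L : List (Vertex n w)) :
    Protocol (Memory v n w) (BobReg n w) ComReg :=
  L.flatMap fun u => [bobStep (exchangeStep u), aliceStep (measureStep k u)]

/-- Measuring a site and returning the previous leftover to it is a rank-one operator on that site,
and operators on distinct sites combine into one tensor product. The column order lets all angles be
expressed through the final record `s`. -/
lemma run_measurements (k : Fin (v + 1)) (L : List (Vertex n w)) (hL : L.Nodup)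
    (hcol : L.Pairwise fun u u' => u.2 ≤ u'.2) (a : Memory v n w) (Ψ : BobReg n w → ℂ) (q : Fin 2)
    (κ : ZMod 8 → Fin 2 → ℂ) (hκ : ∀ τ, IsUnitKet (κ τ)) :
    ∃ (g : (Vertex n w → Fin 2) → Vertex n w → Fin 2 → ℂ)
      (κ' : (Vertex n w → Fin 2) → ZMod 8 → Fin 2 → ℂ),
      (∀ s, ∀ u ∈ L, IsUnitKet (g s u)) ∧ (∀ s τ, IsUnitKet (κ' s τ)) ∧
      (measurements k L).run (branch a (tens Ψ (comKet q (tensorKet κ)))) =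
        ∑ s with ∀ u ∉ L, s u = a.s k u, branch (a.withOutcomes k s)
          (tens (tensorOp (fun u => if u ∈ L then vecMulVec (g s u)
              (star (ketXY ((a.withOutcomes k s).δ k u) (s u + a.tape.r k u))) else 1) *ᵥ Ψ)
            (comKet q (tensorKet (κ' s)))) := by
  induction L generalizing a Ψ κ with
  | nil =>
    refine ⟨fun _ _ => 0, fun _ => κ, by simp, fun _ => hκ, ?_⟩
    have : (Finset.univ.filter fun s : Vertex n w → Fin 2 => ∀ u ∉ [], s u = a.s k u) = {a.s k} := by
      ext s
      simp [funext_iff]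
    rw [this, Finset.sum_singleton]
    simp [measurements, run_nil, tensorOp_one, Memory.withOutcomes]
  | cons u L ih =>
    rw [List.nodup_cons] at hL
    rw [List.pairwise_cons] at hcol
    -- Adding `r` is an involution, so the raw outcome `o` and the recorded bit `o + r` determine
    -- each other.
    have hbit : ∀ x y : Fin 2, x + y + y = x := by decide
    set m : Fin 2 → Fin 2 → ℂ := fun o => ketXY (a.δ k u) o with hm
    set a' : Fin 2 → Memory v n w := fun o =>
      a.withOutcomes k (Function.update (a.s k) u (o + a.tape.r k u)) with ha'
    set Ψ' : Fin 2 → BobReg n w → ℂ := fun o =>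
      tensorOp (Function.update (fun _ => 1) u (vecMulVec (κ 0) (star (m o)))) *ᵥ Ψ with hΨ'
    have hκ₁ : ∀ o τ, IsUnitKet (Function.update κ 0 (m o) τ) := by
      intro o τ
      by_cases h : τ = 0
      · subst h
        simpa using isUnitKet_ketXY _ _
      · simpa [h] using hκ τ
    choose g κ' hg hκ' hrun using fun o =>
      ih hL.2 hcol.2 (a' o) (Ψ' o) (Function.update κ 0 (m o)) (hκ₁ o)
    -- Site `u` receives the exchanged qubit `κ 0`; the other data come from the induction
    -- hypothesis for the raw outcome `s u + r` at `u`.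
    refine ⟨fun s => Function.update (g (s u + a.tape.r k u) s) u (κ 0),
      fun s => κ' (s u + a.tape.r k u) s, fun s u' hu' => ?_, fun s => hκ' _ s, ?_⟩
    · by_cases h : u' = u
      · subst h
        simpa using hκ 0
      · simpa [h] using hg _ s u' ((List.mem_cons.1 hu').resolve_left h)
    rw [measurements, List.flatMap_cons, run_append, run_bobStep_cons, exchangeStep_branch,
      run_aliceStep_cons, measureStep_branch_exchange, run_nil, run_sum]
    change ∑ o, (measurements k L).run (branch (a' o) (tens (Ψ' o) (comKet q
      (tensorKet (Function.update κ 0 (m o)))))) = _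
    -- The records are grouped by their raw outcome at `u`, one group for each branch after the
    -- first measurement.
    rw [← Finset.sum_fiberwise (Finset.univ.filter _) fun s : Vertex n w → Fin 2 =>
      s u + a.tape.r k u]
    refine Finset.sum_congr rfl fun o _ => ?_
    rw [hrun o, Finset.filter_filter]
    refine Finset.sum_congr ?_ fun s hs => ?_
    · ext s
      simp only [Finset.mem_filter, Finset.mem_univ, true_and, ha', Memory.withOutcomes,
        Function.update_self, List.mem_cons, not_or]
      constructor
      · intro h
        refine ⟨fun u' hu' => ?_, ?_⟩
        · rw [h u' hu'.2, Function.update_of_ne hu'.1]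
        · rw [h u hL.1, Function.update_self, hbit]
      · rintro ⟨h, h'⟩ u' hu'
        by_cases hu : u' = u
        · subst hu
          rw [Function.update_self, ← h', hbit]
        · rw [Function.update_of_ne hu, h u' ⟨hu, hu'⟩]
    · simp only [Finset.mem_filter, Finset.mem_univ, true_and] at hs
      obtain ⟨hs, hsu⟩ := hs
      have ha's : (a' o).withOutcomes k s = a.withOutcomes k s :=
        Memory.withOutcomes_withOutcomes _ _ _ _
      -- The qubits measured after `u` lie in the same or a later column, so their outcomes do not
      -- enter the angle of `u`.
      have hδ : (a.withOutcomes k s).δ k u = a.δ k u := by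
        refine Memory.δ_withOutcomes _ _ _ _ fun u' hu' => ?_
        refine hs u' fun h => ?_
        rcases List.mem_cons.1 h with rfl | h
        · exact lt_irrefl _ hu'
        · exact absurd hu' (not_lt.2 (hcol.1 u' h))
      have htape : (a' o).tape = a.tape := rfl
      simp only [hsu, ha's, htape, hΨ']
      rw [mulVec_mulVec, tensorOp_mul]
      congr 4
      funext u'
      by_cases hu : u' = u
      · subst hu
        simp [hL.1, hδ, hsu, hm]
      · simp [hu]

end Measurement

/-! ### Stabilisers of the brickwork state and cancellation of the randomness -/

section GraphState

/-! ### Phases of the computational basis -/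

/-- The relative phase of the basis vector `b` in `|0⟩ + exp(i l π / 4) |1⟩`. -/
def phase (l : ZMod 8) (b : Fin 2) : ℂ := if b = 1 then ZMod.stdAddChar l else 1

/-- The normalisation `1 / √2` of the equatorial states. -/
def invSqrtTwo : ℂ := ((Real.sqrt 2 : ℝ) : ℂ)⁻¹

lemma norm_invSqrtTwo_sq : ‖invSqrtTwo‖ ^ 2 = 1 / 2 := by
  rw [invSqrtTwo, norm_inv, Complex.norm_real, Real.norm_eq_abs, inv_pow, sq_abs,
    Real.sq_sqrt (by norm_num)]
  norm_num

lemma invSqrtTwo_mul_self : invSqrtTwo * invSqrtTwo = 1 / 2 := by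
  rw [invSqrtTwo, ← mul_inv, ← Complex.ofReal_mul, Real.mul_self_sqrt (by norm_num)]
  norm_num

lemma invSqrtTwo_ne_zero : invSqrtTwo ≠ 0 := by
  intro h
  have := invSqrtTwo_mul_self
  rw [h] at this
  norm_num at this

lemma star_invSqrtTwo : star invSqrtTwo = invSqrtTwo := by
  rw [invSqrtTwo, Complex.star_def, map_inv₀, Complex.conj_ofReal]

lemma stdAddChar_four : ZMod.stdAddChar (4 : ZMod 8) = -1 := by
  have h := ZMod.stdAddChar_coe (N := 8) 4
  have h4 : ((4 : ℤ) : ZMod 8) = 4 := rfl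
  rw [h4] at h
  rw [h, ← Complex.exp_pi_mul_I]
  congr 1
  push_cast
  ring

@[simp]
lemma phase_zero_right (l : ZMod 8) : phase l 0 = 1 := by simp [phase]

@[simp]
lemma phase_zero_left (b : Fin 2) : phase 0 b = 1 := by simp [phase]

lemma phase_add (l l' : ZMod 8) (b : Fin 2) : phase (l + l') b = phase l b * phase l' b := by
  unfold phase
  split_ifs
  · exact AddChar.map_add_eq_mul _ _ _
  · simp

lemma phase_sum {I : Type*} (s : Finset I) (l : I → ZMod 8) (b : Fin 2) :
    phase (∑ i ∈ s, l i) b = ∏ i ∈ s, phase (l i) b := by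
  classical
  induction s using Finset.induction_on with
  | empty => simp
  | insert i s hi ih => rw [Finset.sum_insert hi, Finset.prod_insert hi, phase_add, ih]

lemma star_phase (l : ZMod 8) (b : Fin 2) : star (phase l b) = phase (-l) b := by
  unfold phase
  split_ifs
  · rw [AddChar.map_neg_eq_conj]
    rfl
  · simp

lemma phase_four (b : Fin 2) : phase 4 b = if b = 1 then -1 else 1 := by
  simp [phase, stdAddChar_four]

lemma norm_phase (l : ZMod 8) (b : Fin 2) : ‖phase l b‖ = 1 := by
  unfold phase
  split_ifs
  · exact AddChar.norm_apply _ _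
  · simp

lemma phase_piBit (s b : Fin 2) : phase (piBit s) b = if s = 1 ∧ b = 1 then -1 else 1 := by
  by_cases hs : s = 1 <;> by_cases hb : b = 1 <;> simp [hs, hb, piBit, phase, stdAddChar_four]

lemma hadamard_apply (b s : Fin 2) : hadamard b s = invSqrtTwo * phase (piBit s) b := by
  rw [phase_piBit]
  fin_cases b <;> fin_cases s <;> simp [hadamard, invSqrtTwo]

lemma rotZ_eq_diagonal (l : ZMod 8) : rotZ l = diagonal (phase l) := by
  ext i j
  fin_cases i <;> fin_cases j <;> simp [rotZ, phase]

lemma ketXY_apply (l : ZMod 8) (s b : Fin 2) :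
    ketXY l s b = invSqrtTwo * phase (l + piBit s) b := by
  rw [ketXY, rotZ_eq_diagonal, diagonal_mul, hadamard_apply, phase_add]
  ring

/-! ### The overlap of a graph state with equatorial states -/

/-- Conjugation by a bit flip reverses a rotation about `Z`, up to a scalar of modulus one. -/
lemma phase_add_right (l : ZMod 8) (b t : Fin 2) :
    phase l (b + t) = phase l t * phase (signed t l) b := by
  have hinv : phase l 1 * phase (-l) 1 = 1 := by rw [← phase_add]; simp
  have h2 : (1 + 1 : Fin 2) = 0 := by decide
  have hb : b = 0 ∨ b = 1 := by omega
  have ht : t = 0 ∨ t = 1 := by omega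
  rcases hb with rfl | rfl <;> rcases ht with rfl | rfl <;> simp [signed, hinv, h2]

/-- The sign that controlled-Z gates on the pairs in `R` give to a vector of the computational
basis. -/
def edgeSign {J : Type} [Fintype J] (R : J → J → Prop) [DecidableRel R] (x : J → Fin 2) : ℂ :=
  ∏ u, ∏ u', if R u u' ∧ x u = 1 ∧ x u' = 1 then -1 else 1

lemma norm_edgeSign {J : Type} [Fintype J] (R : J → J → Prop) [DecidableRel R]
    (x : J → Fin 2) : ‖edgeSign R x‖ = 1 := by
  simp only [edgeSign, norm_prod]
  exact Finset.prod_eq_one fun _ _ => Finset.prod_eq_one fun _ _ => by split_ifs <;> simp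

/-- The exponent of the sign is a quadratic form over the field with two elements. A translation by
`t` adds the value at `t` and the polar bilinear form, which appears as a phase at each vertex. -/
lemma edgeSign_add {J : Type} [Fintype J] (R : J → J → Prop) [DecidableRel R]
    (x t : J → Fin 2) :
    edgeSign R (x + t) = edgeSign R t * edgeSign R x *
      ∏ u, phase (∑ u', ((if R u u' ∧ t u' = 1 then 4 else 0) +
        (if R u' u ∧ t u' = 1 then 4 else 0))) (x u) := by
  have key : ∀ (p : Prop) [Decidable p] (a b c d : Fin 2),
      (if p ∧ a + b = 1 ∧ c + d = 1 then (-1 : ℂ) else 1) =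
        (if p ∧ b = 1 ∧ d = 1 then (-1 : ℂ) else 1) * (if p ∧ a = 1 ∧ c = 1 then (-1 : ℂ) else 1) *
          (phase (if p ∧ d = 1 then 4 else 0) a * phase (if p ∧ b = 1 then 4 else 0) c) := by
    intro p _ a b c d
    by_cases hp : p
    · have h2 : (1 + 1 : Fin 2) = 0 := by decide
      have ha : a = 0 ∨ a = 1 := by omega
      have hb : b = 0 ∨ b = 1 := by omega
      have hc : c = 0 ∨ c = 1 := by omega
      have hd : d = 0 ∨ d = 1 := by omega
      rcases ha with rfl | rfl <;> rcases hb with rfl | rfl <;> rcases hc with rfl | rfl <;>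
        rcases hd with rfl | rfl <;> simp [hp, h2, phase_four]
    · simp [hp]
  simp only [edgeSign, Pi.add_apply, key, phase_sum, phase_add, Finset.prod_mul_distrib]
  congr 2
  exact Finset.prod_comm

/-- With `linked_asymm` this shows that `linked` orients each edge exactly once, so the two summands
of the polar form in `edgeSign_add` never coincide on an edge and cancel. -/
lemma linked_irrefl {n w : ℕ} (u : Vertex n w) : ¬ linked u u := by
  rintro (⟨-, h⟩ | ⟨-, t, ⟨h, -⟩, -⟩) <;> omega

lemma linked_asymm {n w : ℕ} {u u' : Vertex n w} (h : linked u u') : ¬ linked u' u := by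
  rcases h with ⟨h1, h2⟩ | ⟨h1, t, ⟨h2, -⟩, -⟩ <;>
  rintro (⟨h3, h4⟩ | ⟨h3, t', ⟨h4, -⟩, -⟩)
  · omega
  · rw [h1] at h4
    omega
  · rw [h3] at h2
    omega
  · omega

variable {v n w : ℕ}

/-- The angle `π ∑ t` with the sum over the neighbours of `u`. -/
def neighbourAngle (t : Vertex n w → Fin 2) (u : Vertex n w) : ZMod 8 :=
  ∑ u', if (brickworkGraph n w).Adj u' u ∧ t u' = 1 then 4 else 0

/-- The overlap, up to normalisation, of the brickwork state with the product of the states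
`|0⟩ + exp(- i l) |1⟩`. -/
def graphSum (l : Vertex n w → ZMod 8) : ℂ :=
  ∑ x : Vertex n w → Fin 2, edgeSign linked x * ∏ u, phase (l u) (x u)

/-- The brickwork state is stabilised by the product of the `X_u` with `t u = 1` and of the
`Z_{u'}` with `u'` a neighbour of such `u`. -/
lemma norm_graphSum_stabilizer (t : Vertex n w → Fin 2) (l : Vertex n w → ZMod 8) :
    ‖graphSum l‖ = ‖graphSum fun u => signed (t u) (l u) + neighbourAngle t u‖ := by
  have hnbr : ∀ u, ∑ u' : Vertex n w, ((if linked u u' ∧ t u' = 1 then (4 : ZMod 8) else 0) +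
      (if linked u' u ∧ t u' = 1 then 4 else 0)) = neighbourAngle t u := by
    intro u
    refine Finset.sum_congr rfl fun u' _ => ?_
    have hadj : (brickworkGraph n w).Adj u' u ↔ linked u u' ∨ linked u' u := by
      constructor
      · rintro ⟨-, h⟩
        exact h.symm
      · refine fun h => ⟨?_, h.symm⟩
        rintro rfl
        exact linked_irrefl _ (or_self_iff.1 h)
    simp only [hadj]
    by_cases h1 : linked u u'
    · simp [h1, linked_asymm h1]
    · simp [h1]
  have h : graphSum l = (edgeSign linked t * ∏ u, phase (l u) (t u)) *
      graphSum fun u => signed (t u) (l u) + neighbourAngle t u := by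
    -- The substitution of `x + t` for `x` produces new angles and a global factor of modulus one.
    rw [graphSum, ← Equiv.sum_comp (Equiv.addRight t), graphSum, Finset.mul_sum]
    refine Finset.sum_congr rfl fun x _ => ?_
    simp only [Equiv.coe_addRight, edgeSign_add, hnbr, Pi.add_apply, phase_add_right, phase_add,
      Finset.prod_mul_distrib]
    ring
  rw [h, norm_mul, norm_mul, norm_edgeSign, norm_prod]
  simp [norm_phase]

lemma cZ_mulVec {J : Type} [Fintype J] [DecidableEq J] (R : J → J → Prop) [DecidableRel R]
    (ψ : (J → Fin 2) → ℂ) (x : J → Fin 2) : (cZ R *ᵥ ψ) x = edgeSign R x * ψ x := by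
  rw [cZ, mulVec_diagonal]
  rfl

/-- Bra and ket each contribute `1/√2` per vertex, and the bra conjugates its phases. -/
lemma overlap_eq_graphSum (l l' : Vertex n w → ZMod 8) (o : Vertex n w → Fin 2) :
    star (tensorKet fun u => ketXY (l u) (o u)) ⬝ᵥ
        (cZ linked *ᵥ tensorKet fun u => ketXY (l' u) 0) =
      (invSqrtTwo ^ Fintype.card (Vertex n w)) ^ 2 *
        graphSum fun u => l' u - l u - piBit (o u) := by
  have hpi : ∀ b : Fin 2, -piBit b = piBit b := by decide
  rw [dotProduct, graphSum, Finset.mul_sum]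
  refine Finset.sum_congr rfl fun x _ => ?_
  have h0 : piBit 0 = 0 := rfl
  simp only [Pi.star_apply, cZ_mulVec, tensorKet, ketXY_apply, star_prod, star_mul',
    star_pow, star_invSqrtTwo, star_phase, Finset.prod_mul_distrib, Finset.prod_const, Finset.card_univ,
    sub_eq_add_neg, phase_add, hpi, h0, phase_zero_left]
  ring

/-! ### The outcomes of a computation -/

lemma piBit_sum {I : Type*} (s : Finset I) (b : I → Fin 2) :
    piBit (∑ i ∈ s, b i) = ∑ i ∈ s, piBit (b i) := by
  have h : ∀ b c : Fin 2, piBit (b + c) = piBit b + piBit c := by decide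
  exact map_sum (AddMonoidHom.mk' piBit h) b s

lemma neighbourAngle_eq_piBit (t : Vertex n w → Fin 2) (u : Vertex n w) :
    neighbourAngle t u = piBit (∑ u', if (brickworkGraph n w).Adj u' u then t u' else 0) := by
  rw [piBit_sum]
  refine Finset.sum_congr rfl fun u' _ => ?_
  by_cases h : (brickworkGraph n w).Adj u' u <;> simp [h, piBit]

/-- The outcomes on which `s_X` of some neighbour of `u` depends are those in `s_Z` for `u` and,
unless `u` is in the last column, the outcome of `u` itself. -/
lemma neighbourAngle_sX (a : Memory v n w) (k : Fin (v + 1)) (u : Vertex n w) :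
    neighbourAngle (a.sX k) u =
      piBit (a.sZ k u) + if u.2 = Fin.last _ then 0 else piBit (a.s k u) := by
  -- An outcome at `x` enters `s_X` only for the right neighbour of `x`, so at most one `u'`
  -- contributes.
  have h1 : ∀ x : Vertex n w, (∑ u', if (brickworkGraph n w).Adj u' u then
      (if x.1 = u'.1 ∧ (x.2 : ℕ) + 1 = u'.2 then a.s k x else 0) else 0) =
      if ∃ u'' : Vertex n w, u''.1 = x.1 ∧ (x.2 : ℕ) + 1 = u''.2 ∧
        (brickworkGraph n w).Adj u'' u then a.s k x else 0 := by
    intro x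
    split_ifs with hx
    · obtain ⟨u'', h1, h2, h3⟩ := hx
      rw [Finset.sum_eq_single u'']
      · simp [h3, h1, h2]
      · intro u' _ hu'
        split_ifs with h h'
        · exact absurd (Prod.ext (h'.1.symm.trans h1.symm) (Fin.ext (by omega))) hu'
        · rfl
        · rfl
      · simp
    · refine Finset.sum_eq_zero fun u' _ => ?_
      split_ifs with h h'
      · exact absurd ⟨u', h'.1.symm, h'.2, h⟩ hx
      · rfl
      · rfl
  -- The outcome of `u` itself enters through its right neighbour, which is missing exactly in the
  -- last column.
  have hu : (∃ u'' : Vertex n w, u''.1 = u.1 ∧ (u.2 : ℕ) + 1 = u''.2 ∧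
      (brickworkGraph n w).Adj u'' u) ↔ u.2 ≠ Fin.last _ := by
    constructor
    · rintro ⟨u'', -, h, -⟩ h'
      rw [h'] at h
      have := u''.2.2
      simp only [Fin.val_last] at h
      omega
    · intro h
      have h' : (u.2 : ℕ) < 4 * w := Fin.val_lt_last h
      refine ⟨(u.1, ⟨u.2 + 1, by omega⟩), rfl, rfl, ?_, Or.inr (Or.inl ⟨rfl, rfl⟩)⟩
      intro h
      have := congrArg (fun x : Vertex n w => (x.2 : ℕ)) h
      simp at this
  have h2 : (∑ u', if (brickworkGraph n w).Adj u' u then a.sX k u' else 0) =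
      a.sZ k u + if u.2 = Fin.last _ then 0 else a.s k u := by
    calc _ = ∑ u', ∑ x : Vertex n w, if (brickworkGraph n w).Adj u' u then
          (if x.1 = u'.1 ∧ (x.2 : ℕ) + 1 = u'.2 then a.s k x else 0) else 0 := by
          refine Finset.sum_congr rfl fun u' _ => ?_
          split_ifs
          · rfl
          · simp
      _ = ∑ x : Vertex n w, if ∃ u'' : Vertex n w, u''.1 = x.1 ∧ (x.2 : ℕ) + 1 = u''.2 ∧
          (brickworkGraph n w).Adj u'' u then a.s k x else 0 := by
          rw [Finset.sum_comm]
          exact Finset.sum_congr rfl fun x _ => h1 x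
      _ = ∑ x : Vertex n w, ((if x ≠ u ∧ ∃ u'' : Vertex n w, u''.1 = x.1 ∧
          (x.2 : ℕ) + 1 = u''.2 ∧ (brickworkGraph n w).Adj u'' u then a.s k x else 0) +
          if x = u then (if u.2 = Fin.last _ then 0 else a.s k u) else 0) := by
          refine Finset.sum_congr rfl fun x _ => ?_
          by_cases hx : x = u
          · subst hx
            simp only [hu, ne_eq, not_true_eq_false, false_and, if_false, if_true, zero_add, ite_not]
          · simp only [hx, ne_eq, not_false_eq_true, true_and, if_false, add_zero]
      _ = _ := by
          rw [Finset.sum_add_distrib, Finset.sum_ite_eq' Finset.univ u, if_pos (Finset.mem_univ u)]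
          rfl
  rw [neighbourAngle_eq_piBit, h2]
  have h : ∀ b c : Fin 2, piBit (b + c) = piBit b + piBit c := by decide
  rw [h]
  split_ifs <;> rfl

/-- The measurement angles of the brickwork state without randomness and corrections, with the
outcome `0` in all columns but the last. -/
def plainAngle (φ : Vertex n w → ZMod 8) (s : Vertex n w → Fin 2) (u : Vertex n w) : ZMod 8 :=
  -φ u + if u.2 = Fin.last _ then piBit (s u) else 0

/-- The translation by `r'` undoes the reflections by `r'` and the `π`-shifts of the preparation,
while `θ` and `r` cancel between preparation and measurement. The translation by `s_X` then undoes
the sign of the angle; its neighbour angle cancels `s_Z` and, outside the last column, the outcome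
of the vertex itself. -/
lemma norm_overlap_measured (a : Memory v n w) (k : Fin (v + 1)) :
    ‖star (tensorKet fun u => ketXY (a.δ k u) (a.s k u + a.tape.r k u)) ⬝ᵥ
        (cZ linked *ᵥ tensorKet fun u => ketXY (a.prepAngle k u) 0)‖ =
      ‖(invSqrtTwo ^ Fintype.card (Vertex n w)) ^ 2‖ *
        ‖graphSum (plainAngle (a.angle k) (a.s k))‖ := by
  rw [overlap_eq_graphSum, norm_mul, norm_graphSum_stabilizer (a.tape.r' k),
    norm_graphSum_stabilizer (a.sX k)]
  congr 3
  funext u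
  have hprep : a.prepAngle k u = a.tape.θ k u + neighbourAngle (a.tape.r' k) u := rfl
  rw [hprep, neighbourAngle_sX, neighbourAngle_eq_piBit, Memory.δ, Memory.adapted, plainAngle]
  have h1 : ∀ (r r' b s : Fin 2) (x θ : ZMod 8),
      signed r' (θ + piBit b - (signed r' x + θ + piBit r) - piBit (s + r)) + piBit b =
        -x - piBit s := by
    intro r r' b s x θ
    -- Once `θ` is removed, a finite identity in four bits and one angle remains.
    have h3 : ∀ (r r' b s : Fin 2) (x : ZMod 8),
        signed r' (piBit b - signed r' x - piBit r - piBit (s + r)) + piBit b =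
          -x - piBit s := by decide
    rw [← h3 r r' b s x]
    congr 2
    ring
  have h2 : ∀ (b c s : Fin 2) (x : ZMod 8),
      signed b (-(signed b x + piBit c) - piBit s) + piBit c = -x + piBit s := by decide
  have h4 : ∀ s : Fin 2, piBit s + piBit s = 0 := by decide
  rw [h1, ← add_assoc, h2]
  split_ifs
  · ring
  · rw [add_assoc, h4]

end GraphState

/-! ### From the brickwork state to the logical circuit -/

section LayeredCircuit

/-! ### Sums over paths -/

section Paths

variable {ι : Type} [Fintype ι]

/-- The vector obtained from `g` by applying `M 0, …, M (N - 1)`. -/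
def iterateMulVec (M : ℕ → Matrix ι ι ℂ) (g : ι → ℂ) : ℕ → ι → ℂ
  | 0 => g
  | N + 1 => M N *ᵥ iterateMulVec M g N

lemma sum_fin_succ_last {E : Type*} [AddCommMonoid E] {N : ℕ} (f : (Fin (N + 1) → ι) → E) :
    ∑ X, f X = ∑ y, ∑ X : Fin N → ι, f (Fin.snoc X y) := by
  rw [← Fintype.sum_prod_type', ← Equiv.sum_comp (Fin.snocEquiv fun _ : Fin (N + 1) => ι)]
  rfl

/-- A product of matrices expanded over all intermediate indices; the indices will be the bit
strings of the columns. -/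
lemma sum_paths (M : ℕ → Matrix ι ι ℂ) (g : ι → ℂ) (N : ℕ) (F : ι → ℂ) :
    ∑ X : Fin (N + 1) → ι,
      g (X 0) * (∏ j : Fin N, M j (X j.succ) (X j.castSucc)) * F (X (Fin.last N)) =
      ∑ y, F y * iterateMulVec M g N y := by
  induction N generalizing F with
  | zero =>
    rw [sum_fin_succ_last]
    refine Finset.sum_congr rfl fun y _ => ?_
    simp [iterateMulVec, Fin.snoc, mul_comm]
  | succ N ih =>
    rw [sum_fin_succ_last, Finset.sum_comm]
    have h : ∀ X : Fin (N + 1) → ι, (∑ y, g ((Fin.snoc X y : Fin (N + 2) → ι) 0) *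
        (∏ j : Fin (N + 1), M j ((Fin.snoc X y : Fin (N + 2) → ι) j.succ)
          ((Fin.snoc X y : Fin (N + 2) → ι) j.castSucc)) *
        F ((Fin.snoc X y : Fin (N + 2) → ι) (Fin.last (N + 1)))) =
        g (X 0) * (∏ j : Fin N, M j (X j.succ) (X j.castSucc)) *
          ∑ y, F y * M N y (X (Fin.last N)) := by
      intro X
      rw [Finset.mul_sum]
      refine Finset.sum_congr rfl fun y _ => ?_
      rw [Fin.prod_univ_castSucc]
      have h0 : (Fin.snoc X y : Fin (N + 2) → ι) 0 = X 0 := by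
        rw [← Fin.castSucc_zero, Fin.snoc_castSucc]
      simp only [h0, Fin.snoc_castSucc, Fin.succ_last, Fin.snoc_last, ← Fin.castSucc_succ,
        Fin.val_castSucc, Fin.val_last]
      ring
    rw [Finset.sum_congr rfl fun X _ => h X]
    refine (ih fun y' => ∑ y, F y * M N y y').trans ?_
    simp only [iterateMulVec, mulVec, dotProduct, Finset.sum_mul, Finset.mul_sum]
    rw [Finset.sum_comm]
    exact Finset.sum_congr rfl fun _ _ => Finset.sum_congr rfl fun _ _ => by ring

end Paths

/-! ### The brickwork state column by column -/

variable {n w : ℕ}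

/-- The values on the vertices, column by column. -/
def columnEquiv (n w : ℕ) : (Fin (4 * w + 1) → Fin n → Fin 2) ≃ (Vertex n w → Fin 2) where
  toFun X u := X u.2 u.1
  invFun x j i := x (i, j)
  left_inv _ := rfl
  right_inv _ := rfl

/-- The vertical edges of column `j`. -/
abbrev verticallyLinked (w j i i' : ℕ) : Prop :=
  ∃ t : Fin w, bricked t i i' ∧ (j = 4 * t + 2 ∨ j = 4 * t + 4)

/-- Vertical edges stay within a column and row edges join consecutive columns, which is the shape
required for a product of transfer matrices. -/
lemma edgeSign_linked (X : Fin (4 * w + 1) → Fin n → Fin 2) :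
    edgeSign linked (columnEquiv n w X) =
      (∏ j : Fin (4 * w + 1), edgeSign (fun i i' : Fin n => verticallyLinked w j i i') (X j)) *
        ∏ j : Fin (4 * w), ∏ i, phase (piBit (X j.castSucc i)) (X j.succ i) := by
  set x := columnEquiv n w X
  have hsplit : ∀ u u' : Vertex n w, (if linked u u' ∧ x u = 1 ∧ x u' = 1 then (-1 : ℂ) else 1) =
      (if u.2 = u'.2 ∧ verticallyLinked w u.2 u.1 u'.1 ∧ x u = 1 ∧ x u' = 1 then -1 else 1) *
        (if u.1 = u'.1 ∧ (u.2 : ℕ) + 1 = u'.2 ∧ x u = 1 ∧ x u' = 1 then -1 else 1) := by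
    intro u u'
    by_cases h1 : u.2 = u'.2
    · simp [linked, h1]
    · simp [linked, h1, and_assoc]
  rw [edgeSign]
  simp only [hsplit, Finset.prod_mul_distrib]
  congr 1
  · rw [Fintype.prod_prod_type, Finset.prod_comm]
    refine Finset.prod_congr rfl fun j _ => ?_
    refine Finset.prod_congr rfl fun i _ => ?_
    rw [Fintype.prod_prod_type]
    refine Finset.prod_congr rfl fun i' _ => ?_
    rw [Finset.prod_eq_single j]
    · simp only [true_and]
      rfl
    · intro j' _ hj'
      rw [if_neg]
      rintro ⟨h, -⟩
      exact hj' h.symm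
    · simp
  · rw [Fintype.prod_prod_type, Finset.prod_comm, Fin.prod_univ_castSucc]
    rw [Finset.prod_eq_one (s := Finset.univ) (f := fun i : Fin n => ∏ u' : Vertex n w, _), mul_one]
    · refine Finset.prod_congr rfl fun j _ => ?_
      refine Finset.prod_congr rfl fun i _ => ?_
      rw [Finset.prod_eq_single (i, j.succ), phase_piBit]
      · simp [x, columnEquiv]
      · rintro ⟨i', j'⟩ - hne
        rw [if_neg]
        rintro ⟨h1, h2, -⟩
        exact hne (Prod.ext h1.symm (Fin.ext (by simpa using h2.symm)))
      · simp
    · intro i _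
      refine Finset.prod_eq_one fun u' _ => if_neg ?_
      rintro ⟨-, h, -⟩
      have := u'.2.2
      simp only [Fin.val_last] at h
      omega

/-- The column with number `j`. -/
def colOfNat (w j : ℕ) : Fin (4 * w + 1) := Fin.ofNat (4 * w + 1) j

lemma colOfNat_castSucc (j : Fin (4 * w)) : colOfNat w j = j.castSucc := by
  ext
  simp [colOfNat]

lemma colOfNat_col (t : Fin w) (p : Fin 4) : colOfNat w (4 * t + p) = col t p := by
  ext
  simp [colOfNat, col, Nat.mod_eq_of_lt (show (4 * t + p : ℕ) < 4 * w + 1 by omega)]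

/-- The map on the logical qubits between two columns. -/
def transfer (l : Vertex n w → ZMod 8) (j : ℕ) : Matrix (Fin n → Fin 2) (Fin n → Fin 2) ℂ :=
  (invSqrtTwo ^ n)⁻¹ • (cZ (fun i i' : Fin n => verticallyLinked w (j + 1) i i') *
    tensorOp fun i => hadamard * rotZ (l (i, colOfNat w j)))

/-- The sign of a row edge is an entry of `√2 H`; the prefactor of `transfer` removes the `1/√2` of
the `n` Hadamards. -/
lemma transfer_apply (l : Vertex n w → ZMod 8) (j : ℕ) (y y' : Fin n → Fin 2) :
    transfer l j y y' = edgeSign (fun i i' : Fin n => verticallyLinked w (j + 1) i i') y *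
      ((∏ i, phase (piBit (y' i)) (y i)) * ∏ i, phase (l (i, colOfNat w j)) (y' i)) := by
  have h := pow_ne_zero n invSqrtTwo_ne_zero
  rw [transfer, Matrix.smul_apply, cZ, diagonal_mul, smul_eq_mul]
  simp only [tensorOp, Matrix.of_apply, rotZ_eq_diagonal, mul_diagonal, hadamard_apply,
    Finset.prod_mul_distrib, Finset.prod_const, Finset.card_univ, Fintype.card_fin]
  rw [edgeSign]
  field_simp

lemma graphSum_eq_sum_iterateMulVec (l : Vertex n w → ZMod 8) :
    graphSum l = ∑ y, (∏ i, phase (l (i, Fin.last _)) (y i)) *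
      iterateMulVec (transfer l) (fun _ => 1) (4 * w) y := by
  rw [← sum_paths, graphSum, ← Equiv.sum_comp (columnEquiv n w)]
  refine Finset.sum_congr rfl fun X _ => ?_
  -- The first column has no vertical edges, since these lie in columns `4t + 2` and `4t + 4`. Those
  -- of any other column belong to the transfer into it.
  have h0 : edgeSign (fun i i' : Fin n => verticallyLinked w ((0 : Fin (4 * w + 1)) : ℕ) i i')
      (X 0) = 1 := by
    refine Finset.prod_eq_one fun i _ => Finset.prod_eq_one fun i' _ => if_neg ?_
    rintro ⟨⟨t, -, h | h⟩, -⟩ <;> simp at h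
  have h1 : ∏ u, phase (l u) (columnEquiv n w X u) =
      (∏ j : Fin (4 * w), ∏ i, phase (l (i, j.castSucc)) (X j.castSucc i)) *
        ∏ i, phase (l (i, Fin.last _)) (X (Fin.last _) i) := by
    rw [Fintype.prod_prod_type, Finset.prod_comm, Fin.prod_univ_castSucc]
    rfl
  rw [edgeSign_linked, Fin.prod_univ_succ, h0, h1]
  simp only [transfer_apply, colOfNat_castSucc, Finset.prod_mul_distrib, Fin.val_succ]
  ring

lemma iterateMulVec_add_four {ι : Type} [Fintype ι] (M : ℕ → Matrix ι ι ℂ) (g : ι → ℂ) (N : ℕ) :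
    iterateMulVec M g (N + 4) =
      (M (N + 3) * (M (N + 2) * (M (N + 1) * M N))) *ᵥ iterateMulVec M g N := by
  simp only [iterateMulVec, mulVec_mulVec]

lemma conjTranspose_rotZ (l : ZMod 8) : (rotZ l)ᴴ = rotZ (-l) := by
  rw [rotZ_eq_diagonal, rotZ_eq_diagonal, diagonal_conjTranspose]
  congr 1
  funext b
  exact star_phase l b

lemma conjTranspose_hadamard : hadamardᴴ = hadamard := by
  ext i j
  rw [conjTranspose_apply, hadamard_apply, hadamard_apply, star_mul', star_invSqrtTwo, star_phase]
  fin_cases i <;> fin_cases j <;> simp [piBit, phase, stdAddChar_four]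
  have : (-4 : ZMod 8) = 4 := rfl
  simp [this, stdAddChar_four]

lemma hadamard_mul_self : hadamard * hadamard = 1 := by
  have h := mem_unitaryGroup_iff'.1 hadamard_mem
  rwa [star_eq_conjTranspose, conjTranspose_hadamard] at h

lemma conjTranspose_rotX (l : ZMod 8) : (rotX l)ᴴ = rotX (-l) := by
  rw [rotX, rotX, conjTranspose_mul, conjTranspose_mul, conjTranspose_hadamard,
    conjTranspose_rotZ, mul_assoc]

lemma tensorOp_diagonal {J : Type} [Fintype J] [DecidableEq J] (d : J → Fin 2 → ℂ) :
    tensorOp (fun i => diagonal (d i)) = diagonal fun x => ∏ i, d i (x i) := by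
  ext x y
  rw [tensorOp, Matrix.of_apply]
  by_cases h : x = y
  · subst h
    simp
  · rw [diagonal_apply_ne _ h]
    obtain ⟨i, hi⟩ := Function.ne_iff.1 h
    exact Finset.prod_eq_zero (Finset.mem_univ i) (diagonal_apply_ne _ hi)

lemma cZ_congr {J : Type} [Fintype J] [DecidableEq J] {R R' : J → J → Prop} [DecidableRel R]
    [DecidableRel R'] (h : ∀ u u', R u u' ↔ R' u u') : cZ R = cZ R' := by
  simp only [cZ, h]

lemma cZ_false {J : Type} [Fintype J] [DecidableEq J] {R : J → J → Prop} [DecidableRel R]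
    (h : ∀ u u', ¬ R u u') : cZ R = 1 := by
  simp [cZ, h]

/-- Four columns apply `H R_Z` four times to each row, and the Hadamards turn every second rotation
into `R_X`. The vertical edges of the two columns concerned are the brick layers; the first one
commutes with the rotation of position `2` because both are diagonal. -/
lemma transfer_tape {φ l : Vertex n w → ZMod 8} (t : Fin w)
    (hl : ∀ i p, l (i, col t p) = -φ (i, col t p)) :
    transfer l (4 * t + 3) * (transfer l (4 * t + 2) * (transfer l (4 * t + 1) *
      transfer l (4 * t))) = ((invSqrtTwo ^ n)⁻¹ ^ 4) • tapeUnitary φ t := by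
  have h0 : colOfNat w (4 * t) = col t 0 := colOfNat_col t 0
  have h1 : colOfNat w (4 * t + 1) = col t 1 := colOfNat_col t 1
  have h2 : colOfNat w (4 * t + 2) = col t 2 := colOfNat_col t 2
  have h3 : colOfNat w (4 * t + 3) = col t 3 := colOfNat_col t 3
  have hc1 : cZ (fun i i' : Fin n => verticallyLinked w (4 * t + 1) i i') = 1 := by
    refine cZ_false fun i i' => ?_
    rintro ⟨t', -, h | h⟩ <;> omega
  have hc3 : cZ (fun i i' : Fin n => verticallyLinked w (4 * t + 2 + 1) i i') = 1 := by
    refine cZ_false fun i i' => ?_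
    rintro ⟨t', -, h | h⟩ <;> omega
  have hc2 : cZ (fun i i' : Fin n => verticallyLinked w (4 * t + 1 + 1) i i') =
      brickLayer n t := by
    refine cZ_congr fun i i' => ⟨?_, fun h => ⟨t, h, Or.inl rfl⟩⟩
    rintro ⟨t', h', h | h⟩
    · rwa [show (t : ℕ) = t' by omega]
    · omega
  have hc4 : cZ (fun i i' : Fin n => verticallyLinked w (4 * t + 3 + 1) i i') =
      brickLayer n t := by
    refine cZ_congr fun i i' => ⟨?_, fun h => ⟨t, h, Or.inr rfl⟩⟩
    rintro ⟨t', h', h | h⟩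
    · omega
    · rwa [show (t : ℕ) = t' by omega]
  have hcomm : (tensorOp fun i : Fin n => rotZ (-φ (i, col t 2))) * brickLayer n t =
      brickLayer n t * tensorOp fun i : Fin n => rotZ (-φ (i, col t 2)) := by
    simp only [rotZ_eq_diagonal, tensorOp_diagonal, brickLayer, cZ, diagonal_mul_diagonal, mul_comm]
  simp only [transfer, h0, h1, h2, h3, hc1, hc2, hc3, hc4, hl, one_mul, tapeUnitary,
    conjTranspose_rotZ, conjTranspose_rotX, smul_mul_assoc, mul_smul_comm, smul_smul]
  simp only [rotX]
  have e1 : (tensorOp fun i : Fin n => hadamard * rotZ (-φ (i, col t 1))) *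
      (tensorOp fun i : Fin n => hadamard * rotZ (-φ (i, col t 0))) =
      tensorOp fun i : Fin n => hadamard * rotZ (-φ (i, col t 1)) * hadamard *
        rotZ (-φ (i, col t 0)) := by
    rw [tensorOp_mul]
    simp only [mul_assoc]
  have e2 : (tensorOp fun i : Fin n => hadamard * rotZ (-φ (i, col t 3))) *
      (tensorOp fun i : Fin n => hadamard * rotZ (-φ (i, col t 2))) =
      (tensorOp fun i : Fin n => hadamard * rotZ (-φ (i, col t 3)) * hadamard) *
        tensorOp fun i : Fin n => rotZ (-φ (i, col t 2)) := by
    simp only [tensorOp_mul, mul_assoc]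
  have e3 : (tensorOp fun i : Fin n => rotZ (-φ (i, col t 2))) *
      (tensorOp fun i : Fin n => hadamard * rotZ (-φ (i, col t 1)) * hadamard *
        rotZ (-φ (i, col t 0))) =
      tensorOp fun i : Fin n => rotZ (-φ (i, col t 2)) * (hadamard * rotZ (-φ (i, col t 1)) *
        hadamard) * rotZ (-φ (i, col t 0)) := by
    rw [tensorOp_mul]
    simp only [mul_assoc]
  congr 1
  · ring
  · rw [mul_assoc (brickLayer n t) (tensorOp _) (tensorOp _), e1, mul_assoc (brickLayer n t),
      ← mul_assoc (tensorOp _) (tensorOp _), e2, mul_assoc (tensorOp _) (tensorOp _),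
      ← mul_assoc (tensorOp fun i : Fin n => rotZ (-φ (i, col t 2))), hcomm,
      mul_assoc (brickLayer n t) (tensorOp _) (tensorOp _), e3]
    simp only [mul_assoc]

/-! ### The target amplitude -/

lemma list_reverse_prod_mulVec_induction {ι : Type} [Fintype ι] [DecidableEq ι] {w : ℕ}
    (U : Fin w → Matrix ι ι ℂ) (P : ℕ → (ι → ℂ) → Prop) {ψ₀ : ι → ℂ} (h0 : P 0 ψ₀)
    (hs : ∀ (t : Fin w) (ψ : ι → ℂ), P t ψ → P (t + 1) (U t *ᵥ ψ)) :
    P w (((List.finRange w).map U).reverse.prod *ᵥ ψ₀) := by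
  induction w with
  | zero => simpa using h0
  | succ w ih =>
    have h := ih (fun t => U t.castSucc) fun t => hs t.castSucc
    rw [List.finRange_succ_last, List.map_append, List.map_map, List.reverse_append,
      List.prod_append, ← mulVec_mulVec]
    simpa [Function.comp_def] using hs (Fin.last w) _ h

/-- A property of vectors that holds initially and is preserved by the tapes holds for the final
state of the logical circuit. -/
lemma logicalCircuit_mulVec_induction (φ : Vertex n w → ZMod 8)
    (P : ℕ → ((Fin n → Fin 2) → ℂ) → Prop) {ψ₀ : (Fin n → Fin 2) → ℂ} (h0 : P 0 ψ₀)
    (hs : ∀ (t : Fin w) (ψ : (Fin n → Fin 2) → ℂ), P t ψ → P (t + 1) (tapeUnitary φ t *ᵥ ψ)) :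
    P w (logicalCircuit φ *ᵥ ψ₀) :=
  list_reverse_prod_mulVec_induction (tapeUnitary φ) P h0 hs

lemma iterateMulVec_transfer {φ l : Vertex n w → ZMod 8}
    (hl : ∀ i t p, l (i, col t p) = -φ (i, col t p)) :
    iterateMulVec (transfer l) (fun _ => 1) (4 * w) =
      ((invSqrtTwo ^ n)⁻¹ ^ (4 * w + 1)) •
        (logicalCircuit φ *ᵥ tensorKet fun _ => ketXY 0 0) := by
  have hr := pow_ne_zero n invSqrtTwo_ne_zero
  -- The all-ones vector is `(√2)^n` times `|+⟩ ⊗ … ⊗ |+⟩`, whence the extra `1` in the exponent.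
  refine logicalCircuit_mulVec_induction φ (fun t ψ =>
    iterateMulVec (transfer l) (fun _ => 1) (4 * t) = ((invSqrtTwo ^ n)⁻¹ ^ (4 * t + 1)) • ψ)
    ?_ fun t ψ h => ?_
  · ext x
    have hz : piBit 0 = 0 := rfl
    simp [iterateMulVec, tensorKet, ketXY_apply, hz, hr]
  · rw [mul_add, iterateMulVec_add_four, transfer_tape t fun i p => hl i t p, h, mulVec_smul,
      smul_mulVec, smul_smul]
    congr 1
    ring

/-- No transfer follows the last column: its phases form the bra of the final measurement, whose
normalisation gives one more factor. -/
lemma graphSum_plainAngle (φ : Vertex n w → ZMod 8) (s : Vertex n w → Fin 2) :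
    graphSum (plainAngle φ s) = (invSqrtTwo ^ n)⁻¹ ^ (4 * w + 2) *
      targetAmplitude φ fun i => s (i, Fin.last _) := by
  have hr := pow_ne_zero n invSqrtTwo_ne_zero
  have hpi : ∀ b : Fin 2, -piBit b = piBit b := by decide
  have hcol : ∀ (t : Fin w) (p : Fin 4), col t p ≠ Fin.last (4 * w) := by
    intro t p h
    have := congrArg Fin.val h
    simp only [col, Fin.val_last] at this
    omega
  rw [graphSum_eq_sum_iterateMulVec, iterateMulVec_transfer (φ := φ)
    fun i t p => by simp [plainAngle, hcol], targetAmplitude, dotProduct, Finset.mul_sum]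
  refine Finset.sum_congr rfl fun y _ => ?_
  simp only [plainAngle, if_true, Pi.smul_apply, smul_eq_mul, Pi.star_apply, tensorKet,
    ketXY_apply, star_prod, star_mul', star_pow, star_invSqrtTwo, star_phase, Finset.prod_mul_distrib,
    Finset.prod_const, Finset.card_univ, Fintype.card_fin, neg_add, hpi]
  have h : (invSqrtTwo ^ n)⁻¹ ^ (4 * w + 2) * invSqrtTwo ^ n = (invSqrtTwo ^ n)⁻¹ ^ (4 * w + 1) := by
    rw [pow_succ, mul_assoc, inv_mul_cancel₀ hr, mul_one]
  rw [← h]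
  ring

variable {v : ℕ}

/-- The outcomes outside the last column are uniform and independent of it. Counting powers of
`1/√2`, the overlap has `2n(4w + 1)` and the graph sum `-n(4w + 2)`, so `4wn` remain before
squaring. -/
lemma norm_overlap_measured_sq (a : Memory v n w) (k : Fin (v + 1)) :
    ‖star (tensorKet fun u => ketXY (a.δ k u) (a.s k u + a.tape.r k u)) ⬝ᵥ
        (cZ linked *ᵥ tensorKet fun u => ketXY (a.prepAngle k u) 0)‖ ^ 2 =
      ((2 : ℝ) ^ (4 * w * n))⁻¹ *
        ‖targetAmplitude (a.angle k) fun i => a.s k (i, Fin.last _)‖ ^ 2 := by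
  rw [norm_overlap_measured, graphSum_plainAngle, norm_mul, ← mul_assoc, mul_pow]
  congr 1
  have h := norm_invSqrtTwo_sq
  have h0 : ‖invSqrtTwo‖ ≠ 0 := by simpa using invSqrtTwo_ne_zero
  rw [← inv_pow (2 : ℝ), show (2 : ℝ)⁻¹ = ‖invSqrtTwo‖ ^ 2 by rw [h]; norm_num]
  simp only [norm_pow, norm_inv, Fintype.card_prod, Fintype.card_fin, inv_pow]
  rw [← div_eq_mul_inv, div_pow, div_eq_iff (by positivity)]
  ring

lemma sum_last_column {E : Type*} [AddCommMonoid E] (F : (Fin n → Fin 2) → E) :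
    ∑ s : Vertex n w → Fin 2, F (fun i => s (i, Fin.last _)) = (2 ^ (4 * w * n)) • ∑ o, F o := by
  rw [← Equiv.sum_comp (columnEquiv n w), sum_fin_succ_last, Finset.smul_sum]
  refine Finset.sum_congr rfl fun o _ => ?_
  simp only [columnEquiv, Equiv.coe_fn_mk, Fin.snoc_last, Finset.sum_const, Finset.card_univ,
    Fintype.card_pi, Fintype.card_fin, Finset.prod_const]
  rw [← pow_mul, mul_comm n]

end LayeredCircuit

/-! ### R-traps: single-row rotations and Hadamards -/

section RotationTraps

/-! ### Rotations of equatorial states -/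

variable {n w : ℕ}

lemma piBit_zero : piBit 0 = 0 := rfl

lemma rotZ_zero : rotZ 0 = 1 := by
  rw [rotZ_eq_diagonal, ← diagonal_one]
  congr 1
  funext b
  simp

lemma rotX_zero : rotX 0 = 1 := by
  rw [rotX, rotZ_zero, mul_one, hadamard_mul_self]

lemma rotZ_mulVec_ketXY (l l' : ZMod 8) (s : Fin 2) : rotZ l *ᵥ ketXY l' s = ketXY (l' + l) s := by
  ext b
  rw [rotZ_eq_diagonal, mulVec_diagonal, ketXY_apply, ketXY_apply, add_right_comm, phase_add _ l]
  ring

lemma hadamard_mulVec_mulVec (ψ : Fin 2 → ℂ) : hadamard *ᵥ (hadamard *ᵥ ψ) = ψ := by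
  rw [mulVec_mulVec, hadamard_mul_self, one_mulVec]

lemma ketXY_piBit (s : Fin 2) : ketXY (piBit s) 0 = hadamard *ᵥ Pi.single s 1 := by
  ext b
  rw [ketXY_apply, piBit_zero, add_zero, mulVec_single_one, col_apply, hadamard_apply]

lemma rotX_mulVec_ketXY (l : ZMod 8) (s : Fin 2) :
    rotX l *ᵥ ketXY (piBit s) 0 = phase l s • ketXY (piBit s) 0 := by
  rw [ketXY_piBit, rotX, ← mulVec_mulVec, hadamard_mulVec_mulVec, ← mulVec_mulVec, ← mulVec_smul]
  congr 1
  ext b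
  rw [rotZ_eq_diagonal, mulVec_diagonal, Pi.smul_apply, smul_eq_mul]
  by_cases h : b = s
  · rw [h]
  · simp [h]

/-- The Euler decomposition of the Hadamard into three quarter turns. The scalar is harmless, as the
traps are followed only up to scalars. -/
lemma rotZ_rotX_rotZ_eq_hadamard :
    rotZ (-2) * rotX (-2) * rotZ (-2) =
      (invSqrtTwo * (1 + ZMod.stdAddChar (-2 : ZMod 8))) • hadamard := by
  have h : ZMod.stdAddChar (-2 : ZMod 8) * ZMod.stdAddChar (-2 : ZMod 8) = -1 := by
    rw [← AddChar.map_add_eq_mul, ← stdAddChar_four]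
    rfl
  set z : ℂ := ZMod.stdAddChar (-2 : ZMod 8)
  have hd : hadamard = invSqrtTwo • !![1, 1; 1, -1] := rfl
  have hz : rotZ (-2) = !![1, 0; 0, z] := rfl
  have h2 := invSqrtTwo_mul_self
  rw [rotX, hd, hz]
  ext i j
  fin_cases i <;> fin_cases j <;>
    simp [Matrix.mul_apply, Fin.sum_univ_two, -mul_eq_mul_left_iff, -mul_eq_mul_right_iff]
  · ring
  · linear_combination -invSqrtTwo ^ 2 * h
  · linear_combination -invSqrtTwo ^ 2 * h
  · linear_combination (invSqrtTwo ^ 2 * (1 + z)) * h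

/-! ### Outcomes of a trap -/

lemma col_div {t : Fin w} {p : Fin 4} : ((col t p : Fin (4 * w + 1)) : ℕ) / 4 = t := by
  simp only [col]
  omega

lemma col_mod {t : Fin w} {p : Fin 4} : ((col t p : Fin (4 * w + 1)) : ℕ) % 4 = p := by
  simp only [col]
  omega

lemma col_lt {t : Fin w} {p : Fin 4} : ((col t p : Fin (4 * w + 1)) : ℕ) < 4 * w := by
  simp only [col]
  omega

/-- An outcome other than `0` has outcome `1` in some row, where the bra is orthogonal to the state.
-/
lemma targetAmplitude_eq_zero {φ : Vertex n w → ZMod 8} {c : ℂ}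
    (h : logicalCircuit φ *ᵥ (tensorKet fun _ => ketXY 0 0) =
      c • tensorKet fun i => ketXY (φ (i, Fin.last _)) 0) {o : Fin n → Fin 2} (ho : o ≠ 0) :
    targetAmplitude φ o = 0 := by
  obtain ⟨i, hi⟩ := Function.ne_iff.1 ho
  rw [targetAmplitude, h, dotProduct_smul, star_tensorKet_dotProduct,
    Finset.prod_eq_zero (Finset.mem_univ i), smul_zero]
  rw [star_ketXY_dotProduct]
  exact if_neg hi

/-! ### R-traps -/

/-- The sum of the values of `f` before `t`. -/
def sumBefore {E : Type*} [AddCommMonoid E] (f : Fin w → E) (t : ℕ) : E :=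
  ∑ t' : Fin w, if (t' : ℕ) < t then f t' else 0

lemma sumBefore_zero {E : Type*} [AddCommMonoid E] (f : Fin w → E) : sumBefore f 0 = 0 := by
  simp [sumBefore]

lemma sumBefore_succ {E : Type*} [AddCommMonoid E] (f : Fin w → E) (t : Fin w) :
    sumBefore f (t + 1) = sumBefore f t + f t := by
  have h : f t = ∑ t' : Fin w, if t' = t then f t' else 0 := by simp
  rw [h, sumBefore, sumBefore, ← Finset.sum_add_distrib]
  refine Finset.sum_congr rfl fun t' _ => ?_
  rcases lt_trichotomy t' t with h | h | h
  · have h1 : (t' : ℕ) < t := h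
    simp [h1, h1.trans (Nat.lt_succ_self _), h.ne]
  · subst h
    simp
  · have h1 : (t : ℕ) < t' := h
    have h2 : ¬ (t' : ℕ) < t + 1 := by omega
    have h3 : ¬ (t' : ℕ) < t := by omega
    simp [h2, h3, h.ne']

lemma sumBefore_self {E : Type*} [AddCommMonoid E] (f : Fin w → E) :
    sumBefore f w = ∑ t, f t := by
  simp [sumBefore]

section RTrap

variable (c : Fin n → Fin w → Fin 2) (a : Vertex n w → ZMod 8)

/-- The number of Hadamard tapes of row `i` before `t`. -/
def hadamardCount (i : Fin n) (t : ℕ) : ℕ :=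
  sumBefore (fun t' : Fin w => if isHadamard c i t' then 1 else 0) t

/-- The sum of the random angles of row `i` before tape `t`. -/
def rotationSum (i : Fin n) (t : ℕ) : ZMod 8 :=
  sumBefore (fun t' : Fin w => if isHadamard c i t' then 0 else ∑ p, rTrapAngle c a i t' p) t

/-- A tape before `t` is never the last one, so its coin alone decides whether it is a Hadamard
tape, and counting coins agrees with counting Hadamard tapes. -/
lemma hadamardsBefore_eq (i : Fin n) (t : Fin w) :
    hadamardsBefore c i t = hadamardCount c i t := by
  rw [hadamardsBefore, Finset.card_filter, hadamardCount, sumBefore]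
  refine Finset.sum_congr rfl fun t' _ => ?_
  by_cases h : t' < t
  · have h1 : (t' : ℕ) < t := h
    have h2 : (t' : ℕ) + 1 < w := by omega
    simp only [h, h1, isHadamard, h2, true_and, if_true]
  · have h1 : ¬ (t' : ℕ) < t := h
    simp [h, h1]

/-- The last tape is a Hadamard tape exactly when the count before it is odd. -/
lemma even_hadamardCount (i : Fin n) : Even (hadamardCount c i w) := by
  cases w with
  | zero => simp [hadamardCount, sumBefore_zero]
  | succ w =>
    have h : hadamardCount c i (w + 1) = hadamardCount c i w +
        if isHadamard c i (Fin.last w) then 1 else 0 := sumBefore_succ _ (Fin.last w)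
    have hH : isHadamard c i (Fin.last w) ↔ Odd (hadamardCount c i w) := by
      rw [isHadamard, if_neg (by simp), hadamardsBefore_eq, Fin.val_last]
    rw [h]
    by_cases h' : Odd (hadamardCount c i w)
    · rw [if_pos (hH.2 h')]
      exact h'.add_one
    · rw [if_neg (mt hH.1 h'), add_zero]
      exact Nat.not_odd_iff_even.1 h'

lemma rTrap_col (i : Fin n) (t : Fin w) (p : Fin 4) :
    rTrap c a (i, col t p) = rTrapAngle c a i t p := by
  simp only [rTrap, col_lt, dif_pos, col_div, col_mod]

/-- The state of a row of an R-trap, up to a scalar, after `q` Hadamards and rotations by the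
angles with sum `S`. -/
def rowKet (q : ℕ) (S : ZMod 8) : Fin 2 → ℂ :=
  if Even q then ketXY (-S) 0 else hadamard *ᵥ ketXY (-S) 0

lemma hadamard_mulVec_rowKet (q : ℕ) (S : ZMod 8) :
    hadamard *ᵥ rowKet q S = rowKet (q + 1) S := by
  unfold rowKet
  by_cases h : Even q
  · have h' : ¬ Even (q + 1) := by simpa [Nat.even_add_one] using h
    rw [if_pos h, if_neg h']
  · have h' : Even (q + 1) := by simpa [Nat.even_add_one] using h
    rw [if_neg h, if_pos h', hadamard_mulVec_mulVec]

/-- The Hadamard parity selects the axis. For even parity the `Z`-rotations add up on an equatorial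
state; for odd parity `R_X = H R_Z H` does the same behind the Hadamard. The adjoints account for
the sign in `-S`. -/
lemma rTrap_row (i : Fin n) (t : Fin w) :
    ∃ z : ℂ, ((rotZ (rTrap c a (i, col t 2)))ᴴ * (rotX (rTrap c a (i, col t 1)))ᴴ *
      (rotZ (rTrap c a (i, col t 0)))ᴴ) *ᵥ
        rowKet (hadamardCount c i t) (rotationSum c a i t) =
      z • rowKet (hadamardCount c i (t + 1)) (rotationSum c a i (t + 1)) := by
  have hH : hadamardCount c i (t + 1) = hadamardCount c i t + _ := sumBefore_succ _ t
  have hS : rotationSum c a i (t + 1) = rotationSum c a i t + _ := sumBefore_succ _ t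
  rw [hH, hS]
  simp only [rTrap_col, conjTranspose_rotZ, conjTranspose_rotX]
  by_cases h : isHadamard c i t
  · refine ⟨invSqrtTwo * (1 + ZMod.stdAddChar (-2 : ZMod 8)), ?_⟩
    have hp : ∀ p : Fin 4, p ≠ 3 → rTrapAngle c a i t p = 2 := by
      intro p hp
      rw [rTrapAngle, if_pos h, if_neg hp]
    rw [hp 0 (by decide), hp 1 (by decide), hp 2 (by decide), if_pos h, if_pos h,
      rotZ_rotX_rotZ_eq_hadamard, smul_mulVec, hadamard_mulVec_rowKet, add_zero]
  · refine ⟨1, ?_⟩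
    rw [if_neg h, if_neg h, add_zero, one_smul, Fin.sum_univ_four]
    by_cases hq : Even (hadamardCount c i t)
    · have h1 : rTrapAngle c a i t 1 = 0 := by
        rw [rTrapAngle, if_neg h, hadamardsBefore_eq, if_pos hq, if_neg (by decide)]
      have h3 : rTrapAngle c a i t 3 = 0 := by
        rw [rTrapAngle, if_neg h, hadamardsBefore_eq, if_pos hq, if_neg (by decide)]
      rw [h1, h3, neg_zero, rotX_zero, mul_one, ← mulVec_mulVec, rowKet, rowKet, if_pos hq,
        if_pos hq, rotZ_mulVec_ketXY, rotZ_mulVec_ketXY]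
      congr 1
      ring
    · have h0 : rTrapAngle c a i t 0 = 0 := by
        rw [rTrapAngle, if_neg h, hadamardsBefore_eq, if_neg hq, if_neg (by decide)]
      have h2 : rTrapAngle c a i t 2 = 0 := by
        rw [rTrapAngle, if_neg h, hadamardsBefore_eq, if_neg hq, if_neg (by decide)]
      have h3 : rTrapAngle c a i t 3 = 0 := by
        rw [rTrapAngle, if_neg h, hadamardsBefore_eq, if_neg hq, if_neg (by decide)]
      rw [h0, h2, h3, neg_zero, rotZ_zero, mul_one, one_mul, rowKet, rowKet, if_neg hq,
        if_neg hq, rotX, ← mulVec_mulVec, hadamard_mulVec_mulVec, ← mulVec_mulVec,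
        rotZ_mulVec_ketXY]
      congr 2
      ring

lemma cZ_mul_self {J : Type} [Fintype J] [DecidableEq J] (R : J → J → Prop) [DecidableRel R] :
    cZ R * cZ R = 1 := by
  have h : ∀ x : J → Fin 2, edgeSign R x * edgeSign R x = 1 := by
    intro x
    simp only [edgeSign, ← Finset.prod_mul_distrib]
    exact Finset.prod_eq_one fun _ _ => Finset.prod_eq_one fun _ _ => by split_ifs <;> simp
  rw [cZ, diagonal_mul_diagonal, ← diagonal_one]
  congr 1
  funext x
  exact h x

lemma logicalCircuit_rTrap :
    ∃ z : ℂ, logicalCircuit (rTrap c a) *ᵥ (tensorKet fun _ => ketXY 0 0) =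
      z • tensorKet fun i => ketXY (rTrap c a (i, Fin.last _)) 0 := by
  have h := logicalCircuit_mulVec_induction (rTrap c a)
    (fun t ψ => ∃ z : ℂ, ψ = z • tensorKet fun i =>
      rowKet (hadamardCount c i t) (rotationSum c a i t))
    (ψ₀ := tensorKet fun _ => ketXY 0 0) ⟨1, ?_⟩ ?_
  · obtain ⟨z, hz⟩ := h
    refine ⟨z, ?_⟩
    rw [hz]
    congr 2
    funext i
    -- An even number of Hadamards leaves `R_Z(-S)|+⟩`, and `-S` is the trap's angle in the last
    -- column.
    rw [rowKet, if_pos (even_hadamardCount c i), rotationSum, sumBefore_self]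
    simp [rTrap]
  · rw [one_smul]
    congr 1
    funext i
    rw [hadamardCount, rotationSum, sumBefore_zero, sumBefore_zero]
    simp [rowKet]
  · rintro t ψ ⟨z, rfl⟩
    choose z' hz' using fun i => rTrap_row c a i t
    refine ⟨z * ∏ i, z' i, ?_⟩
    -- Position `3` carries no rotation, so the two brick layers meet and cancel, and the rows do
    -- not interact.
    have h3 : ∀ i, rTrap c a (i, col t 3) = 0 := by
      intro i
      rw [rTrap_col]
      simp only [rTrapAngle]
      split_ifs <;> first | rfl | simp_all
    have hU : tapeUnitary (rTrap c a) t = tensorOp fun i => (rotZ (rTrap c a (i, col t 2)))ᴴ *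
        (rotX (rTrap c a (i, col t 1)))ᴴ * (rotZ (rTrap c a (i, col t 0)))ᴴ := by
      simp only [tapeUnitary, h3, rotX_zero, conjTranspose_one]
      rw [tensorOp_one, mul_one, brickLayer, cZ_mul_self, one_mul]
    rw [hU, mulVec_smul, tensorOp_mulVec_tensorKet]
    simp only [hz']
    rw [tensorKet_smul, smul_smul]

end RTrap

end RotationTraps

/-! ### C-traps: CNOT gates by phase kickback -/

section CNOTTraps

/-! ### Layers of controlled-X gates -/

section CNOTLayer

variable {J : Type} [Fintype J] [DecidableEq J] {N : J → J → Prop} [DecidableRel N]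

/-- The parity of the controls of `j`. -/
def controlParity (N : J → J → Prop) [DecidableRel N] (x : J → Fin 2) (j : J) : Fin 2 :=
  ∑ i, if N i j then x i else 0

omit [DecidableEq J] in
lemma edgeSign_eq_prod_controlParity (x : J → Fin 2) :
    edgeSign N x = ∏ j, phase (piBit (controlParity N x j)) (x j) := by
  rw [edgeSign, Finset.prod_comm]
  refine Finset.prod_congr rfl fun j _ => ?_
  rw [controlParity, piBit_sum, phase_sum]
  refine Finset.prod_congr rfl fun i _ => ?_
  rw [phase_piBit]
  by_cases h : N i j <;> simp [h]

/-- No control is a target, and `U` is trivial off the targets, so the control bits are conserved.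
For fixed control bits the layer acts on each target as a power of `Z`, and the expression factors
over the qubits. -/
lemma conj_cZ_mulVec_tensorKet (hN : ∀ i j k, N i j → ¬ N k i)
    {U : J → Matrix (Fin 2) (Fin 2) ℂ} (hU : ∀ j, (∀ i, ¬ N i j) → U j = 1)
    (k : J → Fin 2 → ℂ) (x : J → Fin 2) :
    ((cZ N * tensorOp U * cZ N) *ᵥ tensorKet k) x =
      ∏ j, ((rotZ (piBit (controlParity N x j)) * U j * rotZ (piBit (controlParity N x j))) *ᵥ
        k j) (x j) := by
  rw [← mulVec_mulVec, ← mulVec_mulVec, cZ_mulVec, edgeSign_eq_prod_controlParity]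
  change _ = tensorKet (fun j => (rotZ (piBit (controlParity N x j)) * U j *
    rotZ (piBit (controlParity N x j))) *ᵥ k j) x
  rw [← tensorOp_mulVec_tensorKet, mulVec, dotProduct, mulVec, dotProduct, Finset.mul_sum]
  refine Finset.sum_congr rfl fun y _ => ?_
  rw [cZ_mulVec, edgeSign_eq_prod_controlParity]
  simp only [tensorOp, Matrix.of_apply, rotZ_eq_diagonal, mul_diagonal, diagonal_mul,
    Finset.prod_mul_distrib]
  -- If `y` differs from `x` off the targets, an identity factor vanishes; otherwise both have the
  -- same control parities.
  by_cases h : ∀ i, (∀ j, ¬ N j i) → x i = y i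
  · have hp : controlParity N y = controlParity N x := by
      funext j
      refine Finset.sum_congr rfl fun i _ => ?_
      by_cases hij : N i j
      · rw [if_pos hij, if_pos hij, h i fun k => hN i j k hij]
      · rw [if_neg hij, if_neg hij]
    rw [hp]
    ring
  · push Not at h
    obtain ⟨i, hi, hxy⟩ := h
    have h0 : ∏ j, U j (x j) (y j) = 0 :=
      Finset.prod_eq_zero (Finset.mem_univ i) (by rw [hU i hi, one_apply_ne hxy])
    rw [h0]
    ring

-- A target has at most one control, so a phase of the parity can be moved to that control.
omit [DecidableEq J] in
lemma phase_controlParity [∀ j, Decidable (∃ i, N i j)]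
    (hN : ∀ i i' j, N i j → N i' j → i = i') (x : J → Fin 2) (j : J)
    (l : ZMod 8) :
    phase (if ∃ i, N i j then l else 0) (controlParity N x j) =
      ∏ i, phase (if N i j then l else 0) (x i) := by
  split_ifs with h
  · obtain ⟨i, hi⟩ := h
    have hne : ∀ i', i' ≠ i → ¬ N i' j := fun i' hi' h => hi' (hN _ _ _ h hi)
    rw [controlParity, Finset.sum_eq_single i, Finset.prod_eq_single i, if_pos hi, if_pos hi]
    · intro i' _ hi'
      rw [if_neg (hne i' hi'), phase_zero_left]
    · simp
    · intro i' _ hi'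
      rw [if_neg (hne i' hi')]
    · simp
  · rw [phase_zero_left, Finset.prod_eq_one]
    intro i _
    rw [if_neg fun hi => h ⟨i, hi⟩, phase_zero_left]

/-- A layer of controlled-X gates, up to rotations of the controls and targets, adds the phase of
each target to that of its control. -/
lemma cnot_layer [∀ j, Decidable (∃ i, N i j)] [∀ i, Decidable (∃ j, N i j)]
    (h1 : ∀ i j k, N i j → ¬ N k i) (h2 : ∀ i j j', N i j → N i j' → j = j')
    (h3 : ∀ i i' j, N i j → N i' j → i = i') (s : J → Fin 2) :
    ∃ z : ℂ, (cZ N * tensorOp (fun j => rotX (if ∃ i, N i j then 2 else 0)) * cZ N) *ᵥ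
        (tensorKet fun i => ketXY (piBit (s i) - if ∃ j, N i j then 2 else 0) 0) =
      z • tensorKet fun i => ketXY (piBit (s i) + ∑ j, if N i j then piBit (s j) else 0) 0 := by
  refine ⟨∏ j, phase (if ∃ i, N i j then 2 else 0) (s j), ?_⟩
  ext x
  rw [conj_cZ_mulVec_tensorKet h1]
  swap
  · intro j hj
    rw [if_neg (by simpa using hj), rotX_zero]
  have hsig : ∀ s : Fin 2, signed s 2 = 2 + piBit s := by decide
  have hsig0 : ∀ s : Fin 2, signed s 0 = 0 := by decide
  have hadd : ∀ s p : Fin 2, piBit s + piBit p = piBit (p + s) := by decide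
  have hadd' : ∀ s p : Fin 2, piBit (p + s) + piBit p = piBit s := by decide
  -- Phase kickback: the target is an eigenvector of `R_X`, and its control selects between `|+⟩`
  -- and `|-⟩`. The eigenvalue thus becomes a phase of the control.
  have hfac : ∀ j, (rotZ (piBit (controlParity N x j)) * rotX (if ∃ i, N i j then 2 else 0) *
      rotZ (piBit (controlParity N x j))) *ᵥ ketXY (piBit (s j) - if ∃ k, N j k then 2 else 0) 0 =
      (phase (if ∃ i, N i j then 2 else 0) (s j) *
        ∏ i, phase (if N i j then 2 + piBit (s j) else 0) (x i)) •
          ketXY (piBit (s j) - if ∃ k, N j k then 2 else 0) 0 := by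
    intro j
    rw [← phase_controlParity h3]
    by_cases hj : ∃ i, N i j
    · have hj' : ¬ ∃ k, N j k := by
        rintro ⟨k, hk⟩
        obtain ⟨i, hi⟩ := hj
        exact h1 j k i hk hi
      simp only [if_pos hj, if_neg hj', sub_zero]
      rw [← mulVec_mulVec, ← mulVec_mulVec, rotZ_mulVec_ketXY, hadd, rotX_mulVec_ketXY,
        mulVec_smul, rotZ_mulVec_ketXY, hadd', phase_add_right, hsig]
    · have hp : controlParity N x j = 0 := by
        refine Finset.sum_eq_zero fun i _ => if_neg fun hi => hj ⟨i, hi⟩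
      simp only [if_neg hj, hp, piBit_zero, rotZ_zero, rotX_zero, one_mulVec, phase_zero_left,
        mul_one, one_smul]
  -- The quarter turn kicked back cancels the one subtracted from the control beforehand; only the
  -- `π`-phase of the target remains.
  have hctl : ∀ i, (piBit (s i) - if ∃ j, N i j then 2 else 0) +
      (∑ j, if N i j then 2 + piBit (s j) else 0) =
      piBit (s i) + ∑ j, if N i j then piBit (s j) else 0 := by
    intro i
    by_cases hi : ∃ j, N i j
    · rw [if_pos hi]
      obtain ⟨j, hj⟩ := hi
      have hne : ∀ j', j' ≠ j → ¬ N i j' := fun j' hj' h => hj' (h2 _ _ _ h hj)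
      rw [Finset.sum_eq_single j, Finset.sum_eq_single j, if_pos hj, if_pos hj]
      · ring
      · exact fun j' _ hj' => if_neg (hne j' hj')
      · simp
      · exact fun j' _ hj' => if_neg (hne j' hj')
      · simp
    · rw [if_neg hi, Finset.sum_eq_zero, Finset.sum_eq_zero, sub_zero]
      · exact fun j _ => if_neg fun hj => hi ⟨j, hj⟩
      · exact fun j _ => if_neg fun hj => hi ⟨j, hj⟩
  simp only [hfac, Pi.smul_apply, smul_eq_mul, Finset.prod_mul_distrib, tensorKet]
  rw [mul_assoc, Finset.prod_comm, ← Finset.prod_mul_distrib]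
  congr 1
  refine Finset.prod_congr rfl fun i _ => ?_
  rw [← phase_sum, ← hctl, ketXY_apply, ketXY_apply, piBit_zero, add_zero, add_zero, phase_add]
  ring

end CNOTLayer

/-! ### C-traps -/

variable {n w : ℕ}

section CTrap

variable (c₀ : Fin n → Fin 2) (c : Fin n → Fin w → Fin 2)

/-- The upper rows of the bricks of one tape have a fixed parity, so the bricks are disjoint pairs
of rows. The two uniqueness lemmas below have the same reason. -/
lemma isCNOT_control_ne_target (t : Fin w) (i j k : Fin n) (h : isCNOT c t i j) :
    ¬ isCNOT c t k i := by
  rintro (⟨⟨h3, h4⟩, h5⟩ | ⟨⟨h3, h4⟩, h5⟩) <;>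
    rcases h with ⟨⟨h1, h2⟩, h0⟩ | ⟨⟨h1, h2⟩, h0⟩ <;> rw [Nat.even_iff] at h2 h4
  · omega
  · have : j = k := Fin.ext (by omega)
    subst this
    rw [h5] at h0
    exact absurd h0 (by decide)
  · rw [h5] at h0
    exact absurd h0 (by decide)
  · omega

lemma isCNOT_target_unique (t : Fin w) (i j j' : Fin n) (h : isCNOT c t i j)
    (h' : isCNOT c t i j') : j = j' := by
  rcases h with ⟨⟨h1, h2⟩, -⟩ | ⟨⟨h1, h2⟩, -⟩ <;>
    rcases h' with ⟨⟨h3, h4⟩, -⟩ | ⟨⟨h3, h4⟩, -⟩ <;> rw [Nat.even_iff] at h2 h4 <;>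
    exact Fin.ext (by omega)

lemma isCNOT_control_unique (t : Fin w) (i i' j : Fin n) (h : isCNOT c t i j)
    (h' : isCNOT c t i' j) : i = i' := by
  rcases h with ⟨⟨h1, h2⟩, -⟩ | ⟨⟨h1, h2⟩, -⟩ <;>
    rcases h' with ⟨⟨h3, h4⟩, -⟩ | ⟨⟨h3, h4⟩, -⟩ <;> rw [Nat.even_iff] at h2 h4 <;>
    exact Fin.ext (by omega)

/-- A controlled-Z gate is symmetric, so orienting each brick by its coin does not change the layer.
-/
lemma brickLayer_eq_cZ_isCNOT (t : Fin w) :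
    brickLayer n t = cZ fun i j : Fin n => isCNOT c t i j := by
  rw [brickLayer, cZ, cZ]
  congr 1
  funext x
  have h : ∀ i j : Fin n, (if isCNOT c t i j ∧ x i = 1 ∧ x j = 1 then (-1 : ℂ) else 1) =
      (if bricked t i j ∧ c i t = 0 ∧ x i = 1 ∧ x j = 1 then -1 else 1) *
        (if bricked t j i ∧ c j t = 1 ∧ x i = 1 ∧ x j = 1 then -1 else 1) := by
    intro i j
    by_cases h1 : bricked t i j
    · have h2 : ¬ bricked t j i := fun h2 => by
        have := h1.1
        have := h2.1
        omega
      simp only [isCNOT, h1, h2, true_and, false_and, or_false, if_false, mul_one, and_assoc]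
    · simp only [isCNOT, h1, false_and, false_or, if_false, one_mul, and_assoc]
  simp only [h, Finset.prod_mul_distrib]
  rw [Finset.prod_comm (f := fun i j : Fin n =>
    if bricked t j i ∧ c j t = 1 ∧ x i = 1 ∧ x j = 1 then (-1 : ℂ) else 1),
    ← Finset.prod_mul_distrib]
  refine Finset.prod_congr rfl fun i _ => ?_
  rw [← Finset.prod_mul_distrib]
  refine Finset.prod_congr rfl fun j _ => ?_
  have hc : c i t = 0 ∨ c i t = 1 := by omega
  rcases hc with hc | hc <;> simp [hc, and_comm]

lemma cTrap_col (i : Fin n) (t : Fin w) (p : Fin 4) :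
    cTrap c₀ c (i, col t p) = cTrapAngle c₀ c i t p := by
  simp only [cTrap, col_lt, dif_pos, col_div, col_mod]

/-- All phases remain multiples of `π`; this is what makes the targets eigenvectors of `R_X`. -/
lemma cTrapPhase_eq_piBit (t : ℕ) (i : Fin n) : ∃ s, cTrapPhase c₀ c t i = piBit s := by
  induction t generalizing i with
  | zero =>
    rcases eq_or_ne (c₀ i) 0 with h | h
    · exact ⟨1, by simp [cTrapPhase, h, piBit]⟩
    · exact ⟨0, by simp [cTrapPhase, h, piBit]⟩
  | succ t ih =>
    have hadd : ∀ b c : Fin 2, piBit b + piBit c = piBit (b + c) := by decide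
    choose s hs using ih
    simp only [cTrapPhase, hs]
    split_ifs with h
    · refine ⟨s i + ∑ j, if isCNOT c ⟨t, h⟩ i j then s j else 0, ?_⟩
      rw [← hadd, piBit_sum]
      congr 1
      refine Finset.sum_congr rfl fun j _ => ?_
      split_ifs <;> rfl
    · exact ⟨s i, add_zero _⟩

/-- Before tape `0` the initial `Z` gates have not acted yet, so the incoming phase there is `0` and
position `0` supplies them. Position `1` then meets an eigenvector of `R_X`, and position `2` gives
each control the quarter turn that `cnot_layer` expects. -/
lemma cTrap_row (i : Fin n) (t : Fin w) :
    ∃ z : ℂ, ((rotZ (cTrap c₀ c (i, col t 2)))ᴴ * (rotX (cTrap c₀ c (i, col t 1)))ᴴ *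
      (rotZ (cTrap c₀ c (i, col t 0)))ᴴ) *ᵥ
        ketXY (if (t : ℕ) = 0 then 0 else cTrapPhase c₀ c t i) 0 =
      z • ketXY (cTrapPhase c₀ c t i - if ∃ j, isCNOT c t i j then 2 else 0) 0 := by
  obtain ⟨s, hs⟩ := cTrapPhase_eq_piBit c₀ c t i
  have h0 : (if (t : ℕ) = 0 then 0 else cTrapPhase c₀ c t i) + -cTrap c₀ c (i, col t 0) =
      piBit s := by
    rw [cTrap_col, cTrapAngle, if_pos rfl, ← hs]
    by_cases ht : (t : ℕ) = 0
    · rw [ht]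
      by_cases hc : c₀ i = 0
      · simp only [cTrapPhase, hc]
        decide
      · simp [cTrapPhase, hc]
    · simp [ht]
  have h2 : cTrap c₀ c (i, col t 2) = if ∃ j, isCNOT c t i j then 2 else 0 := by
    rw [cTrap_col, cTrapAngle, if_neg (by decide), if_pos rfl]
  refine ⟨phase (-cTrap c₀ c (i, col t 1)) s, ?_⟩
  rw [← mulVec_mulVec, ← mulVec_mulVec, conjTranspose_rotZ, conjTranspose_rotZ,
    conjTranspose_rotX, rotZ_mulVec_ketXY, h0, rotX_mulVec_ketXY, mulVec_smul, rotZ_mulVec_ketXY,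
    h2, hs, sub_eq_add_neg]

lemma tapeUnitary_cTrap (t : Fin w) :
    ∃ z : ℂ, tapeUnitary (cTrap c₀ c) t *ᵥ
        (tensorKet fun i => ketXY (if (t : ℕ) = 0 then 0 else cTrapPhase c₀ c t i) 0) =
      z • tensorKet fun i => ketXY (cTrapPhase c₀ c (t + 1) i) 0 := by
  choose z hz using fun i => cTrap_row c₀ c i t
  choose s hs using fun i => cTrapPhase_eq_piBit c₀ c t i
  obtain ⟨z', hz'⟩ := cnot_layer (N := fun i j => isCNOT c t i j)
    (isCNOT_control_ne_target c t)
    (isCNOT_target_unique c t) (isCNOT_control_unique c t) s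
  -- The adjoint turns the angle `-π/2` at position `3` into the `π/2` of `cnot_layer`.
  have h3 : ∀ i, (rotX (cTrap c₀ c (i, col t 3)))ᴴ =
      rotX (if ∃ j, isCNOT c t j i then 2 else 0) := by
    intro i
    rw [conjTranspose_rotX, cTrap_col, cTrapAngle, if_neg (by decide), if_neg (by decide)]
    by_cases h : ∃ j, isCNOT c t j i
    · rw [if_pos h, if_pos h, if_neg (by decide), neg_neg]
    · rw [if_neg h, if_neg h, neg_zero]
  have hsucc : ∀ i, cTrapPhase c₀ c (t + 1) i =
      piBit (s i) + ∑ j, if isCNOT c t i j then piBit (s j) else 0 := by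
    intro i
    simp only [cTrapPhase, hs, t.2, dif_pos]
  refine ⟨(∏ i, z i) * z', ?_⟩
  rw [tapeUnitary, ← mulVec_mulVec, tensorOp_mulVec_tensorKet]
  simp only [hz, h3, hsucc]
  simp only [hs]
  rw [tensorKet_smul, brickLayer_eq_cZ_isCNOT c, mulVec_smul, hz', smul_smul]

/-- At least one tape is needed: without it the initial `Z` gates would never act, although the
angles of the last column already contain their phases. -/
lemma logicalCircuit_cTrap (hw : 1 ≤ w) :
    ∃ z : ℂ, logicalCircuit (cTrap c₀ c) *ᵥ (tensorKet fun _ => ketXY 0 0) =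
      z • tensorKet fun i => ketXY (cTrap c₀ c (i, Fin.last _)) 0 := by
  have h := logicalCircuit_mulVec_induction (cTrap c₀ c)
    (fun t ψ => ∃ z : ℂ, ψ = z • tensorKet fun i =>
      ketXY (if t = 0 then 0 else cTrapPhase c₀ c t i) 0)
    (ψ₀ := tensorKet fun _ => ketXY 0 0) ⟨1, by simp⟩ ?_
  · obtain ⟨z, hz⟩ := h
    refine ⟨z, ?_⟩
    rw [hz]
    congr 2
    funext i
    rw [if_neg (by omega)]
    simp [cTrap]
  · rintro t ψ ⟨z, rfl⟩
    obtain ⟨z', hz'⟩ := tapeUnitary_cTrap c₀ c t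
    refine ⟨z * z', ?_⟩
    rw [mulVec_smul, hz', smul_smul]
    simp

end CTrap

variable {v : ℕ}

/-- The outcomes of the last column of a trap are `0`. -/
lemma targetAmplitude_trap (hw : 1 ≤ w) (a : Memory v n w) {k : Fin (v + 1)} (hk : k ≠ a.tape.vt)
    {o : Fin n → Fin 2} (ho : o ≠ 0) : targetAmplitude (a.angle k) o = 0 := by
  rw [Memory.angle, if_neg hk]
  split_ifs
  · obtain ⟨z, hz⟩ := logicalCircuit_cTrap (a.tape.cInit k) (a.tape.cCoin k) hw
    exact targetAmplitude_eq_zero hz ho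
  · obtain ⟨z, hz⟩ := logicalCircuit_rTrap (a.tape.rCoin k) (a.tape.rAngle k)
    exact targetAmplitude_eq_zero hz ho

end CNOTTraps

/-! ### Composition of the computations and correctness -/

section Correctness

variable {v n w : ℕ}

/-! ### A computation -/

lemma entangleStep_branch (a : Memory v n w) (β : BobReg n w → ℂ) (χ : ComReg → ℂ) :
    entangleStep.applyBC (branch a (tens β χ)) = branch a (tens (cZ linked *ᵥ β) χ) := by
  rw [applyBC_branch]
  change ∑ _u : Unit, branch a ((cZ (linked (n := n) (w := w)) ⊗ₖ 1) *ᵥ tens β χ) = _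
  rw [kronecker_mulVec_tens, one_mulVec]
  simp

lemma verifyStep_branch (k : Fin (v + 1)) (a : Memory v n w) (ψ : BobReg n w × ComReg → ℂ) :
    (verifyStep k).applyAC (branch a ψ) =
      branch { a with rejected := a.rejected || decide (a.fails k) } ψ := by
  rw [verifyStep, applyAC_instrument_branch]
  simp

lemma outputStep_branch (a : Memory v n w) (ψ : BobReg n w × ComReg → ℂ) :
    outputStep.applyAC (branch a ψ) = branch (Memory.final v w
      (if a.rejected then none else some fun i => a.s a.tape.vt (i, Fin.last _))) ψ := by
  rw [outputStep, applyAC_instrument_branch]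
  simp

/-- The vertices, row by row. -/
def verticesByRow (n w : ℕ) : List (Vertex n w) :=
  (List.finRange n).flatMap fun i => (List.finRange (4 * w + 1)).map fun j => (i, j)

/-- The vertices, column by column. -/
def verticesByCol (n w : ℕ) : List (Vertex n w) :=
  (List.finRange (4 * w + 1)).flatMap fun j => (List.finRange n).map fun i => (i, j)

lemma mem_verticesByRow (u : Vertex n w) : u ∈ verticesByRow n w := by
  simp [verticesByRow]

lemma mem_verticesByCol (u : Vertex n w) : u ∈ verticesByCol n w := by
  simp [verticesByCol]

lemma nodup_verticesByCol : (verticesByCol n w).Nodup := by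
  rw [verticesByCol, List.nodup_flatMap]
  refine ⟨fun j _ => (List.nodup_finRange n).map fun i i' h => (Prod.mk.inj h).1, ?_⟩
  refine (List.nodup_finRange _).imp fun {j j'} hj => ?_
  intro u hu hu'
  simp only [List.mem_map, List.mem_finRange, true_and] at hu hu'
  obtain ⟨i, rfl⟩ := hu
  obtain ⟨i', h⟩ := hu'
  exact hj (Prod.mk.inj h).2.symm

lemma pairwise_verticesByCol : (verticesByCol n w).Pairwise fun u u' => u.2 ≤ u'.2 := by
  rw [verticesByCol, List.pairwise_flatMap]
  refine ⟨fun j _ => ?_, ?_⟩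
  · rw [List.pairwise_map]
    exact List.Pairwise.imp (R := fun _ _ => True) (fun _ => le_refl j)
      (List.pairwise_of_forall fun _ _ => trivial)
  · refine (List.pairwise_lt_finRange _).imp fun {j j'} hj => ?_
    intro u hu u' hu'
    simp only [List.mem_map, List.mem_finRange, true_and] at hu hu'
    obtain ⟨i, rfl⟩ := hu
    obtain ⟨i', rfl⟩ := hu'
    exact hj.le

lemma computation_eq (T : ℕ) (k : Fin (v + 1)) :
    (computation T k : Protocol (Memory v n w) (BobReg n w) ComReg) =
      (verticesByRow n w).flatMap (fun u => preparation T k u) ++ [bobStep entangleStep] ++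
        measurements k (verticesByCol n w) ++ [aliceStep (verifyStep k)] := by
  simp only [computation, measurements, verticesByRow, verticesByCol, List.flatMap_assoc,
    List.flatMap_map]

/-- The memory after computation `k` with outcomes `s`. -/
def Memory.afterComputation (a : Memory v n w) (k : Fin (v + 1)) (s : Vertex n w → Fin 2) :
    Memory v n w :=
  { a.withOutcomes k s with rejected := a.rejected || decide ((a.withOutcomes k s).fails k) }

/-- The probability of the outcomes `s` in computation `k`. -/
def outcomeWeight (a : Memory v n w) (k : Fin (v + 1)) (s : Vertex n w → Fin 2) : ℝ :=
  ((2 : ℝ) ^ (4 * w * n))⁻¹ * ‖targetAmplitude (a.angle k) fun i => s (i, Fin.last _)‖ ^ 2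

lemma tensorOp_vecMulVec_mulVec {J : Type} [Fintype J] [DecidableEq J] (g m : J → Fin 2 → ℂ)
    (Ψ : (J → Fin 2) → ℂ) :
    tensorOp (fun u => vecMulVec (g u) (star (m u))) *ᵥ Ψ =
      (star (tensorKet m) ⬝ᵥ Ψ) • tensorKet g := by
  have h : tensorOp (fun u => vecMulVec (g u) (star (m u))) =
      vecMulVec (tensorKet g) (star (tensorKet m)) := by
    ext x y
    simp [tensorOp, tensorKet, vecMulVec_apply, Finset.prod_mul_distrib]
  rw [h, vecMulVec_star_mulVec]

/-- With every site measured, a rank-one operator acts everywhere, and the squared overlap is the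
weight. The qubits are again in a product of unit vectors, so the next computation starts from data
of the same form. -/
lemma run_computation {T : ℕ} (hT : 1 ≤ T) {a : Memory v n w} (ha : a.status = .waiting)
    (k : Fin (v + 1)) (β : Vertex n w → Fin 2 → ℂ) (hβ : ∀ u, IsUnitKet (β u)) (q : Fin 2)
    (κ : ZMod 8 → Fin 2 → ℂ) (hκ : ∀ τ, IsUnitKet (κ τ)) :
    ∃ (β' : (Vertex n w → Fin 2) → Vertex n w → Fin 2 → ℂ) (q' : Fin 2)
      (κ' : (Vertex n w → Fin 2) → ZMod 8 → Fin 2 → ℂ),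
      (∀ s u, IsUnitKet (β' s u)) ∧ (∀ s τ, IsUnitKet (κ' s τ)) ∧
      (computation T k).run (branch a (tens (tensorKet β) (comKet q (tensorKet κ)))) =
        ∑ s, (outcomeWeight a k s : ℂ) • branch (a.afterComputation k s)
          (tens (tensorKet (β' s)) (comKet q' (tensorKet (κ' s)))) := by
  obtain ⟨q', κ₁, hκ₁, h₁⟩ := run_preparations hT ha k (verticesByRow n w) β hβ q κ hκ
  simp only [mem_verticesByRow, if_true] at h₁
  obtain ⟨g, κ', hg, hκ', h₂⟩ := run_measurements k (verticesByCol n w) nodup_verticesByCol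
    pairwise_verticesByCol a (cZ linked *ᵥ tensorKet fun u => ketXY (a.prepAngle k u) 0) q' κ₁ hκ₁
  refine ⟨g, q', κ', fun s u => hg s u (mem_verticesByCol u), hκ', ?_⟩
  rw [computation_eq, run_append, run_append, run_append, h₁, run_bobStep_cons, run_nil,
    entangleStep_branch, h₂, run_sum]
  simp only [mem_verticesByCol, not_true_eq_false, false_imp_iff, implies_true,
    Finset.filter_true, if_true]
  refine Finset.sum_congr rfl fun s _ => ?_
  rw [run_aliceStep_cons, verifyStep_branch, run_nil, tensorOp_vecMulVec_mulVec, tens_smul_left,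
    branch_smul]
  have h := norm_overlap_measured_sq (a.withOutcomes k s) k
  simp only [Memory.withOutcomes_s] at h
  change ‖star (tensorKet fun u => ketXY ((a.withOutcomes k s).δ k u) (s u + a.tape.r k u)) ⬝ᵥ
    (cZ linked *ᵥ tensorKet fun u => ketXY (a.prepAngle k u) 0)‖ ^ 2 = outcomeWeight a k s at h
  rw [h]
  rfl

/-! ### The output -/

lemma sum_norm_sq_targetAmplitude (φ : Vertex n w → ZMod 8) :
    ∑ o, ((‖targetAmplitude φ o‖ ^ 2 : ℝ) : ℂ) = 1 := by
  rw [← sum_targetAmplitude φ]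
  refine Finset.sum_congr rfl fun o _ => ?_
  rw [Complex.star_def, ← Complex.normSq_eq_conj_mul_self, Complex.normSq_eq_norm_sq]

/-- Each last column is shared by `2^(4wn)` records, which cancels the uniform factor and leaves the
Born distribution. -/
lemma sum_outcomeWeight_smul {E : Type*} [AddCommGroup E] [Module ℂ E] (a : Memory v n w)
    (k : Fin (v + 1)) (F : (Fin n → Fin 2) → E) :
    ∑ s, (outcomeWeight a k s : ℂ) • F (fun i => s (i, Fin.last _)) =
      ∑ o, ((‖targetAmplitude (a.angle k) o‖ ^ 2 : ℝ) : ℂ) • F o := by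
  have h := sum_last_column (w := w) fun o =>
    ((((2 : ℝ) ^ (4 * w * n))⁻¹ * ‖targetAmplitude (a.angle k) o‖ ^ 2 : ℝ) : ℂ) • F o
  refine h.trans ?_
  rw [Finset.smul_sum]
  refine Finset.sum_congr rfl fun o _ => ?_
  rw [← Nat.cast_smul_eq_nsmul ℂ, smul_smul]
  congr 1
  push_cast
  rw [← mul_assoc, mul_inv_cancel₀ (pow_ne_zero _ two_ne_zero), one_mul]

lemma sum_outcomeWeight (a : Memory v n w) (k : Fin (v + 1)) :
    ∑ s, (outcomeWeight a k s : ℂ) = 1 := by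
  have h := sum_outcomeWeight_smul a k fun _ => (1 : ℂ)
  simpa [sum_norm_sq_targetAmplitude] using h.trans (by
    simpa using sum_norm_sq_targetAmplitude (a.angle k))

/-- The state of Alice's register after the accepted output `o`. -/
def acceptedState (v w : ℕ) (o : Fin n → Fin 2) : Matrix (Memory v n w) (Memory v n w) ℂ :=
  Matrix.single (Memory.final v w (some o)) (Memory.final v w (some o)) 1

/-- The remaining computations `ks`, when nothing has been rejected so far, give the accepted
outcomes of the target: with the Born probabilities if the target is still to be computed, and
those recorded in the memory otherwise. -/
lemma traceBC_run_computations (hw : 1 ≤ w) {T : ℕ} (hT : 1 ≤ T) (ks : List (Fin (v + 1)))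
    (hks : ks.Nodup) {a : Memory v n w} (ha : a.status = .waiting) (hrej : a.rejected = false)
    (β : Vertex n w → Fin 2 → ℂ) (hβ : ∀ u, IsUnitKet (β u)) (q : Fin 2)
    (κ : ZMod 8 → Fin 2 → ℂ) (hκ : ∀ τ, IsUnitKet (κ τ)) :
    traceBC (Protocol.run ((ks.flatMap fun k => computation T k) ++ [aliceStep outputStep])
      (branch a (tens (tensorKet β) (comKet q (tensorKet κ))))) =
      if a.tape.vt ∈ ks then
        ∑ o, ((‖targetAmplitude a.φ o‖ ^ 2 : ℝ) : ℂ) • acceptedState v w o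
      else acceptedState v w fun i => a.s a.tape.vt (i, Fin.last _) := by
  induction ks generalizing a β q κ with
  | nil =>
    rw [List.flatMap_nil, List.nil_append, run_aliceStep_cons, run_nil, outputStep_branch, hrej,
      traceBC_branch _ ((IsUnitKet.tensorKet hβ).tens (isUnitKet_comKet q (.tensorKet hκ)))]
    simp [acceptedState]
  | cons k ks ih =>
    rw [List.nodup_cons] at hks
    obtain ⟨β', q', κ', hβ', hκ', h⟩ := run_computation hT ha k β hβ q κ hκ
    rw [List.flatMap_cons, List.append_assoc, run_append, h, run_sum, traceBC_sum]
    have hs : ∀ s, traceBC (Protocol.run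
        ((ks.flatMap fun k => computation T k) ++ [aliceStep outputStep])
        ((outcomeWeight a k s : ℂ) • branch (a.afterComputation k s)
          (tens (tensorKet (β' s)) (comKet q' (tensorKet (κ' s)))))) =
        (outcomeWeight a k s : ℂ) • if a.tape.vt ∈ ks then
          ∑ o, ((‖targetAmplitude a.φ o‖ ^ 2 : ℝ) : ℂ) • acceptedState v w o
        else acceptedState v w fun i =>
          (a.withOutcomes k s).s a.tape.vt (i, Fin.last _) := by
      intro s
      rw [run_smul, traceBC_smul]
      by_cases hfail : (a.withOutcomes k s).fails k
      -- A branch with a failed trap has weight zero, so its continuation is irrelevant.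
      · obtain ⟨hk, i, hi⟩ := hfail
        have h0 : outcomeWeight a k s = 0 := by
          rw [outcomeWeight, targetAmplitude_trap hw a hk]
          · simp
          · refine Function.ne_iff.2 ⟨i, ?_⟩
            simpa using hi
        simp [h0]
      · congr 1
        have hrej' : (a.afterComputation k s).rejected = false := by
          simp only [Memory.afterComputation, hrej, hfail, decide_false, Bool.or_false]
        exact ih hks.2 (a := a.afterComputation k s) ha hrej' (β' s) (hβ' s) q' (κ' s) (hκ' s)
    simp only [hs]
    -- If `k` is the target, it does not recur in `ks`, and the sum over its records is the Born
    -- distribution. A trap leaves the target's record untouched, and its weights sum to one.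
    by_cases hk : a.tape.vt = k
    · have hmem : a.tape.vt ∉ ks := hk ▸ hks.1
      have hang : a.angle k = a.φ := by rw [Memory.angle, if_pos hk.symm]
      simp only [if_neg hmem]
      rw [if_pos (by simp [hk]), ← hang, ← sum_outcomeWeight_smul]
      simp only [hk, Memory.withOutcomes_s]
    · have hcond : a.tape.vt ∈ k :: ks ↔ a.tape.vt ∈ ks := by simp [hk]
      have hold : ∀ s, (a.withOutcomes k s).s a.tape.vt = a.s a.tape.vt := fun s =>
        Function.update_of_ne hk _ _
      simp only [hold, hcond]
      rw [← Finset.sum_smul, sum_outcomeWeight, one_smul]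

/-! ### The target channel -/

section Target

variable {A B C : Type} [Fintype A] [DecidableEq A] [Fintype B] [DecidableEq B]
  [Fintype C] [DecidableEq C]

lemma liftA_single_mulVec_branchKet (c : ℂ) (a a₁ a₂ : A) (ψ : B × C → ℂ) :
    liftA (Matrix.single a₂ a₁ c) *ᵥ branchKet a ψ =
      if a₁ = a then branchKet a₂ (c • ψ) else 0 := by
  ext ⟨a', x⟩
  have hL : (if a₁ = a then branchKet a₂ (c • ψ) else 0) (a', x) =
      if a₁ = a ∧ a₂ = a' then c * ψ x else 0 := by
    by_cases h : a₁ = a <;> simp [h, branchKet, eq_comm]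
  rw [hL]
  simp only [mulVec, dotProduct, liftA, branchKet, Matrix.of_apply,
    Fintype.sum_prod_type (α₁ := A), Matrix.single_apply]
  rw [Finset.sum_eq_single a, Finset.sum_eq_single x]
  · simp [and_comm, ite_and]
  · intro y _ hy
    simp [Ne.symm hy]
  · simp
  · intro b _ hb
    simp [hb]
  · simp

lemma applyA_sum (E : KrausMap A) {I : Type*} (s : Finset I)
    (ρ : I → Matrix (A × B × C) (A × B × C) ℂ) :
    E.applyA (∑ i ∈ s, ρ i) = ∑ i ∈ s, E.applyA (ρ i) := by
  simp only [KrausMap.applyA, Finset.mul_sum, Finset.sum_mul]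
  exact Finset.sum_comm

lemma applyA_smul (E : KrausMap A) (c : ℂ) (ρ : Matrix (A × B × C) (A × B × C) ℂ) :
    E.applyA (c • ρ) = c • E.applyA ρ := by
  simp [KrausMap.applyA, Finset.smul_sum]

end Target

lemma traceBC_targetChannel_branch (a : Memory v n w) {ψ : BobReg n w × ComReg → ℂ}
    (hψ : IsUnitKet ψ) :
    traceBC ((targetChannel v n w).applyA (branch a ψ)) =
      ∑ o, ((‖targetAmplitude a.φ o‖ ^ 2 : ℝ) : ℂ) • acceptedState v w o := by
  have h : (targetChannel v n w).applyA (branch a ψ) =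
      ∑ u : Memory v n w × (Fin n → Fin 2),
        liftA (Matrix.single (Memory.final v w (some u.2)) u.1 (targetAmplitude u.1.φ u.2)) *
          branch a ψ *
        (liftA (Matrix.single (Memory.final v w (some u.2)) u.1
          (targetAmplitude u.1.φ u.2)))ᴴ := rfl
  rw [h, Fintype.sum_prod_type, Finset.sum_eq_single a, traceBC_sum]
  · refine Finset.sum_congr rfl fun o _ => ?_
    rw [branch, mul_vecMulVec_mul_conjTranspose, liftA_single_mulVec_branchKet, if_pos rfl]
    change traceBC (branch _ _) = _
    rw [branch_smul, traceBC_smul, traceBC_branch _ hψ, acceptedState]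
  · intro b _ hb
    refine Finset.sum_eq_zero fun o _ => ?_
    rw [branch, mul_vecMulVec_mul_conjTranspose, liftA_single_mulVec_branchKet, if_neg hb]
    ext x y
    simp [vecMulVec_apply]
  · simp

/-! ### Correctness -/

lemma tensorKet_single {J : Type} [Fintype J] [DecidableEq J] :
    tensorKet (fun _ : J => Pi.single 0 1) = Pi.single 0 1 := by
  ext x
  rw [tensorKet]
  by_cases h : x = 0
  · simp [h]
  · obtain ⟨i, hi⟩ := Function.ne_iff.1 h
    rw [Finset.prod_eq_zero (Finset.mem_univ i), Pi.single_eq_of_ne h]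
    exact Pi.single_eq_of_ne hi 1

lemma inputState_eq (v : ℕ) (φ : Vertex n w → ZMod 8) :
    inputState v φ = ∑ τ : Tape v n w, (Fintype.card (Tape v n w) : ℂ)⁻¹ •
      branch (Memory.init φ τ) (tens (tensorKet fun _ => Pi.single 0 1)
        (comKet 0 (tensorKet fun _ => Pi.single 0 1))) := by
  refine Finset.sum_congr rfl fun τ _ => ?_
  congr 1
  have h : ∀ x : Memory v n w × BobReg n w × ComReg, branchKet (Memory.init φ τ)
      (tens (tensorKet fun _ => Pi.single 0 1) (comKet 0 (tensorKet fun _ => Pi.single 0 1))) x =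
      if x = (Memory.init φ τ, 0, 0) then 1 else 0 := by
    rintro ⟨a, b, p, c⟩
    rw [tensorKet_single, tensorKet_single]
    simp only [branchKet, tens, comKet, Pi.single_apply, Prod.mk.injEq, Prod.mk_eq_zero]
    by_cases h1 : a = Memory.init φ τ <;> by_cases h2 : b = 0 <;> by_cases h3 : p = 0 <;>
      by_cases h4 : c = 0 <;> simp [h1, h2, h3, h4]
  ext x y
  rw [branch, vecMulVec_apply, Pi.star_apply, h, h, Matrix.single_apply]
  by_cases hx : x = (Memory.init φ τ, 0, 0) <;> by_cases hy : y = (Memory.init φ τ, 0, 0) <;>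
    simp [hx, hy, eq_comm]

lemma traceDistance_self {ι : Type} [Fintype ι] [DecidableEq ι] (ρ : Matrix ι ι ℂ) :
    traceDistance ρ ρ = 0 := by
  simp [traceDistance]

end Correctness

end BrickworkVerification

end

theorem theorem5 (v n w T : ℕ) (hw : 1 ≤ w) (hT : 1 ≤ T)
    (φ : BrickworkVerification.Vertex n w → ZMod 8) :
    (BrickworkVerification.measurementProtocol v n w T).IsCorrect
      (BrickworkVerification.targetChannel v n w)
      (BrickworkVerification.inputState v φ) := by
  open BrickworkVerification in
  have h : traceBC ((targetChannel v n w).applyA (inputState v φ)) =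
      traceBC ((measurementProtocol v n w T).run (inputState v φ)) := by
    rw [inputState_eq, applyA_sum, run_sum, traceBC_sum, traceBC_sum]
    -- The two sides agree for each value `τ` of the random choices separately.
    refine Finset.sum_congr rfl fun τ _ => ?_
    have hβ : ∀ u : Vertex n w, IsUnitKet (Pi.single 0 1 : Fin 2 → ℂ) := fun _ =>
      isUnitKet_single 0
    have hκ : ∀ τ : ZMod 8, IsUnitKet (Pi.single 0 1 : Fin 2 → ℂ) := fun _ => isUnitKet_single 0
    rw [applyA_smul, run_smul, traceBC_smul, traceBC_smul, measurementProtocol,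
      traceBC_run_computations hw hT _ (List.nodup_finRange _) rfl rfl _ hβ 0 _ hκ,
      traceBC_targetChannel_branch _
        ((IsUnitKet.tensorKet hβ).tens (isUnitKet_comKet 0 (.tensorKet hκ))),
      if_pos (List.mem_finRange _)]
  rw [BrickworkVerification.Protocol.IsCorrect, h, BrickworkVerification.traceDistance_self]
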